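/- **Setting.** Let $V$ be a real inner product space of finite dimension $d$, and let $E\subseteq V$ be a closed set that contains an affine basis of $V$ ($d+1$ affinely independent points). Let $E_\Delta=E\cup\{\Delta\}$ with an added cemetery point $\Delta$ and the $\sigma$-algebra $\mathcal E_\Delta$ generated by the Borel sets of $E$ and $\{\Delta\}$. For $u\in V+iV$ let $\langle u,x\rangle$ be the complex-linear (in $u$) extension of the inner product, let $f_u(x)=e^{\langle u,x\rangle}$ for $x\in E$ and $f_u(\Delta)=0$, and put $$\mathcal U=\{u\in V+iV:\ f_u \text{ is bounded on } E\},\qquad \mathcal U_k=\{u\in V+iV:\ \sup_{x\in E}|f_u(x)|\le k\}\quad(k\in\mathbb N).$$ A *transition function* is a family $\{P_{s,t}\}_{0\le s\le t}$ of Markov kernels on $E_\Delta$ with $P_{s,s}(x,\cdot)=\delta_x$, $P_{s,u}P_{u,t}=P_{s,t}$ for $s<u<t$, and $P_{s,t}(\Delta,\cdot)=\delta_\Delta$. It is *continuously affine* if there are functions $\Phi_{s,t}:\mathcal U\to\mathbb C$ and $\psi_{s,t}:\mathcal U\to V+iV$ $(0\le s\le t)$ with $$P_{s,t}f_u(x)=\Phi_{s,t}(u)\,e^{\langle\psi_{s,t}(u),x\rangle}\qquad(0\le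 s\le t,\ u\in\mathcal U,\ x\in E)$$ such that, with $\mathcal Q_k=\{(t,T,u):0\le t\le T,\ u\in\mathcal U_k,\ \Phi_{v,T}(u)\ne0\text{ for all } v\in[t,T]\}$ and for every $k\in\mathbb N$: $\psi$ is continuous on $\mathcal Q_k$ and $\psi_{0,0}(0)=0$; there is a function $\phi$ on $\bigcup_k\mathcal Q_k$, continuous on each $\mathcal Q_k$, with $e^{\phi_{t,T}(u)}=\Phi_{t,T}(u)$; and $\Phi$ as well as, for each $x\in E$, the map $(t,T,u)\mapsto P_{t,T}f_u(x)$ are continuous on $\{(t,T,u):0\le t\le T,\ u\in\mathcal U_k\}$. Let $X=(X_t)_{t\ge0}$ be an $E_\Delta$-valued process on a measurable space $(\Omega,\mathcal A)$ with natural filtration $\mathcal F=\mathcal F^X$, $\mathcal F^X_t=\sigma(X_s,\,s\le t)$, and $\mathcal A=\mathcal F^X_\infty=\sigma(X_s,\,s\ge0)$, such that $X_s=\Delta$ implies $X_t=\Delta$ for all $t>s$. For a probability measure $\mathbb P$ on $\mathcal A$ let the completed filtration be $$\mathcal F^{\mathbb P}_t=\{A\subseteq\Omega:\ \exists B\in\mathcal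 F_t\ \text{such that } A\,\triangle\,B \text{ is a } \mathbb P\text{-null set}\}.$$ **Theorem.** Let $\{P_{s,t}\}$ be a continuously affine transition function. 1. If $\mathbb P$ is a probability measure under which $X$ is a Markov process with transition function $\{P_{s,t}\}$, i.e. $\mathbb E[f(X_t)\mid\mathcal F_s]=P_{s,t}f(X_s)$ a.s. for all $s<t$ and all bounded measurable $f:E_\Delta\to\mathbb R$, then $\mathcal F^{\mathbb P}$ is right-continuous: $\mathcal F^{\mathbb P}_t=\bigcap_{s>t}\mathcal F^{\mathbb P}_s$ for all $t\ge0$. 2. If $\{\mathbb P^{(r,x)}\}_{r\ge0,\,x\in E_\Delta}$ is a family of probability measures such that $(X,\mathcal F,\{\mathbb P^{(r,x)}\})$ is a Markov process with transition function $\{P_{s,t}\}$, i.e. $\mathbb P^{(r,x)}(X_0=x)=1$, $P_{s,s+t}(x,B)=\mathbb P^{(s,x)}(X_t\in B)$ for $B\in\mathcal E_\Delta$, and $\mathbb E^{(r,x)}[f(X_{t+s})\mid\mathcal F_s]=P_{r+s,r+s+t}f(X_s)$ $\mathbb P^{(r,x)}$-a.s. for all $r,s,t\ge0$ and all bounded measurable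 $f:E_\Delta\to\mathbb R$, then for all $r\ge0$ and $x\in E_\Delta$ the completed filtration $\mathcal F^{\mathbb P^{(r,x)}}$ is right-continuous. -/

import Mathlib

open MeasureTheory ProbabilityTheory Set Filter
open scoped NNReal OnePoint Topology

noncomputable section

namespace AffineProcess

/-! ### Markov processes with a cemetery point

The state space is `OnePoint E`, i.e. `E` together with the cemetery point `∞`. -/

section Markov

variable {E : Type*} [MeasurableSpace E] {Ω : Type*}

/-- The σ-algebra generated by the measurable subsets of `E` and by the singleton `{∞}`: a set
is measurable if and only if its trace on `E` is. -/
instance cemeteryMeasurableSpace : MeasurableSpace (OnePoint E) :=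
  MeasurableSpace.map (fun x : E => (x : OnePoint E)) inferInstance

/-- A (time-inhomogeneous) transition function on `E` with the cemetery point added. Only the
kernels `kernel s t` with `s ≤ t` are meaningful. -/
structure TransitionFunction (E : Type*) [MeasurableSpace E] where
  kernel : ℝ≥0 → ℝ≥0 → Kernel (OnePoint E) (OnePoint E)
  isMarkovKernel : ∀ s t, s ≤ t → IsMarkovKernel (kernel s t)
  absorbing : ∀ s t, s ≤ t → kernel s t ∞ = Measure.dirac ∞
  refl : ∀ s, kernel s s = Kernel.id
  comp : ∀ s u t, s < u → u < t → (kernel u t) ∘ₖ (kernel s u) = kernel s t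

/-- The process stays in the cemetery once it has arrived there. -/
def StaysInCemetery (X : ℝ≥0 → Ω → OnePoint E) : Prop :=
  ∀ ω s t, s < t → X s ω = ∞ → X t ω = ∞

/-- `X` is a Markov process on the filtered probability space `(Ω, mΩ, ℱ, μ)` with transition
function `P`. -/
structure IsMarkovProcess {mΩ : MeasurableSpace Ω} (X : ℝ≥0 → Ω → OnePoint E)
    (ℱ : Filtration ℝ≥0 mΩ) (μ : Measure Ω) (P : TransitionFunction E) : Prop where
  isProbabilityMeasure : IsProbabilityMeasure μ
  adapted : ∀ t, Measurable[ℱ t] (X t)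
  staysInCemetery : StaysInCemetery X
  markov : ∀ s t, s < t → ∀ f : OnePoint E → ℝ, Measurable f → (∃ C, ∀ y, |f y| ≤ C) →
    μ[fun ω => f (X t ω) | ℱ s] =ᵐ[μ] fun ω => ∫ y, f y ∂(P.kernel s t (X s ω))

/-- `(X, ℱ, {Pr r x})` is a Markov process given through the family of probability measures
`Pr r x` (start in the state `x` at the absolute time `r`; `X t` is the state at time `r + t`),
with transition function `P`. -/
structure IsMarkovFamily {mΩ : MeasurableSpace Ω} (X : ℝ≥0 → Ω → OnePoint E)
    (ℱ : Filtration ℝ≥0 mΩ) (Pr : ℝ≥0 → OnePoint E → Measure Ω)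
    (P : TransitionFunction E) : Prop where
  isProbabilityMeasure : ∀ r x, IsProbabilityMeasure (Pr r x)
  adapted : ∀ t, Measurable[ℱ t] (X t)
  staysInCemetery : StaysInCemetery X
  start : ∀ r x, Pr r x {ω | X 0 ω = x} = 1
  law : ∀ s t x (B : Set (OnePoint E)), MeasurableSet B →
    P.kernel s (s + t) x B = Pr s x (X t ⁻¹' B)
  markov : ∀ r x s t, ∀ f : OnePoint E → ℝ, Measurable f → (∃ C, ∀ y, |f y| ≤ C) →
    (Pr r x)[fun ω => f (X (t + s) ω) | ℱ s] =ᵐ[Pr r x]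
      fun ω => ∫ y, f y ∂(P.kernel (r + s) (r + s + t) (X s ω))

/-- The σ-algebra `ℱ^X_∞` generated by the whole process. -/
abbrev processSigma (X : ℝ≥0 → Ω → OnePoint E) : MeasurableSpace Ω :=
  ⨆ t, MeasurableSpace.comap (X t) inferInstance

/-- The natural filtration `ℱ^X_t = σ(X_s, s ≤ t)`. -/
def naturalFiltration {mΩ : MeasurableSpace Ω} (X : ℝ≥0 → Ω → OnePoint E)
    (hX : ∀ t, Measurable (X t)) : Filtration ℝ≥0 mΩ where
  seq t := ⨆ s ≤ t, MeasurableSpace.comap (X s) inferInstance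
  mono' _ _ hij := biSup_mono fun _ => ge_trans hij
  le' _ := iSup₂_le fun s _ => (hX s).comap_le

/-- The completed filtration `ℱ^μ`, a filtration of the `μ`-completion of `mΩ`: a set `A`
belongs to `ℱ^μ_t` if and only if there is `B ∈ ℱ_t` such that the symmetric difference of `A`
and `B` is a `μ`-null set. -/
def completedFiltration {mΩ : MeasurableSpace Ω} (ℱ : Filtration ℝ≥0 mΩ) (μ : Measure Ω) :
    Filtration ℝ≥0 (eventuallyMeasurableSpace mΩ (ae μ)) where
  seq t := eventuallyMeasurableSpace (ℱ t) (ae μ)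
  mono' := by
    rintro s t hst A ⟨B, hB, hAB⟩
    exact ⟨B, ℱ.mono hst B hB, hAB⟩
  le' := by
    rintro t A ⟨B, hB, hAB⟩
    exact ⟨B, ℱ.le t B hB, hAB⟩

end Markov

/-! ### Affine transition functions

`V` is a finite-dimensional real inner product space. The complexification `V + iV` is modelled
by `V × V`, the pair `(a, b)` standing for `a + i b`. -/

section Affine

variable {V : Type*} [NormedAddCommGroup V] [InnerProductSpace ℝ V]

/-- The bilinear pairing `⟨u, x⟩` of `u ∈ V + iV` with `x ∈ V`. -/
def pairing (u : V × V) (x : V) : ℂ :=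
  ((inner ℝ u.1 x : ℝ) : ℂ) + ((inner ℝ u.2 x : ℝ) : ℂ) * Complex.I

/-- `𝒰_k`: the `u ∈ V + iV` with `|exp ⟨u, x⟩| ≤ k` for all `x ∈ E`. -/
def expBoundedBy (E : Set V) (k : ℕ) : Set (V × V) :=
  {u | ∀ x ∈ E, ‖Complex.exp (pairing u x)‖ ≤ k}

/-- `𝒰`: the `u ∈ V + iV` for which `x ↦ exp ⟨u, x⟩` is bounded on `E`. -/
def expBounded (E : Set V) : Set (V × V) :=
  {u | ∃ C : ℝ, ∀ x ∈ E, ‖Complex.exp (pairing u x)‖ ≤ C}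

/-- The function `f_u(x) = exp ⟨u, x⟩` on `E`, extended by `f_u(∞) = 0`. -/
def expFun {E : Set V} (u : V × V) (y : OnePoint E) : ℂ :=
  y.elim 0 fun x => Complex.exp (pairing u (x : V))

variable [MeasurableSpace V] {E : Set V}

/-- The transition operator applied to `f_u`, i.e. `P_{s,t} f_u (x)`. -/
def TransitionFunction.expTransform (P : TransitionFunction E) (s t : ℝ≥0) (u : V × V)
    (x : OnePoint E) : ℂ :=
  ∫ y, expFun u y ∂(P.kernel s t x)

/-- `P` is affine with parameter functions `Φ` and `ψ`. -/
def TransitionFunction.IsAffineWith (P : TransitionFunction E)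
    (Φ : ℝ≥0 → ℝ≥0 → V × V → ℂ) (ψ : ℝ≥0 → ℝ≥0 → V × V → V × V) : Prop :=
  ∀ s t, s ≤ t → ∀ u ∈ expBounded E, ∀ x : E,
    P.expTransform s t u (x : OnePoint E)
      = Φ s t u * Complex.exp (pairing (ψ s t u) (x : V))

/-- The set of all `(t, T, u)` with `0 ≤ t ≤ T` and `u ∈ 𝒰_k`. -/
def timeParam (E : Set V) (k : ℕ) : Set (ℝ≥0 × ℝ≥0 × (V × V)) :=
  {p | p.1 ≤ p.2.1 ∧ p.2.2 ∈ expBoundedBy E k}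

/-- `𝒬_k`: the `(t, T, u)` with `0 ≤ t ≤ T`, `u ∈ 𝒰_k` and `Φ_{v,T}(u) ≠ 0` for
`t ≤ v ≤ T`. -/
def nonvanishing (E : Set V) (Φ : ℝ≥0 → ℝ≥0 → V × V → ℂ) (k : ℕ) :
    Set (ℝ≥0 × ℝ≥0 × (V × V)) :=
  {p | p ∈ timeParam E k ∧ ∀ v, p.1 ≤ v → v ≤ p.2.1 → Φ v p.2.1 p.2.2 ≠ 0}

/-- `P` is a continuously affine transition function. -/
def TransitionFunction.IsContinuouslyAffine (P : TransitionFunction E) : Prop :=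
  ∃ (Φ : ℝ≥0 → ℝ≥0 → V × V → ℂ) (ψ : ℝ≥0 → ℝ≥0 → V × V → V × V)
    (φ : ℝ≥0 → ℝ≥0 → V × V → ℂ),
    P.IsAffineWith Φ ψ ∧
    (∀ k, ∀ p ∈ nonvanishing E Φ k,
      Complex.exp (φ p.1 p.2.1 p.2.2) = Φ p.1 p.2.1 p.2.2) ∧
    ψ 0 0 0 = 0 ∧
    (∀ k, ContinuousOn (fun p : ℝ≥0 × ℝ≥0 × (V × V) => ψ p.1 p.2.1 p.2.2)
      (nonvanishing E Φ k)) ∧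
    (∀ k, ContinuousOn (fun p : ℝ≥0 × ℝ≥0 × (V × V) => φ p.1 p.2.1 p.2.2)
      (nonvanishing E Φ k)) ∧
    (∀ k, ContinuousOn (fun p : ℝ≥0 × ℝ≥0 × (V × V) => Φ p.1 p.2.1 p.2.2)
      (timeParam E k)) ∧
    (∀ k, ∀ x : E, ContinuousOn (fun p : ℝ≥0 × ℝ≥0 × (V × V) =>
      P.expTransform p.1 p.2.1 p.2.2 (x : OnePoint E)) (timeParam E k))

end Affine

end AffineProcess

end

set_option linter.unusedSectionVars false

namespace AffineProcess

/-! ### State space with cemetery, the exponentials f_u and their domains. -/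

section OnePoint

variable {E : Type*} [MeasurableSpace E]

/-! Call A a germ event at t if it lies in the completion of F_s for every s > t. The heart of the
matter is the Markov property at time t on germ events (`IsAffineData.map_restrict_germ_eq`): the
law of X_s on A is the law of X_t on A, transported by P_{t,s}. Once this is known, a germ event is
conditionally independent of the future given F_t, so its conditional probability given F_t is
already its indicator (`HasGermMarkovProperty.exists_measurableSet_ae_eq`).

The Markov property is tested on the functions f_u. If Φ_{t,s}(u) ≠ 0, then P_{r,s}f_u(X_r)
converges in L² to P_{t,s}f_u(X_t) as r ↓ t: since |f_u|² is again an exponential, the second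
moments are given by the affine formula and are continuous
(`IsAffineData.integral_expFun_germ_of_ne_zero`). If Φ_{r,s}(u) = 0 for some r in (t, s], both sides
vanish. The hard case is Φ_{r,s}(u) ≠ 0 for all r in (t, s] but Φ_{t,s}(u) = 0, where ψ_{r,s}(u) may
escape to infinity as r ↓ t.

The way out is the neutral space, the orthogonal complement of all vectors a with ⟨a, ·⟩ bounded
above on E. Transforms of finite measures are holomorphic along complex lines that stay in the
domain, so their values near a point iq with q neutral determine their values at every u whose
imaginary part has neutral component q (`integral_expFun_eq_of_eqOn`). Hence it is enough that the
neutral component of Im ψ_{r,s}(u) stays bounded (`IsAffineData.exists_norm_neutralPart_psi_le`,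
used in `IsAffineData.integral_expFun_eq_of_nonvanishing`).

For this bound, note that Re ψ is orthogonal to the neutral space. The neutral component of ψ along
a complex line is therefore holomorphic with zero real part, thus constant, and it depends only on
the neutral component of the argument (`IsAffineData.inner_psi_snd_eq`). So ψ induces a flow on the
neutral space. This flow is additive in short time (`IsAffineData.exists_neutralFlow_add`); a large
argument can then be divided by an integer, moved inside a fixed ball, and multiplied back.

Additivity comes from infinitesimal divisibility. Over a short step the characteristic function is
close to the unit circle and its phase is additive up to a multiple of the loss of modulus
(`abs_im_log_defect_le`). Defect and loss are affine in the starting point x, and an affine function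
that is nonnegative on a large finite part of E has a neutral slope that is tiny compared with its
values on an affine basis (`exists_finset_norm_slope_le`). Thus the defect of the neutral flow in
one step is at most η times the loss, with η as small as desired. The losses over any partition have
a sum bounded independently of the partition, because each is controlled by the increment of a
bounded increasing energy, the mean squared modulus of the prediction of f_θ(X_s)
(`IsAffineData.exists_sum_loss_le`). Stability of the additive functional equation replaces each
step by a linear map, and the product of these maps is close to the whole flow
(`norm_flow_sub_leftProd_le`); letting η tend to 0 gives exact additivity. -/

lemma measurable_of_coe {β : Type*} [MeasurableSpace β] {f : OnePoint E → β}
    (h : Measurable fun x : E => f x) : Measurable f := fun _ hs => h hs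

lemma measurable_coe_onePoint : Measurable fun x : E => (x : OnePoint E) := fun _ hs => hs

end OnePoint

section Pairing

variable {V : Type*} [NormedAddCommGroup V] [InnerProductSpace ℝ V]

lemma pairing_re (u : V × V) (x : V) : (pairing u x).re = inner ℝ u.1 x := by
  simp [pairing]

lemma pairing_im (u : V × V) (x : V) : (pairing u x).im = inner ℝ u.2 x := by
  simp [pairing]

lemma norm_exp_pairing (u : V × V) (x : V) :
    ‖Complex.exp (pairing u x)‖ = Real.exp (inner ℝ u.1 x) := by
  rw [Complex.norm_exp, pairing_re]

lemma pairing_add (u v : V × V) (x : V) : pairing (u + v) x = pairing u x + pairing v x := by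
  simp [pairing, inner_add_left]; ring

lemma pairing_sub (u v : V × V) (x : V) : pairing (u - v) x = pairing u x - pairing v x := by
  simp [pairing, inner_sub_left]; ring

lemma pairing_sub_right (u : V × V) (x y : V) :
    pairing u (x - y) = pairing u x - pairing u y := by
  simp [pairing, inner_sub_right]; ring

@[simp] lemma pairing_zero (x : V) : pairing (0 : V × V) x = 0 := by simp [pairing]

lemma norm_pairing_le (u : V × V) (x : V) : ‖pairing u x‖ ≤ 2 * ‖u‖ * ‖x‖ := by
  have h1 : |inner ℝ u.1 x| ≤ ‖u‖ * ‖x‖ :=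
    (abs_real_inner_le_norm _ _).trans (by gcongr; exact norm_fst_le u)
  have h2 : |inner ℝ u.2 x| ≤ ‖u‖ * ‖x‖ :=
    (abs_real_inner_le_norm _ _).trans (by gcongr; exact norm_snd_le u)
  calc ‖pairing u x‖ ≤ |(pairing u x).re| + |(pairing u x).im| := Complex.norm_le_abs_re_add_abs_im _
    _ ≤ 2 * ‖u‖ * ‖x‖ := by rw [pairing_re, pairing_im]; linarith

lemma continuous_pairing_left (x : V) : Continuous fun u : V × V => pairing u x := by
  unfold pairing; fun_prop

lemma continuous_pairing_right (u : V × V) : Continuous fun x : V => pairing u x := by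
  unfold pairing; fun_prop

/-- Multiplication by a complex scalar on the complexification `V × V`. -/
def complexSMul (z : ℂ) (u : V × V) : V × V :=
  (z.re • u.1 - z.im • u.2, z.re • u.2 + z.im • u.1)

lemma pairing_complexSMul (z : ℂ) (u : V × V) (x : V) :
    pairing (complexSMul z u) x = z * pairing u x := by
  apply Complex.ext
  · simp [pairing_re, pairing_im, complexSMul, inner_sub_left, inner_smul_left]
  · simp [pairing_re, pairing_im, complexSMul, inner_add_left, inner_smul_left]

lemma continuous_complexSMul (u : V × V) : Continuous fun z : ℂ => complexSMul z u := by
  unfold complexSMul; fun_prop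

variable {E : Set V}

lemma expBoundedBy_subset (k : ℕ) : expBoundedBy E k ⊆ expBounded E := fun _ hu => ⟨k, hu⟩

lemma expBoundedBy_mono {k l : ℕ} (h : k ≤ l) : expBoundedBy E k ⊆ expBoundedBy E l :=
  fun _ hu x hx => (hu x hx).trans (by exact_mod_cast h)

lemma mem_expBoundedBy {u : V × V} {k : ℕ} :
    u ∈ expBoundedBy E k ↔ ∀ x ∈ E, Real.exp (inner ℝ u.1 x) ≤ k := by
  simp [expBoundedBy, norm_exp_pairing]

lemma mem_expBounded {u : V × V} :
    u ∈ expBounded E ↔ ∃ C : ℝ, ∀ x ∈ E, inner ℝ u.1 x ≤ C := by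
  simp only [expBounded, norm_exp_pairing, mem_ofPred_eq]
  constructor
  · rintro ⟨C, hC⟩
    refine ⟨C, fun x hx => ?_⟩
    have := hC x hx
    have h2 := Real.add_one_le_exp (inner ℝ u.1 x)
    linarith
  · rintro ⟨C, hC⟩
    exact ⟨Real.exp C, fun x hx => Real.exp_le_exp.2 (hC x hx)⟩

lemma exists_mem_expBoundedBy {u : V × V} (hu : u ∈ expBounded E) :
    ∃ k, u ∈ expBoundedBy E k := by
  obtain ⟨C, hC⟩ := hu
  obtain ⟨k, hk⟩ := exists_nat_ge C
  exact ⟨k, fun x hx => (hC x hx).trans hk⟩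

lemma isClosed_expBoundedBy (k : ℕ) : IsClosed (expBoundedBy E k) := by
  have : expBoundedBy E k = ⋂ x ∈ E, {u : V × V | Real.exp (inner ℝ u.1 x) ≤ k} := by
    ext u; simp [mem_expBoundedBy]
  rw [this]
  refine isClosed_biInter fun x _ => isClosed_le ?_ continuous_const
  fun_prop

lemma imag_mem_expBoundedBy (c : V) {k : ℕ} (hk : 1 ≤ k) : ((0, c) : V × V) ∈ expBoundedBy E k := by
  rw [mem_expBoundedBy]; intro x _; simpa using by exact_mod_cast hk

@[simp] lemma expFun_infty (u : V × V) : expFun u (∞ : OnePoint E) = 0 := rfl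

@[simp] lemma expFun_coe (u : V × V) (x : E) :
    expFun u (x : OnePoint E) = Complex.exp (pairing u (x : V)) := rfl

lemma norm_expFun_le {u : V × V} {k : ℕ} (hu : u ∈ expBoundedBy E k) (y : OnePoint E) :
    ‖expFun u y‖ ≤ k := by
  induction y using OnePoint.rec with
  | infty => simp
  | coe x => exact hu x x.2

lemma norm_expFun_imag_le (c : V) (y : OnePoint E) : ‖expFun (0, c) y‖ ≤ 1 := by
  simpa using norm_expFun_le (E := E) (imag_mem_expBoundedBy c le_rfl) y

lemma continuous_expFun (y : OnePoint E) : Continuous fun u : V × V => expFun u y := by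
  induction y using OnePoint.rec with
  | infty => simpa using continuous_const
  | coe x =>
    simp only [expFun_coe]
    exact Complex.continuous_exp.comp (continuous_pairing_left _)

variable [MeasurableSpace V]

variable [BorelSpace V]

lemma measurable_expFun (u : V × V) : Measurable fun y : OnePoint E => expFun u y := by
  apply measurable_of_coe
  simp only [expFun_coe]
  have : Continuous fun x : E => Complex.exp (pairing u (x : V)) :=
    Complex.continuous_exp.comp ((continuous_pairing_right u).comp continuous_subtype_val)
  exact this.measurable

lemma integrable_expFun {u : V × V} (hu : u ∈ expBounded E) (κ : Measure (OnePoint E))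
    [IsFiniteMeasure κ] : Integrable (fun y => expFun u y) κ := by
  obtain ⟨k, hk⟩ := exists_mem_expBoundedBy hu
  exact Integrable.of_bound (measurable_expFun u).aestronglyMeasurable k
    (Eventually.of_forall fun y => norm_expFun_le hk y)

end Pairing

end AffineProcess

namespace AffineProcess

/-! ### Uniqueness of continuous logarithms. -/

section LogUniqueness

/-- The values lie in 2πiℤ, and their imaginary parts form an interval containing 0. A nonzero value
would force π or -π into that interval, and neither is a multiple of 2π. -/
lemma eq_zero_of_exp_eq_one {α : Type*} [TopologicalSpace α] {S : Set α} (hS : IsPreconnected S)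
    {h : α → ℂ} (hc : ContinuousOn h S) (h1 : ∀ a ∈ S, Complex.exp (h a) = 1) {a₀ : α}
    (ha₀ : a₀ ∈ S) (h0 : h a₀ = 0) {a : α} (ha : a ∈ S) : h a = 0 := by
  have hint : ∀ a ∈ S, ∃ n : ℤ, h a = n * (2 * Real.pi * Complex.I) := fun a ha =>
    Complex.exp_eq_one_iff.1 (h1 a ha)
  have hre : ∀ a ∈ S, (h a).re = 0 := by
    intro a ha
    obtain ⟨n, hn⟩ := hint a ha
    simp [hn]
  have him : ContinuousOn (fun a => (h a).im) S := Complex.continuous_im.comp_continuousOn hc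
  have himg : (fun a => (h a).im) '' S = {0} ∨ ∃ y ∈ (fun a => (h a).im) '' S, y ≠ 0 := by
    by_cases hh : ∃ y ∈ (fun a => (h a).im) '' S, y ≠ 0
    · exact Or.inr hh
    · left
      push Not at hh
      refine Subset.antisymm (fun y hy => hh y hy) ?_
      rintro _ rfl
      exact ⟨a₀, ha₀, by simp [h0]⟩
  rcases himg with himg | ⟨y, ⟨a', ha', rfl⟩, hy⟩
  · have : (h a).im ∈ (fun a => (h a).im) '' S := ⟨a, ha, rfl⟩
    rw [himg] at this
    exact Complex.ext (hre a ha) this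
  · exfalso
    have hoc := (hS.image _ him).ordConnected
    obtain ⟨n, hn⟩ := hint a' ha'
    have hn' : (h a').im = n * (2 * Real.pi) := by simp [hn]
    have hn0 : n ≠ 0 := by rintro rfl; simp [hn'] at hy
    have hz : (0 : ℝ) ∈ (fun a => (h a).im) '' S := ⟨a₀, ha₀, by simp [h0]⟩
    have hm : (h a').im ∈ (fun a => (h a).im) '' S := ⟨a', ha', rfl⟩
    have key : ∀ z : ℝ, z ∈ (fun a => (h a).im) '' S → ∃ m : ℤ, z = m * (2 * Real.pi) := by
      rintro _ ⟨b, hb, rfl⟩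
      obtain ⟨m, hm⟩ := hint b hb
      exact ⟨m, by simp [hm]⟩
    have hpi := Real.pi_pos
    rcases lt_or_gt_of_ne hn0 with hlt | hgt
    · have h1 : (n : ℝ) ≤ -1 := by exact_mod_cast Int.le_sub_one_of_lt hlt
      obtain ⟨m, hm'⟩ := key (-Real.pi) (hoc.out hm hz ⟨by rw [hn']; nlinarith, by linarith⟩)
      have : (2 * m : ℝ) = -1 := by
        have : (2 * m + 1 : ℝ) * Real.pi = 0 := by linarith
        rcases mul_eq_zero.1 this with h | h <;> linarith
      have h3 : (2 * m : ℤ) = -1 := by exact_mod_cast this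
      omega
    · have h1 : (1 : ℝ) ≤ n := by exact_mod_cast hgt
      obtain ⟨m, hm'⟩ := key Real.pi (hoc.out hz hm ⟨by linarith, by rw [hn']; nlinarith⟩)
      have : (2 * m : ℝ) = 1 := by
        have : (2 * m - 1 : ℝ) * Real.pi = 0 := by linarith
        rcases mul_eq_zero.1 this with h | h <;> linarith
      have h3 : (2 * m : ℤ) = 1 := by exact_mod_cast this
      omega

variable {V : Type*} [NormedAddCommGroup V] [InnerProductSpace ℝ V] {ι : Type*}

/-- Differences of points of an affine basis span V. Only differences are tested because the scalar
factor Φ hides any constant added to an exponent. -/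
lemma eq_zero_of_inner_affineBasis_sub [Nonempty ι] (b : AffineBasis ι ℝ V) {w : V}
    (h : ∀ i j, inner ℝ w (b i - b j) = 0) : w = 0 := by
  have hspan : vectorSpan ℝ (range b) = ⊤ := by
    rw [← direction_affineSpan, b.tot, AffineSubspace.direction_top]
  have : ∀ z ∈ vectorSpan ℝ (range b), inner ℝ w z = 0 := by
    intro z hz
    rw [vectorSpan_def] at hz
    induction hz using Submodule.span_induction with
    | mem x hx =>
      obtain ⟨_, ⟨i, rfl⟩, _, ⟨j, rfl⟩, rfl⟩ := hx
      exact h i j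
    | zero => simp
    | add x y _ _ hx hy => simp [inner_add_right, hx, hy]
    | smul a x _ hx => simp [inner_smul_right, hx]
  have h0 := this w (by rw [hspan]; trivial)
  simpa using h0

lemma eq_of_pairing_affineBasis_sub [Nonempty ι] (b : AffineBasis ι ℝ V) {u v : V × V}
    (h : ∀ i j, pairing (u - v) (b i - b j) = 0) : u = v := by
  rw [← sub_eq_zero]
  refine Prod.ext (eq_zero_of_inner_affineBasis_sub b fun i j => ?_)
    (eq_zero_of_inner_affineBasis_sub b fun i j => ?_)
  · rw [← pairing_re, h]; rfl
  · rw [← pairing_im, h]; rfl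

/-- Two continuous families of exponents that give proportional exponential functions on `E`
agree as soon as they agree at one point of a connected parameter set. -/
lemma eqOn_of_exp_pairing_proportional [Nonempty ι] (b : AffineBasis ι ℝ V) {α : Type*}
    [TopologicalSpace α] {S : Set α} (hS : IsPreconnected S) {g₁ g₂ : α → V × V}
    (hg₁ : ContinuousOn g₁ S) (hg₂ : ContinuousOn g₂ S) {C₁ C₂ : α → ℂ}
    (hC : ∀ a ∈ S, C₁ a ≠ 0)
    (h : ∀ a ∈ S, ∀ i, C₁ a * Complex.exp (pairing (g₁ a) (b i))
      = C₂ a * Complex.exp (pairing (g₂ a) (b i))) {a₀ : α} (ha₀ : a₀ ∈ S)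
    (h0 : g₁ a₀ = g₂ a₀) {a : α} (ha : a ∈ S) : g₁ a = g₂ a := by
  refine eq_of_pairing_affineBasis_sub b fun i j => ?_
  refine eq_zero_of_exp_eq_one (h := fun a => pairing (g₁ a - g₂ a) (b i - b j)) hS ?_ ?_ ha₀
    (by simp [h0]) ha
  · exact (continuous_pairing_left _).comp_continuousOn (hg₁.sub hg₂)
  · intro a ha
    have hi := h a ha i
    have hj := h a ha j
    have h1 := hC a ha
    have h2 : C₂ a ≠ 0 := by
      intro h2
      rw [h2, zero_mul] at hi
      exact mul_ne_zero h1 (Complex.exp_ne_zero _) hi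
    have : pairing (g₁ a - g₂ a) (b i - b j) = (pairing (g₁ a) (b i) - pairing (g₂ a) (b i))
        - (pairing (g₁ a) (b j) - pairing (g₂ a) (b j)) := by
      rw [pairing_sub, pairing_sub_right, pairing_sub_right]; ring
    rw [this, Complex.exp_sub, Complex.exp_sub, Complex.exp_sub]
    have e1 := Complex.exp_ne_zero (pairing (g₁ a) (b i))
    have e2 := Complex.exp_ne_zero (pairing (g₂ a) (b i))
    have e3 := Complex.exp_ne_zero (pairing (g₁ a) (b j))
    have e4 := Complex.exp_ne_zero (pairing (g₂ a) (b j))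
    -- The quotient of the two exponentials is the same at every basis point, so it cancels between
    -- `b i` and `b j`.
    have hi' : Complex.exp (pairing (g₁ a) (b i)) / Complex.exp (pairing (g₂ a) (b i))
        = C₂ a / C₁ a := by field_simp; linear_combination hi
    have hj' : Complex.exp (pairing (g₁ a) (b j)) / Complex.exp (pairing (g₂ a) (b j))
        = C₂ a / C₁ a := by field_simp; linear_combination hj
    rw [hi', hj']
    exact div_self (div_ne_zero h2 h1)

end LogUniqueness

/-! ### The affine formula: diagonal values and semiflow relations. -/

section Kernel

variable {V : Type*} [NormedAddCommGroup V] [InnerProductSpace ℝ V] [MeasurableSpace V]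
  {E : Set V}

/-- The data of a continuously affine transition function, with the parameter functions fixed
and with `ψ` normalized on the diagonal. -/
structure IsAffineData (P : TransitionFunction E) (Φ : ℝ≥0 → ℝ≥0 → V × V → ℂ)
    (ψ : ℝ≥0 → ℝ≥0 → V × V → V × V) : Prop where
  affine : P.IsAffineWith Φ ψ
  diag : ∀ t, ∀ u ∈ expBounded E, ψ t t u = u
  continuousOn_psi : ∀ k, ContinuousOn (fun p : ℝ≥0 × ℝ≥0 × (V × V) => ψ p.1 p.2.1 p.2.2)
    (nonvanishing E Φ k)
  continuousOn_phi : ∀ k, ContinuousOn (fun p : ℝ≥0 × ℝ≥0 × (V × V) => Φ p.1 p.2.1 p.2.2)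
    (timeParam E k)

variable {P : TransitionFunction E} {Φ : ℝ≥0 → ℝ≥0 → V × V → ℂ}
  {ψ : ℝ≥0 → ℝ≥0 → V × V → V × V}

lemma TransitionFunction.comp_of_le (P : TransitionFunction E) {r w s : ℝ≥0} (hrw : r ≤ w)
    (hws : w ≤ s) : (P.kernel w s) ∘ₖ (P.kernel r w) = P.kernel r s := by
  rcases hrw.eq_or_lt with rfl | hrw
  · rw [P.refl, Kernel.comp_id]
  rcases hws.eq_or_lt with rfl | hws
  · rw [P.refl, Kernel.id_comp]
  exact P.comp r w s hrw hws

variable [BorelSpace V]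

@[simp] lemma TransitionFunction.expTransform_infty (P : TransitionFunction E) {s t : ℝ≥0}
    (hst : s ≤ t) (u : V × V) : P.expTransform s t u ∞ = 0 := by
  rw [TransitionFunction.expTransform, P.absorbing s t hst,
    integral_dirac' _ _ (measurable_expFun u).stronglyMeasurable]
  simp

lemma TransitionFunction.expTransform_self (P : TransitionFunction E) (s : ℝ≥0) (u : V × V)
    (x : OnePoint E) : P.expTransform s s u x = expFun u x := by
  rw [TransitionFunction.expTransform, P.refl, Kernel.id_apply,
    integral_dirac' _ _ (measurable_expFun u).stronglyMeasurable]

lemma TransitionFunction.expTransform_comp (P : TransitionFunction E) {r w s : ℝ≥0}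
    (hrw : r ≤ w) (hws : w ≤ s) {u : V × V} (hu : u ∈ expBounded E) (x : OnePoint E) :
    P.expTransform r s u x = ∫ y, P.expTransform w s u y ∂(P.kernel r w x) := by
  have := P.isMarkovKernel r w hrw
  have := P.isMarkovKernel w s hws
  simp only [TransitionFunction.expTransform]
  rw [← P.comp_of_le hrw hws, Kernel.integral_comp]
  have : IsMarkovKernel (P.kernel w s ∘ₖ P.kernel r w) := inferInstance
  exact integrable_expFun hu _

lemma TransitionFunction.norm_expTransform_le (P : TransitionFunction E) {s t : ℝ≥0}
    (hst : s ≤ t) {u : V × V} {k : ℕ} (hu : u ∈ expBoundedBy E k) (x : OnePoint E) :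
    ‖P.expTransform s t u x‖ ≤ k := by
  have := P.isMarkovKernel s t hst
  refine (norm_integral_le_of_norm_le_const (C := k)
    (Eventually.of_forall fun y => norm_expFun_le hu y)).trans ?_
  simp

lemma TransitionFunction.IsAffineWith.expTransform_eq (h : P.IsAffineWith Φ ψ) {s t : ℝ≥0}
    (hst : s ≤ t) {u : V × V} (hu : u ∈ expBounded E) (x : OnePoint E) :
    P.expTransform s t u x = Φ s t u * expFun (ψ s t u) x := by
  induction x using OnePoint.rec with
  | infty => simp [hst]
  | coe x => exact h s t hst u hu x

/-- Chapman-Kolmogorov: the inner transform is a multiple of another exponential. The formula also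
holds at the cemetery, because every f_v vanishes there. -/
lemma TransitionFunction.IsAffineWith.expTransform_comp (h : P.IsAffineWith Φ ψ)
    {r w s : ℝ≥0} (hrw : r ≤ w) (hws : w ≤ s) {u : V × V} (hu : u ∈ expBounded E)
    (x : OnePoint E) :
    P.expTransform r s u x = Φ w s u * P.expTransform r w (ψ w s u) x := by
  rw [P.expTransform_comp hrw hws hu]
  simp_rw [h.expTransform_eq hws hu]
  rw [integral_const_mul]
  rfl

/-- A Markov operator does not increase the supremum norm, so |Φ| exp⟨Re ψ, x⟩ ≤ k on E; dividing by
|Φ| gives the bound. -/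
lemma TransitionFunction.IsAffineWith.psi_mem (h : P.IsAffineWith Φ ψ) {s t : ℝ≥0}
    (hst : s ≤ t) {u : V × V} {k l : ℕ} (hu : u ∈ expBoundedBy E k)
    (hl : (k : ℝ) ≤ l * ‖Φ s t u‖) (h0 : Φ s t u ≠ 0) : ψ s t u ∈ expBoundedBy E l := by
  intro x hx
  have h1 := P.norm_expTransform_le hst hu ((⟨x, hx⟩ : E) : OnePoint E)
  rw [h.expTransform_eq hst (expBoundedBy_subset k hu), norm_mul, expFun_coe] at h1
  have h2 : 0 < ‖Φ s t u‖ := norm_pos_iff.2 h0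
  have h3 := h1.trans hl
  rw [mul_comm] at h3
  exact le_of_mul_le_mul_right h3 h2

lemma TransitionFunction.IsAffineWith.psi_mem_expBounded (h : P.IsAffineWith Φ ψ) {s t : ℝ≥0}
    (hst : s ≤ t) {u : V × V} (hu : u ∈ expBounded E) (h0 : Φ s t u ≠ 0) :
    ψ s t u ∈ expBounded E := by
  obtain ⟨k, hk⟩ := exists_mem_expBoundedBy hu
  obtain ⟨l, hl⟩ := exists_nat_ge ((k : ℝ) / ‖Φ s t u‖)
  exact expBoundedBy_subset l (h.psi_mem hst hk ((div_le_iff₀ (norm_pos_iff.2 h0)).1 hl) h0)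

/-- If `Φ_{w,s}(u)` vanishes then so does `Φ_{r,s}(u)` for `r ≤ w`. -/
lemma TransitionFunction.IsAffineWith.phi_eq_zero_of_le (h : P.IsAffineWith Φ ψ)
    (hE : E.Nonempty) {r w s : ℝ≥0} (hrw : r ≤ w) (hws : w ≤ s) {u : V × V}
    (hu : u ∈ expBounded E) (h0 : Φ w s u = 0) : Φ r s u = 0 := by
  obtain ⟨x, hx⟩ := hE
  have h1 := h.expTransform_comp hrw hws hu ((⟨x, hx⟩ : E) : OnePoint E)
  rw [h0, zero_mul, h.expTransform_eq (hrw.trans hws) hu, expFun_coe] at h1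
  exact (mul_eq_zero.1 h1).resolve_right (Complex.exp_ne_zero _)

lemma TransitionFunction.IsAffineWith.phi_mul_exp_self (h : P.IsAffineWith Φ ψ) (t : ℝ≥0)
    {u : V × V} (hu : u ∈ expBounded E) {x : V} (hx : x ∈ E) :
    Φ t t u * Complex.exp (pairing (ψ t t u) x) = Complex.exp (pairing u x) := by
  have h1 := h.expTransform_eq le_rfl hu ((⟨x, hx⟩ : E) : OnePoint E) (s := t)
  rw [P.expTransform_self] at h1
  exact h1.symm

lemma TransitionFunction.IsAffineWith.phi_self_ne_zero (h : P.IsAffineWith Φ ψ)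
    (hE : E.Nonempty) (t : ℝ≥0) {u : V × V} (hu : u ∈ expBounded E) : Φ t t u ≠ 0 := by
  obtain ⟨x, hx⟩ := hE
  intro h0
  have := h.phi_mul_exp_self t hu hx
  rw [h0, zero_mul] at this
  exact Complex.exp_ne_zero _ this.symm

/-- The set is star-shaped about 0 only when k ≥ 1, since u = 0 gives the constant function 1. -/
lemma smul_mem_expBoundedBy {u : V × V} {k : ℕ} (hk : 1 ≤ k) (hu : u ∈ expBoundedBy E k)
    {τ : ℝ} (h0 : 0 ≤ τ) (h1 : τ ≤ 1) : τ • u ∈ expBoundedBy E k := by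
  rw [mem_expBoundedBy] at hu ⊢
  intro x hx
  have hk' : (1 : ℝ) ≤ k := by exact_mod_cast hk
  have h2 := hu x hx
  rw [Prod.smul_fst, inner_smul_left]
  simp only [conj_trivial]
  rcases le_total 0 (inner ℝ u.1 x) with h | h
  · exact (Real.exp_le_exp.2 (by nlinarith)).trans h2
  · exact (Real.exp_le_one_iff.2 (by nlinarith)).trans hk'

lemma self_mem_nonvanishing (h : P.IsAffineWith Φ ψ) (hE : E.Nonempty) (t : ℝ≥0) {u : V × V}
    {k : ℕ} (hu : u ∈ expBoundedBy E k) : (t, t, u) ∈ nonvanishing E Φ k :=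
  ⟨⟨le_rfl, hu⟩, fun v h1 h2 => by
    obtain rfl : v = t := le_antisymm h2 h1
    exact h.phi_self_ne_zero hE v (expBoundedBy_subset k hu)⟩

/-- `ψ` is the identity on the diagonal, by continuity. -/
lemma psi_self (h : P.IsAffineWith Φ ψ) {ι : Type*} [Nonempty ι] (b : AffineBasis ι ℝ V)
    (hb : range b ⊆ E) (h0 : ψ 0 0 0 = 0)
    (hψ : ∀ k, ContinuousOn (fun p : ℝ≥0 × ℝ≥0 × (V × V) => ψ p.1 p.2.1 p.2.2)
      (nonvanishing E Φ k)) (t : ℝ≥0) {u : V × V} (hu : u ∈ expBounded E) : ψ t t u = u := by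
  have hE : E.Nonempty := ⟨_, hb (mem_range_self (Classical.arbitrary ι))⟩
  obtain ⟨k, hk⟩ := exists_mem_expBoundedBy hu
  have hk : u ∈ expBoundedBy E (k + 1) := expBoundedBy_mono (Nat.le_succ k) hk
  -- The path joins (0, 0, 0), where ψ is normalized by assumption, to (t, t, u), and it consists of
  -- diagonal points, where Φ cannot vanish. Along it ψ and τu are two continuous exponents of
  -- proportional exponentials.
  let γ : ℝ≥0 → ℝ≥0 × ℝ≥0 × (V × V) := fun τ => (τ * t, τ * t, (τ : ℝ) • u)
  have hγ : Continuous γ := by fun_prop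
  have hmem : ∀ τ ∈ Icc (0 : ℝ≥0) 1, (τ : ℝ) • u ∈ expBoundedBy E (k + 1) := fun τ hτ =>
    smul_mem_expBoundedBy (by omega) hk τ.2 (by exact_mod_cast hτ.2)
  have := eqOn_of_exp_pairing_proportional b (S := Icc (0 : ℝ≥0) 1) isPreconnected_Icc
    (g₁ := fun τ => ψ (τ * t) (τ * t) ((τ : ℝ) • u)) (g₂ := fun τ => (τ : ℝ) • u)
    (C₁ := fun τ => Φ (τ * t) (τ * t) ((τ : ℝ) • u)) (C₂ := fun _ => 1)
    ((hψ (k + 1)).comp hγ.continuousOn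
      fun τ hτ => self_mem_nonvanishing h hE (τ * t) (hmem τ hτ))
    (by fun_prop)
    (fun τ hτ => h.phi_self_ne_zero hE _ (expBoundedBy_subset _ (hmem τ hτ)))
    (fun τ hτ i => by
      rw [one_mul]
      exact h.phi_mul_exp_self _ (expBoundedBy_subset _ (hmem τ hτ)) (hb (mem_range_self i)))
    (a₀ := 0) (by simp) (by simp [h0]) (a := 1) (by simp)
  simpa using this

namespace IsAffineData

variable (h : IsAffineData P Φ ψ)
include h

lemma phi_self (hE : E.Nonempty) (t : ℝ≥0) {u : V × V} (hu : u ∈ expBounded E) :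
    Φ t t u = 1 := by
  obtain ⟨x, hx⟩ := hE
  have := h.affine.phi_mul_exp_self t hu hx
  rw [h.diag t u hu] at this
  exact mul_right_cancel₀ (Complex.exp_ne_zero _) (by rw [this, one_mul])

lemma continuousOn_left_psi {r s : ℝ≥0} {u : V × V} (hu : u ∈ expBounded E)
    (hne : ∀ v ∈ Icc r s, Φ v s u ≠ 0) : ContinuousOn (fun w => ψ w s u) (Icc r s) := by
  obtain ⟨k, hk⟩ := exists_mem_expBoundedBy hu
  have hc : Continuous fun w : ℝ≥0 => ((w, s, u) : ℝ≥0 × ℝ≥0 × (V × V)) := by fun_prop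
  exact (h.continuousOn_psi k).comp hc.continuousOn fun w hw =>
    ⟨⟨hw.2, hk⟩, fun v h1 h2 => hne v ⟨hw.1.trans h1, h2⟩⟩

lemma continuousOn_left_phi {s : ℝ≥0} {u : V × V} (hu : u ∈ expBounded E) :
    ContinuousOn (fun w => Φ w s u) (Iic s) := by
  obtain ⟨k, hk⟩ := exists_mem_expBoundedBy hu
  have hc : Continuous fun w : ℝ≥0 => ((w, s, u) : ℝ≥0 × ℝ≥0 × (V × V)) := by fun_prop
  exact (h.continuousOn_phi k).comp hc.continuousOn fun w hw => ⟨hw, hk⟩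

/-- On a compact time interval |Φ| is bounded away from 0, so a single bound l serves for all w. -/
lemma exists_psi_mem_Icc {r s : ℝ≥0} {u : V × V} (hu : u ∈ expBounded E)
    (hne : ∀ v ∈ Icc r s, Φ v s u ≠ 0) : ∃ l : ℕ, ∀ w ∈ Icc r s, ψ w s u ∈ expBoundedBy E l := by
  obtain ⟨k, hk⟩ := exists_mem_expBoundedBy hu
  have hc : ContinuousOn (fun w => (k : ℝ) / ‖Φ w s u‖) (Icc r s) :=
    continuousOn_const.div
      ((h.continuousOn_left_phi hu).mono fun w hw => hw.2).norm fun w hw => norm_ne_zero_iff.2 (hne w hw)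
  obtain ⟨C, hC⟩ := (isCompact_Icc.image_of_continuousOn hc).bddAbove
  obtain ⟨l, hl⟩ := exists_nat_ge C
  refine ⟨l, fun w hw => h.affine.psi_mem hw.2 hk ?_ (hne w hw)⟩
  exact (div_le_iff₀ (norm_pos_iff.2 (hne w hw))).1 ((hC ⟨w, hw, rfl⟩).trans hl)

/-- Up to nonzero exponentials, Φ_{r,s}(u) is the product of Φ_{w,s}(u) and Φ_{r,w}(ψ_{w,s}(u)). -/
lemma phi_cocycle_ne_zero (hE : E.Nonempty) {r w s : ℝ≥0} (hrw : r ≤ w) (hws : w ≤ s)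
    {u : V × V} (hu : u ∈ expBounded E) (hne : Φ r s u ≠ 0) : Φ r w (ψ w s u) ≠ 0 := by
  obtain ⟨x, hx⟩ := hE
  have hw : Φ w s u ≠ 0 := fun h0 => hne (h.affine.phi_eq_zero_of_le ⟨x, hx⟩ hrw hws hu h0)
  intro h0
  have h1 := h.affine.expTransform_comp hrw hws hu ((⟨x, hx⟩ : E) : OnePoint E)
  rw [h.affine.expTransform_eq hrw (h.affine.psi_mem_expBounded hws hu hw), h0,
    h.affine.expTransform_eq (hrw.trans hws) hu, zero_mul, mul_zero, expFun_coe] at h1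
  exact mul_ne_zero hne (Complex.exp_ne_zero _) h1

/-- The semiflow property of `ψ`. -/
lemma psi_cocycle {ι : Type*} [Nonempty ι] (b : AffineBasis ι ℝ V) (hb : range b ⊆ E)
    {r w s : ℝ≥0} (hrw : r ≤ w) (hws : w ≤ s) {u : V × V} (hu : u ∈ expBounded E)
    (hne : ∀ v ∈ Icc r s, Φ v s u ≠ 0) : ψ r w (ψ w s u) = ψ r s u := by
  have hE : E.Nonempty := ⟨_, hb (mem_range_self (Classical.arbitrary ι))⟩
  obtain ⟨l, hl⟩ := h.exists_psi_mem_Icc hu hne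
  have hrs := hrw.trans hws
  have hmem : ∀ v ∈ Icc r s, (r, v, ψ v s u) ∈ nonvanishing E Φ l := fun v hv =>
    ⟨⟨hv.1, hl v hv⟩, fun z h1 h2 =>
      h.phi_cocycle_ne_zero hE h2 hv.2 hu (hne z ⟨h1, h2.trans hv.2⟩)⟩
  -- The intermediate time v varies over [r, s]; at v = s both exponents agree because ψ is the
  -- identity on the diagonal.
  refine eqOn_of_exp_pairing_proportional b (S := Icc r s) isPreconnected_Icc
    (g₁ := fun v => ψ r v (ψ v s u)) (g₂ := fun _ => ψ r s u)
    (C₁ := fun v => Φ v s u * Φ r v (ψ v s u)) (C₂ := fun _ => Φ r s u) ?_ continuousOn_const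
    ?_ ?_ (a₀ := s) ⟨hrs, le_rfl⟩ (by simp only [h.diag s u hu]) ⟨hrw, hws⟩
  · have hc : ContinuousOn (fun v : ℝ≥0 => ((r, v, ψ v s u) : ℝ≥0 × ℝ≥0 × (V × V))) (Icc r s) :=
      continuousOn_const.prodMk (continuousOn_id.prodMk (h.continuousOn_left_psi hu hne))
    exact (h.continuousOn_psi l).comp hc hmem
  · exact fun v hv => mul_ne_zero (hne v hv)
      (h.phi_cocycle_ne_zero hE hv.1 hv.2 hu (hne r ⟨le_rfl, hrs⟩))
  · intro v hv i
    have h1 := h.affine.expTransform_comp hv.1 hv.2 hu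
      ((⟨b i, hb (mem_range_self i)⟩ : E) : OnePoint E)
    rw [h.affine.expTransform_eq hv.1 (expBoundedBy_subset l (hl v hv)),
      h.affine.expTransform_eq hrs hu, ← mul_assoc] at h1
    exact h1.symm

end IsAffineData

end Kernel

end AffineProcess

namespace AffineProcess

/-! ### Uniform small-time estimates. -/

section SmallTime

variable {V : Type*} [NormedAddCommGroup V] [InnerProductSpace ℝ V] [MeasurableSpace V]
  [BorelSpace V] [FiniteDimensional ℝ V] {E : Set V} {P : TransitionFunction E}
  {Φ : ℝ≥0 → ℝ≥0 → V × V → ℂ} {ψ : ℝ≥0 → ℝ≥0 → V × V → V × V}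

/-- Over short time intervals `Φ` is uniformly close to `1` and `ψ` uniformly close to the
identity, on bounded subsets of `𝒰_k`. -/
lemma IsAffineData.exists_small_time (h : IsAffineData P Φ ψ) (hE : E.Nonempty) (k : ℕ) (R : ℝ)
    (T : ℝ≥0) {η : ℝ} (hη : 0 < η) :
    ∃ δ : ℝ≥0, 0 < δ ∧ ∀ r s u, r ≤ s → s ≤ T → s ≤ r + δ → u ∈ expBoundedBy E k → ‖u‖ ≤ R →
      ‖Φ r s u - 1‖ ≤ η ∧ ‖ψ r s u - u‖ ≤ η := by
  set η' := min η (1 / 2) with hη'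
  have hη'0 : 0 < η' := by positivity
  let S : Set (ℝ≥0 × ℝ≥0 × (V × V)) :=
    {p | p.1 ≤ p.2.1 ∧ p.2.1 ≤ T ∧ p.2.2 ∈ expBoundedBy E k ∧ ‖p.2.2‖ ≤ R}
  have hSc : IsCompact S := by
    have hK : IsCompact (Icc (0 : ℝ≥0) T ×ˢ Icc (0 : ℝ≥0) T ×ˢ Metric.closedBall (0 : V × V) R) :=
      isCompact_Icc.prod (isCompact_Icc.prod (isCompact_closedBall 0 R))
    have hcl : IsClosed ({p : ℝ≥0 × ℝ≥0 × (V × V) | p.1 ≤ p.2.1} ∩ ({p | p.2.1 ≤ T} ∩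
        ((fun p => p.2.2) ⁻¹' expBoundedBy E k ∩ {p | ‖p.2.2‖ ≤ R}))) :=
      (isClosed_le (by fun_prop) (by fun_prop)).inter
        ((isClosed_le (by fun_prop) (by fun_prop)).inter
          (((isClosed_expBoundedBy k).preimage (by fun_prop)).inter
            (isClosed_le (by fun_prop) (by fun_prop))))
    refine hK.of_isClosed_subset hcl ?_
    · rintro ⟨r, s, u⟩ ⟨h1, h2, -, h4⟩
      exact ⟨⟨zero_le, h1.trans h2⟩, ⟨zero_le, h2⟩, by simpa using h4⟩
  have hST : S ⊆ timeParam E k := fun p hp => ⟨hp.1, hp.2.2.1⟩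
  obtain ⟨δ₁, hδ₁, h1⟩ := Metric.uniformContinuousOn_iff.1
    (hSc.uniformContinuousOn_of_continuous ((h.continuousOn_phi k).mono hST)) η' hη'0
  have hdist : ∀ (r s : ℝ≥0) (u : V × V) (δ : ℝ), 0 < δ → r ≤ s → s ≤ r + (δ / 2).toNNReal →
      dist (r, s, u) (s, s, u) < δ := by
    intro r s u δ hδ hrs hs
    have h3 : (s : ℝ) ≤ r + δ / 2 := by
      have : (s : ℝ) ≤ ((r + (δ / 2).toNNReal : ℝ≥0) : ℝ) := by exact_mod_cast hs
      rwa [NNReal.coe_add, Real.coe_toNNReal _ (by positivity)] at this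
    have h4 : (r : ℝ) ≤ s := by exact_mod_cast hrs
    simp only [Prod.dist_eq, dist_self]
    rw [max_lt_iff, NNReal.dist_eq, abs_lt]
    exact ⟨⟨by linarith, by linarith⟩, hδ⟩
  have hphi : ∀ r s u, (r, s, u) ∈ S → s ≤ r + (δ₁ / 2).toNNReal → ‖Φ r s u - 1‖ < η' := by
    intro r s u hS hs
    have h2 := h1 (r, s, u) hS (s, s, u) ⟨le_rfl, hS.2⟩ (hdist r s u δ₁ hδ₁ hS.1 hs)
    rwa [dist_eq_norm, h.phi_self hE s (expBoundedBy_subset k hS.2.2.1)] at h2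
  -- Continuity of ψ is available only where Φ does not vanish. On this smaller compact set
  -- Φ_{v,s}(u) differs from 1 by less than 1/2 for all v in [r, s], which is why η is cut off at
  -- 1/2.
  let S' := S ∩ {p | p.2.1 ≤ p.1 + (δ₁ / 2).toNNReal}
  have hS'c : IsCompact S' := hSc.inter_right (isClosed_le (by fun_prop) (by fun_prop))
  have hS'n : S' ⊆ nonvanishing E Φ k := by
    rintro ⟨r, s, u⟩ ⟨hS, hs⟩
    refine ⟨hST hS, fun v hv1 hv2 h0 => ?_⟩
    simp only at hv1 hv2 hs h0
    have h2 := hphi v s u ⟨hv2, hS.2⟩ (hs.trans (by gcongr))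
    rw [h0] at h2
    simp only [zero_sub, norm_neg, norm_one] at h2
    linarith [min_le_right η (1 / 2)]
  obtain ⟨δ₂, hδ₂, h2⟩ := Metric.uniformContinuousOn_iff.1
    (hS'c.uniformContinuousOn_of_continuous ((h.continuousOn_psi k).mono hS'n)) η hη
  refine ⟨min (δ₁ / 2).toNNReal (δ₂ / 2).toNNReal, lt_min (by simpa) (by simpa), ?_⟩
  intro r s u hrs hsT hs hu hR
  have hS : (r, s, u) ∈ S := ⟨hrs, hsT, hu, hR⟩
  have hs1 : s ≤ r + (δ₁ / 2).toNNReal := hs.trans (by gcongr; exact min_le_left _ _)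
  have hs2 : s ≤ r + (δ₂ / 2).toNNReal := hs.trans (by gcongr; exact min_le_right _ _)
  refine ⟨(hphi r s u hS hs1).le.trans (min_le_left _ _), ?_⟩
  have h3 := h2 (r, s, u) ⟨hS, hs1⟩ (s, s, u)
    ⟨⟨le_rfl, hS.2⟩, show s ≤ s + _ from le_self_add⟩ (hdist r s u δ₂ hδ₂ hrs hs2)
  rw [dist_eq_norm, h.diag s u (expBoundedBy_subset k hu)] at h3
  exact h3.le

end SmallTime

/-! ### The barrier cone and complex lines inside the domain. -/

section Lines

variable {V : Type*} [NormedAddCommGroup V] [InnerProductSpace ℝ V]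

/-- The barrier cone of `E`: the vectors `a` for which `x ↦ ⟪a, x⟫` is bounded above on `E`. -/
def barrierCone (E : Set V) : Set V := {a | ∃ C : ℝ, ∀ x ∈ E, inner ℝ a x ≤ C}

variable {E : Set V}

lemma mem_expBounded_iff_fst {u : V × V} : u ∈ expBounded E ↔ u.1 ∈ barrierCone E :=
  mem_expBounded

/-- For b in the cone take a = b, so that a + yb is a multiple of b by a factor in [0, 2]; the
property passes to sums and multiples. The vector a then absorbs small perturbations of either sign
along b. -/
lemma exists_absorbing {b : V} (hb : b ∈ Submodule.span ℝ (barrierCone E)) :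
    ∃ (a : V) (M : ℝ), ∀ y : ℝ, |y| ≤ 1 → ∀ x ∈ E, inner ℝ (a + y • b) x ≤ M := by
  induction hb using Submodule.span_induction with
  | mem b hb =>
    obtain ⟨C, hC⟩ := hb
    refine ⟨b, 2 * |C|, fun y hy x hx => ?_⟩
    rw [inner_add_left, inner_smul_left]
    simp only [conj_trivial]
    have h1 := hC x hx
    have h2 := le_abs_self C
    rw [abs_le] at hy
    nlinarith [abs_nonneg C]
  | zero => exact ⟨0, 0, fun y _ x _ => by simp⟩
  | add b c _ _ hb hc =>
    obtain ⟨a, M, h⟩ := hb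
    obtain ⟨a', M', h'⟩ := hc
    refine ⟨a + a', M + M', fun y hy x hx => ?_⟩
    have h1 := h y hy x hx
    have h2 := h' y hy x hx
    simp only [inner_add_left, smul_add] at *
    linarith
  | smul c b _ hb =>
    obtain ⟨a, M, h⟩ := hb
    refine ⟨|c| • a, |c| * M, fun y hy x hx => ?_⟩
    have key : ∀ z : ℝ, |z| ≤ 1 → inner ℝ (|c| • a + (|c| * z) • b) x ≤ |c| * M := by
      intro z hz
      have : |c| • a + (|c| * z) • b = |c| • (a + z • b) := by rw [smul_add, smul_smul]
      rw [this, inner_smul_left]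
      exact mul_le_mul_of_nonneg_left (h z hz x hx) (abs_nonneg c)
    rw [smul_smul]
    rcases abs_cases c with ⟨hc, _⟩ | ⟨hc, _⟩
    · have := key y hy; rwa [hc, mul_comm c y] at *
    · have := key (-y) (by rwa [abs_neg]); rw [hc] at *
      rwa [neg_mul_neg, mul_comm c y] at this

/-- The complex line through `u₀` and `u₁`, shifted by `ρ a` into the interior of the domain,
stays in the domain near the segment. -/
lemma exists_line_shift {u₀ u₁ : V × V} {C₀ C₁ : ℝ} (h0 : ∀ x ∈ E, inner ℝ u₀.1 x ≤ C₀)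
    (h1 : ∀ x ∈ E, inner ℝ u₁.1 x ≤ C₁)
    (hξ1 : (u₁ - u₀).1 ∈ Submodule.span ℝ (barrierCone E))
    (hξ2 : (u₁ - u₀).2 ∈ Submodule.span ℝ (barrierCone E)) {η : ℝ} (hη : 0 < η) :
    ∃ (a : V) (ρ₀ : ℝ), 0 < ρ₀ ∧ ∀ ρ : ℝ, 0 < ρ → ρ ≤ ρ₀ → ∀ z : ℂ, -ρ < z.re → z.re < 1 + ρ →
      |z.im| < ρ → ∃ p : ℝ, p = max 0 (min 1 z.re) ∧
        (∀ x ∈ E, inner ℝ (u₀ + complexSMul z (u₁ - u₀) + (ρ • a, 0)).1 x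
          ≤ (1 - p) * C₀ + p * C₁ + η) ∧
        ‖u₀ + complexSMul z (u₁ - u₀) + (ρ • a, 0)‖ ≤ max ‖u₀‖ ‖u₁‖ + η := by
  obtain ⟨a, M, ha⟩ := exists_absorbing hξ1
  obtain ⟨a', M', ha'⟩ := exists_absorbing hξ2
  set ξ := u₁ - u₀ with hξ
  set D := |M| + |M'| + ‖a + a'‖ + 2 * ‖ξ‖ + 1 with hD
  have hDpos : 0 < D := by positivity
  refine ⟨a + a', η / D, by positivity, fun ρ hρ hρ0 z hz1 hz2 hz3 => ⟨_, rfl, ?_⟩⟩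
  -- p is the point of [0, 1] nearest to Re z. The excess of z over p is at most ρ in real and
  -- imaginary part, and the shift by ρ(a + a') absorbs it: a takes care of Re ξ, and a' of Im ξ,
  -- which multiplication by z turns into a real direction.
  set p := max 0 (min 1 z.re) with hp
  have hρD : ρ * D ≤ η := by rwa [le_div_iff₀ hDpos] at hρ0
  have hp0 : 0 ≤ p := le_max_left _ _
  have hp1 : p ≤ 1 := max_le zero_le_one (min_le_left _ _)
  have hq : |z.re - p| ≤ ρ := by
    rw [hp]
    rcases le_total 0 z.re with h | h
    · rcases le_total 1 z.re with h' | h'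
      · rw [min_eq_left h', max_eq_right zero_le_one, abs_le]; constructor <;> linarith
      · rw [min_eq_right h', max_eq_right h]; simp [hρ.le]
    · rw [max_eq_left ((min_le_right _ _).trans h), abs_le]; constructor <;> linarith
  constructor
  · intro x hx
    have e1 := ha ((z.re - p) / ρ) (by rw [abs_div, abs_of_pos hρ, div_le_one hρ]; exact hq) x hx
    have e2 := ha' (-z.im / ρ) (by
      rw [abs_div, abs_of_pos hρ, div_le_one hρ, abs_neg]; exact hz3.le) x hx
    have e3 := h0 x hx
    have e4 := h1 x hx
    have hu1 : u₁.1 = u₀.1 + ξ.1 := by simp [hξ]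
    rw [hu1] at e4
    simp only [complexSMul, Prod.fst_add, inner_add_left, inner_sub_left, inner_smul_left,
      conj_trivial] at e1 e2 e3 e4 ⊢
    set A := inner ℝ a x
    set A' := inner ℝ a' x
    set X := inner ℝ ξ.1 x
    set Y := inner ℝ ξ.2 x
    have f1 : ρ * A + (z.re - p) * X ≤ ρ * M := by
      have := mul_le_mul_of_nonneg_left e1 hρ.le
      calc _ = ρ * (A + (z.re - p) / ρ * X) := by field_simp
        _ ≤ _ := this
    have f2 : ρ * A' - z.im * Y ≤ ρ * M' := by
      have := mul_le_mul_of_nonneg_left e2 hρ.le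
      calc _ = ρ * (A' + -z.im / ρ * Y) := by field_simp; ring
        _ ≤ _ := this
    have f3 : ρ * M + ρ * M' ≤ ρ * D := by
      have := le_abs_self M; have := le_abs_self M'
      have : M + M' ≤ D := by
        have := norm_nonneg (a + a'); have := norm_nonneg ξ
        linarith
      nlinarith
    have f4 := mul_le_mul_of_nonneg_left e3 (sub_nonneg.2 hp1)
    have f5 := mul_le_mul_of_nonneg_left e4 hp0
    nlinarith
  · have hdec : u₀ + complexSMul z ξ + (ρ • (a + a'), 0)
        = ((1 - p) • u₀ + p • u₁) + (complexSMul (z - p) ξ + (ρ • (a + a'), 0)) := by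
      refine Prod.ext ?_ ?_
      · simp only [complexSMul, hξ, Prod.fst_add, Prod.fst_sub, Prod.snd_sub, Prod.smul_fst,
          Complex.sub_re, Complex.sub_im, Complex.ofReal_re, Complex.ofReal_im]
        module
      · simp only [complexSMul, hξ, Prod.snd_add, Prod.fst_sub, Prod.snd_sub, Prod.smul_snd,
          Complex.sub_re, Complex.sub_im, Complex.ofReal_re, Complex.ofReal_im]
        module
    rw [hdec]
    have g1 : ‖(1 - p) • u₀ + p • u₁‖ ≤ max ‖u₀‖ ‖u₁‖ := by
      refine (norm_add_le _ _).trans ?_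
      rw [norm_smul, norm_smul, Real.norm_of_nonneg hp0, Real.norm_of_nonneg (sub_nonneg.2 hp1)]
      nlinarith [le_max_left ‖u₀‖ ‖u₁‖, le_max_right ‖u₀‖ ‖u₁‖]
    have g2 : ‖complexSMul (z - p) ξ‖ ≤ ρ * (2 * ‖ξ‖) := by
      have n1 : ‖ξ.1‖ ≤ ‖ξ‖ := norm_fst_le ξ
      have n2 : ‖ξ.2‖ ≤ ‖ξ‖ := norm_snd_le ξ
      have m1 : |(z - p).re| ≤ ρ := by simpa using hq
      have m2 : |(z - p).im| ≤ ρ := by simpa using hz3.le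
      have q1 : ∀ (c : ℝ) (v : V), |c| ≤ ρ → ‖v‖ ≤ ‖ξ‖ → ‖c • v‖ ≤ ρ * ‖ξ‖ := by
        intro c v hc hv
        rw [norm_smul]
        exact mul_le_mul hc hv (norm_nonneg _) hρ.le
      refine max_le ?_ ?_
      · refine (norm_sub_le _ _).trans ?_
        linarith [q1 _ _ m1 n1, q1 _ _ m2 n2]
      · refine (norm_add_le _ _).trans ?_
        linarith [q1 _ _ m1 n2, q1 _ _ m2 n1]
    have g3 : ‖((ρ • (a + a'), 0) : V × V)‖ ≤ ρ * ‖a + a'‖ := by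
      rw [Prod.norm_mk, norm_smul, Real.norm_of_nonneg hρ.le]
      simp; positivity
    have g4 : ρ * (2 * ‖ξ‖) + ρ * ‖a + a'‖ ≤ ρ * D := by
      rw [← mul_add]
      gcongr
      have := abs_nonneg M; have := abs_nonneg M'
      linarith
    linarith [norm_add_le ((1 - p) • u₀ + p • u₁)
      (complexSMul (z - p) ξ + ((ρ • (a + a'), 0) : V × V)),
      norm_add_le (complexSMul (z - p) ξ) ((ρ • (a + a'), 0) : V × V)]

variable [MeasurableSpace V] [BorelSpace V]

/-- Differentiation under the integral. The derivative carries the unbounded factor ⟨ξ, x⟩, but the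
bound k on the whole open set controls it through Cauchy's estimate. -/
lemma differentiableOn_integral_expFun (κ : Measure (OnePoint E)) [IsFiniteMeasure κ]
    {Ω : Set ℂ} (hΩ : IsOpen Ω) {u ξ : V × V} {k : ℕ}
    (hmem : ∀ z ∈ Ω, u + complexSMul z ξ ∈ expBoundedBy E k) :
    DifferentiableOn ℂ (fun z => ∫ y, expFun (u + complexSMul z ξ) y ∂κ) Ω := by
  intro z₀ hz₀
  obtain ⟨ρ, hρ, hball⟩ := Metric.isOpen_iff.1 hΩ z₀ hz₀
  let F' : ℂ → OnePoint E → ℂ := fun z y =>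
    y.elim 0 fun x => pairing ξ (x : V) * Complex.exp (pairing (u + complexSMul z ξ) (x : V))
  have hderiv : ∀ y z, HasDerivAt (fun z => expFun (u + complexSMul z ξ) y) (F' z y) z := by
    intro y z
    induction y using OnePoint.rec with
    | infty => simpa [F'] using hasDerivAt_const z (0 : ℂ)
    | coe x =>
      have h1 : HasDerivAt (fun z : ℂ => pairing (u + complexSMul z ξ) (x : V))
          (pairing ξ (x : V)) z := by
        simp_rw [pairing_add, pairing_complexSMul]
        simpa using ((hasDerivAt_id z).mul_const (pairing ξ (x : V))).const_add (pairing u x)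
      have h2 := h1.cexp
      rw [mul_comm] at h2
      exact h2
  have hmeas : ∀ z, Measurable (F' z) := by
    intro z
    apply measurable_of_coe
    have : Continuous fun x : E => pairing ξ (x : V)
        * Complex.exp (pairing (u + complexSMul z ξ) (x : V)) :=
      ((continuous_pairing_right ξ).comp continuous_subtype_val).mul
        (Complex.continuous_exp.comp ((continuous_pairing_right _).comp continuous_subtype_val))
    exact this.measurable
  have hbound : ∀ y, ∀ z ∈ Metric.ball z₀ (ρ / 2), ‖F' z y‖ ≤ k / (ρ / 2 / 2) := by
    intro y z hz
    rw [← (hderiv y z).deriv]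
    refine Complex.norm_deriv_le_of_forall_mem_sphere_norm_le (by positivity) ?_ ?_
    · exact Differentiable.diffContOnCl fun w => (hderiv y w).differentiableAt
    · intro w hw
      refine norm_expFun_le (hmem w (hball ?_)) y
      rw [mem_sphere_iff_norm] at hw
      rw [Metric.mem_ball, dist_eq_norm] at hz ⊢
      calc ‖w - z₀‖ = ‖(w - z) + (z - z₀)‖ := by ring_nf
        _ ≤ ‖w - z‖ + ‖z - z₀‖ := norm_add_le _ _
        _ < ρ := by rw [hw]; linarith
  have := hasDerivAt_integral_of_dominated_loc_of_deriv_le (μ := κ)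
    (F := fun z y => expFun (u + complexSMul z ξ) y) (F' := F') (x₀ := z₀)
    (Metric.ball_mem_nhds z₀ (by positivity : 0 < ρ / 2)) (bound := fun _ => k / (ρ / 2 / 2))
    (Eventually.of_forall fun z => (measurable_expFun _).aestronglyMeasurable)
    (integrable_expFun (expBoundedBy_subset k (hmem z₀ hz₀)) κ)
    (hmeas z₀).aestronglyMeasurable
    (Eventually.of_forall fun y z hz => hbound y z hz) (integrable_const _)
    (Eventually.of_forall fun y z _ => hderiv y z)
  exact this.2.differentiableAt.differentiableWithinAt

end Lines

end AffineProcess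

namespace AffineProcess

/-! ### Holomorphic logarithms and strips. -/

section Analytic

/-- Near z₀ continuity keeps g within distance 1 < π of g(z₀), so g is g(z₀) plus a principal
logarithm of a holomorphic function. -/
lemma DifferentiableOn.of_exp {Ω : Set ℂ} (hΩ : IsOpen Ω) {g : ℂ → ℂ} (hc : ContinuousOn g Ω)
    (hd : DifferentiableOn ℂ (fun z => Complex.exp (g z)) Ω) : DifferentiableOn ℂ g Ω := by
  intro z₀ hz₀
  have hat := hΩ.mem_nhds hz₀
  have h1 : DifferentiableAt ℂ (fun z => Complex.exp (g z)) z₀ := hd.differentiableAt hat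
  have h2 : DifferentiableAt ℂ (fun z => Complex.exp (g z) / Complex.exp (g z₀)) z₀ :=
    h1.div_const _
  have h3 : DifferentiableAt ℂ
      (fun z => g z₀ + Complex.log (Complex.exp (g z) / Complex.exp (g z₀))) z₀ := by
    refine (h2.clog ?_).const_add _
    rw [div_self (Complex.exp_ne_zero _)]
    exact Complex.one_mem_slitPlane
  have hca : ContinuousAt g z₀ := hc.continuousAt hat
  have h4 : ∀ᶠ z in 𝓝 z₀, dist (g z) (g z₀) < 1 := Metric.tendsto_nhds.1 hca 1 one_pos
  refine (h3.congr_of_eventuallyEq ?_).differentiableWithinAt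
  filter_upwards [h4] with z hz
  rw [← Complex.exp_sub, Complex.log_exp]
  · ring
  · have := Complex.abs_im_le_norm (g z - g z₀)
    rw [dist_eq_norm] at hz
    have hpi := Real.pi_gt_three
    linarith [(abs_le.1 (this.trans hz.le)).1]
  · have := Complex.abs_im_le_norm (g z - g z₀)
    rw [dist_eq_norm] at hz
    have hpi := Real.pi_gt_three
    linarith [(abs_le.1 (this.trans hz.le)).2]

/-- Open mapping theorem: a nonconstant g would have an open image, which does not fit into the
imaginary axis. -/
lemma eq_of_differentiableOn_of_re_eq_zero {Ω : Set ℂ} (hΩ : IsOpen Ω) (hconn : IsPreconnected Ω)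
    {g : ℂ → ℂ} (hd : DifferentiableOn ℂ g Ω) (hre : ∀ z ∈ Ω, (g z).re = 0) {z w : ℂ}
    (hz : z ∈ Ω) (hw : w ∈ Ω) : g z = g w := by
  have ha : AnalyticOnNhd ℂ g Ω := hd.analyticOnNhd hΩ
  rcases ha.is_constant_or_isOpen hconn with ⟨c, hc⟩ | hopen
  · rw [hc z hz, hc w hw]
  · exfalso
    have h1 := hopen Ω Subset.rfl hΩ
    obtain ⟨ε, hε, hb⟩ := Metric.isOpen_iff.1 h1 (g z) ⟨z, hz, rfl⟩
    obtain ⟨z', hz', he⟩ := hb (show g z + (ε / 2 : ℝ) ∈ Metric.ball (g z) ε by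
      rw [mem_ball_iff_norm, add_sub_cancel_left, Complex.norm_real,
        Real.norm_of_nonneg (by positivity)]
      linarith)
    have h2 := hre z' hz'
    rw [he, Complex.add_re, hre z hz, Complex.ofReal_re] at h2
    linarith

/-- An open strip around the segment `[0, 1]` in the complex plane. -/
def strip (ρ : ℝ) : Set ℂ := {z | -ρ < z.re ∧ z.re < 1 + ρ ∧ |z.im| < ρ}

lemma isOpen_strip (ρ : ℝ) : IsOpen (strip ρ) := by
  have h1 : IsOpen {z : ℂ | -ρ < z.re} := isOpen_lt continuous_const Complex.continuous_re
  have h2 : IsOpen {z : ℂ | z.re < 1 + ρ} := isOpen_lt Complex.continuous_re continuous_const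
  have h3 : IsOpen {z : ℂ | |z.im| < ρ} := isOpen_lt Complex.continuous_im.abs continuous_const
  exact h1.inter (h2.inter h3)

lemma isPreconnected_strip (ρ : ℝ) : IsPreconnected (strip ρ) := by
  refine Convex.isPreconnected ?_
  intro z ⟨h1, h2, h3⟩ w ⟨g1, g2, g3⟩ a b ha hb hab
  rw [abs_lt] at h3 g3
  rcases ha.eq_or_lt with rfl | ha'
  · obtain rfl : b = 1 := by linarith
    simpa using ⟨g1, g2, abs_lt.2 g3⟩
  have e1 := mul_lt_mul_of_pos_left h1 ha'
  have e2 := mul_lt_mul_of_pos_left h2 ha'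
  have e3 := mul_lt_mul_of_pos_left h3.1 ha'
  have e4 := mul_lt_mul_of_pos_left h3.2 ha'
  have f1 := mul_le_mul_of_nonneg_left g1.le hb
  have f2 := mul_le_mul_of_nonneg_left g2.le hb
  have f3 := mul_le_mul_of_nonneg_left g3.1.le hb
  have f4 := mul_le_mul_of_nonneg_left g3.2.le hb
  obtain rfl : b = 1 - a := by linarith
  refine ⟨?_, ?_, abs_lt.2 ⟨?_, ?_⟩⟩ <;> simp <;> linarith

lemma ofReal_mem_strip {ρ : ℝ} (hρ : 0 < ρ) {τ : ℝ} (h0 : 0 ≤ τ) (h1 : τ ≤ 1) :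
    (τ : ℂ) ∈ strip ρ := ⟨by simp; linarith, by simp; linarith, by simpa⟩

end Analytic

/-! ### The neutral component of ψ. -/

section Autonomy

variable {V : Type*} [NormedAddCommGroup V] [InnerProductSpace ℝ V] {E : Set V}

/-- The orthogonal complement of the span of the barrier cone. -/
noncomputable def neutralSpace (E : Set V) : Submodule ℝ V := (Submodule.span ℝ (barrierCone E))ᗮ

lemma inner_eq_zero_of_mem_neutralSpace {a l : V} (ha : a ∈ Submodule.span ℝ (barrierCone E))
    (hl : l ∈ neutralSpace E) : inner ℝ a l = 0 :=
  Submodule.inner_right_of_mem_orthogonal ha hl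

variable [MeasurableSpace V] [BorelSpace V] {P : TransitionFunction E}
  {Φ : ℝ≥0 → ℝ≥0 → V × V → ℂ} {ψ : ℝ≥0 → ℝ≥0 → V × V → V × V}

/-- The neutral component of `ψ_{r,s}(u)` depends on the neutral component of `u` only. -/
lemma IsAffineData.inner_psi_snd_eq (h : IsAffineData P Φ ψ) {ι : Type*} [Nonempty ι]
    (b : AffineBasis ι ℝ V) (hb : range b ⊆ E) {r s : ℝ≥0} (hrs : r ≤ s) {k l : ℕ} {R : ℝ}
    (hne : ∀ u ∈ expBoundedBy E l, ‖u‖ ≤ R + 1 → ∀ v ∈ Icc r s, Φ v s u ≠ 0)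
    (hk : 1 ≤ k) (hkl : 2 * k ≤ l)
    {u₀ u₁ : V × V} (hu₀ : u₀ ∈ expBoundedBy E k) (hu₁ : u₁ ∈ expBoundedBy E k)
    (hR₀ : ‖u₀‖ ≤ R) (hR₁ : ‖u₁‖ ≤ R)
    (hsnd : (u₁ - u₀).2 ∈ Submodule.span ℝ (barrierCone E)) {w : V} (hw : w ∈ neutralSpace E) :
    inner ℝ (ψ r s u₀).2 w = inner ℝ (ψ r s u₁).2 w := by
  have hk0 : (0 : ℝ) < k := by exact_mod_cast hk
  have hlog : ∀ u ∈ expBoundedBy E k, ∀ x ∈ E, inner ℝ u.1 x ≤ Real.log k := fun u hu x hx => by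
    rw [Real.le_log_iff_exp_le hk0]; exact mem_expBoundedBy.1 hu x hx
  have hfst : (u₁ - u₀).1 ∈ Submodule.span ℝ (barrierCone E) :=
    Submodule.sub_mem _ (Submodule.subset_span ⟨_, hlog u₁ hu₁⟩)
      (Submodule.subset_span ⟨_, hlog u₀ hu₀⟩)
  have hlog2 : 0 < Real.log 2 := Real.log_pos (by norm_num)
  have hlog2' : Real.log 2 ≤ 1 := by linarith [Real.log_two_lt_d9]
  -- An allowance of log 2 in the exponent turns the bound k at the end points into 2k along the
  -- strip, hence 2k ≤ l.
  obtain ⟨a, ρ₀, hρ₀, hline⟩ := exists_line_shift (hlog u₀ hu₀) (hlog u₁ hu₁) hfst hsnd hlog2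
  set ξ := u₁ - u₀ with hξ
  let γ : ℝ → ℂ → V × V := fun ρ z => u₀ + complexSMul z ξ + (ρ • a, 0)
  have hγ : ∀ ρ, 0 < ρ → ρ ≤ ρ₀ → ∀ z ∈ strip ρ,
      γ ρ z ∈ expBoundedBy E l ∧ ‖γ ρ z‖ ≤ R + 1 := by
    intro ρ hρ hρ' z hz
    obtain ⟨p, -, h1, h2⟩ := hline ρ hρ hρ' z hz.1 hz.2.1 hz.2.2
    refine ⟨mem_expBoundedBy.2 fun x hx => ?_, h2.trans (add_le_add (max_le hR₀ hR₁) hlog2')⟩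
    refine (Real.exp_le_exp.2 (h1 x hx)).trans ?_
    have : (1 - p) * Real.log k + p * Real.log k + Real.log 2 = Real.log (2 * k) := by
      rw [Real.log_mul (by norm_num) hk0.ne']; ring
    rw [this, Real.exp_log (by positivity)]
    exact_mod_cast hkl
  have hψc : ContinuousOn (fun u => ψ r s u) (expBoundedBy E l ∩ {u | ‖u‖ ≤ R + 1}) := by
    have hc : Continuous fun u : V × V => ((r, s, u) : ℝ≥0 × ℝ≥0 × (V × V)) := by fun_prop
    exact (h.continuousOn_psi l).comp hc.continuousOn fun u hu =>
      ⟨⟨hrs, hu.1⟩, fun v h1 h2 => hne u hu.1 hu.2 v ⟨h1, h2⟩⟩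
  have hstep : ∀ ρ, 0 < ρ → ρ ≤ ρ₀ →
      inner ℝ (ψ r s (γ ρ 0)).2 w = inner ℝ (ψ r s (γ ρ 1)).2 w := by
    intro ρ hρ hρ'
    have hmem : ∀ z ∈ strip ρ, γ ρ z ∈ expBoundedBy E l := fun z hz => (hγ ρ hρ hρ' z hz).1
    have hγc : Continuous (γ ρ) := by
      have := continuous_complexSMul ξ
      fun_prop
    have hψγ : ContinuousOn (fun z => ψ r s (γ ρ z)) (strip ρ) :=
      hψc.comp hγc.continuousOn fun z hz => hγ ρ hρ hρ' z hz
    have hneγ : ∀ z ∈ strip ρ, Φ r s (γ ρ z) ≠ 0 := fun z hz =>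
      hne _ (hmem z hz) (hγ ρ hρ hρ' z hz).2 r ⟨le_rfl, hrs⟩
    have := P.isMarkovKernel r s hrs
    have htr : ∀ x : OnePoint E,
        DifferentiableOn ℂ (fun z => P.expTransform r s (γ ρ z) x) (strip ρ) := by
      intro x
      have := differentiableOn_integral_expFun (P.kernel r s x) (isOpen_strip ρ)
        (u := u₀ + (ρ • a, 0)) (ξ := ξ) (k := l) (fun z hz => by
          rw [add_right_comm]; exact hmem z hz)
      refine this.congr fun z _ => ?_
      simp only [γ, TransitionFunction.expTransform]
      rw [add_right_comm]
    -- The quotient of the transforms at x and y no longer contains Φ, so its continuous logarithm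
    -- ⟨ψ, x - y⟩ is holomorphic. Differences of points of E span V, which gives every component of
    -- ψ.
    have hdiff : ∀ x y : E, DifferentiableOn ℂ
        (fun z => pairing (ψ r s (γ ρ z)) ((x : V) - y)) (strip ρ) := by
      intro x y
      refine DifferentiableOn.of_exp (isOpen_strip ρ)
        ((continuous_pairing_left _).comp_continuousOn hψγ) ?_
      have hq : ∀ z ∈ strip ρ, ∀ x : E, P.expTransform r s (γ ρ z) (x : OnePoint E)
          = Φ r s (γ ρ z) * Complex.exp (pairing (ψ r s (γ ρ z)) (x : V)) := fun z hz x =>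
        h.affine r s hrs _ (expBoundedBy_subset l (hmem z hz)) x
      refine ((htr x).div (htr y) fun z hz => ?_).congr fun z hz => ?_
      · rw [hq z hz y]
        exact mul_ne_zero (hneγ z hz) (Complex.exp_ne_zero _)
      · rw [Pi.div_apply, hq z hz x, hq z hz y, mul_div_mul_left _ _ (hneγ z hz), pairing_sub_right,
          Complex.exp_sub]
    have hspan : vectorSpan ℝ (range b) = ⊤ := by
      rw [← direction_affineSpan, b.tot, AffineSubspace.direction_top]
    have hall : ∀ y : V, DifferentiableOn ℂ (fun z => pairing (ψ r s (γ ρ z)) y) (strip ρ) := by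
      intro y
      have hy : y ∈ vectorSpan ℝ (range b) := by rw [hspan]; trivial
      rw [vectorSpan_def] at hy
      induction hy using Submodule.span_induction with
      | mem y hy =>
        obtain ⟨x, hx, x', hx', rfl⟩ := hy
        exact hdiff ⟨x, hb hx⟩ ⟨x', hb hx'⟩
      | zero =>
        refine (differentiableOn_const (0 : ℂ)).congr fun z _ => ?_
        simp [pairing]
      | add y y' _ _ hy hy' =>
        refine (hy.add hy').congr fun z _ => ?_
        simp [pairing, inner_add_right]; ring
      | smul c y _ hy =>
        refine (hy.const_mul (c : ℂ)).congr fun z _ => ?_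
        simp [pairing, inner_smul_right]; ring
    -- Re ψ lies in the barrier cone because f_ψ is bounded on E, and w is orthogonal to that cone.
    have hre : ∀ z ∈ strip ρ, (pairing (ψ r s (γ ρ z)) w).re = 0 := by
      intro z hz
      rw [pairing_re]
      refine inner_eq_zero_of_mem_neutralSpace (Submodule.subset_span ?_) hw
      exact mem_expBounded_iff_fst.1
        (h.affine.psi_mem_expBounded hrs (expBoundedBy_subset l (hmem z hz)) (hneγ z hz))
    have := eq_of_differentiableOn_of_re_eq_zero (isOpen_strip ρ) (isPreconnected_strip ρ)
      (hall w) hre (by simpa using ofReal_mem_strip hρ le_rfl zero_le_one)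
      (by simpa using ofReal_mem_strip hρ zero_le_one le_rfl : (1 : ℂ) ∈ strip ρ)
    have := congrArg Complex.im this
    simpa only [pairing_im] using this
  -- The end points themselves may lie on the boundary of the domain; they are reached from the
  -- shifted line by letting ρ ↓ 0.
  have hlim : ∀ τ : ℝ, τ = 0 ∨ τ = 1 → ∀ u, u ∈ expBoundedBy E k → ‖u‖ ≤ R →
      (∀ ρ, γ ρ (τ : ℂ) = u + (ρ • a, 0)) →
      Tendsto (fun ρ => inner ℝ (ψ r s (γ ρ (τ : ℂ))).2 w) (𝓝[>] 0) (𝓝 (inner ℝ (ψ r s u).2 w)) := by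
    intro τ hτ u hu huR hγu
    have hmem : u ∈ expBoundedBy E l ∩ {u | ‖u‖ ≤ R + 1} :=
      ⟨expBoundedBy_mono (by omega) hu, huR.trans (by linarith)⟩
    have h1 : Tendsto (fun ρ : ℝ => γ ρ (τ : ℂ)) (𝓝[>] 0)
        (𝓝[expBoundedBy E l ∩ {u | ‖u‖ ≤ R + 1}] u) := by
      refine tendsto_nhdsWithin_iff.2 ⟨?_, ?_⟩
      · have hc : Continuous fun ρ : ℝ => u + ((ρ • a, 0) : V × V) := by fun_prop
        have := hc.tendsto 0
        simp only [zero_smul, Prod.mk_zero_zero, add_zero] at this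
        simp_rw [hγu]
        exact this.mono_left nhdsWithin_le_nhds
      · filter_upwards [Ioc_mem_nhdsGT hρ₀] with ρ hρ
        exact hγ ρ hρ.1 hρ.2 _ (ofReal_mem_strip hρ.1 (by rcases hτ with rfl | rfl <;> simp)
          (by rcases hτ with rfl | rfl <;> simp))
    have h2 := (hψc u hmem).tendsto.comp h1
    exact ((continuous_snd.tendsto _).comp h2).inner tendsto_const_nhds
  have hl0 := hlim 0 (Or.inl rfl) u₀ hu₀ hR₀ (fun ρ => by simp [γ, complexSMul])
  have hl1 := hlim 1 (Or.inr rfl) u₁ hu₁ hR₁ (fun ρ => by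
    have h1 : complexSMul (1 : ℂ) ξ = ξ := by simp [complexSMul]
    change u₀ + complexSMul ((1 : ℝ) : ℂ) ξ + _ = _
    rw [Complex.ofReal_one, h1, hξ, add_sub_cancel])
  refine tendsto_nhds_unique (hl0.congr' ?_) hl1
  filter_upwards [Ioc_mem_nhdsGT hρ₀] with ρ hρ
  simpa using hstep ρ hρ.1 hρ.2

end Autonomy

/-! ### Analytic continuation of transforms of finite measures. -/

section Extension

variable {V : Type*} [NormedAddCommGroup V] [InnerProductSpace ℝ V] {E : Set V}
  [MeasurableSpace V] [BorelSpace V]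

lemma continuousOn_integral_expFun (κ : Measure (OnePoint E)) [IsFiniteMeasure κ] (k : ℕ) :
    ContinuousOn (fun u => ∫ y, expFun u y ∂κ) (expBoundedBy E k) :=
  continuousOn_of_dominated (bound := fun _ => (k : ℝ))
    (fun u _ => (measurable_expFun u).aestronglyMeasurable)
    (fun _ hu => Eventually.of_forall fun y => norm_expFun_le hu y) (integrable_const _)
    (Eventually.of_forall fun y => (continuous_expFun y).continuousOn)

/-- If two finite measures have the same exponential transforms near the imaginary point `i q`
then they have the same exponential transforms at all points with the same neutral component. -/
lemma integral_expFun_eq_of_eqOn (κ₁ κ₂ : Measure (OnePoint E)) [IsFiniteMeasure κ₁]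
    [IsFiniteMeasure κ₂] {q : V} {R : ℝ} (hqR : ‖q‖ < R)
    (hD : ∀ u ∈ expBoundedBy E 4, ‖u‖ ≤ R → ∫ y, expFun u y ∂κ₁ = ∫ y, expFun u y ∂κ₂)
    {u : V × V} (hu : u ∈ expBounded E)
    (hq : q - u.2 ∈ Submodule.span ℝ (barrierCone E)) :
    ∫ y, expFun u y ∂κ₁ = ∫ y, expFun u y ∂κ₂ := by
  obtain ⟨C, hC⟩ := mem_expBounded.1 hu
  obtain ⟨k, hk⟩ := exists_nat_ge (Real.exp (|C| + Real.log 2))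
  have hlog2 : 0 < Real.log 2 := Real.log_pos (by norm_num)
  have hC' : ∀ x ∈ E, inner ℝ u.1 x ≤ |C| := fun x hx => (hC x hx).trans (le_abs_self C)
  -- The line runs from u at z = 0 to iq at z = 1. Equality holds near z = 1, and the identity
  -- theorem carries it to z = 0 for each small shift ρ.
  obtain ⟨a, ρ₀, hρ₀, hline⟩ := exists_line_shift (u₁ := (0, q)) (C₁ := 0) hC' (by simp)
    (by simpa using Submodule.subset_span (mem_expBounded_iff_fst.1 hu))
    (by simpa using hq) hlog2
  set ξ : V × V := (0, q) - u with hξ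
  let γ : ℝ → ℂ → V × V := fun ρ z => u + complexSMul z ξ + (ρ • a, 0)
  have hγk : ∀ ρ, 0 < ρ → ρ ≤ ρ₀ → ∀ z ∈ strip ρ, γ ρ z ∈ expBoundedBy E k := by
    intro ρ hρ hρ' z hz
    obtain ⟨p, hp, h1, -⟩ := hline ρ hρ hρ' z hz.1 hz.2.1 hz.2.2
    refine mem_expBoundedBy.2 fun x hx => (Real.exp_le_exp.2 ((h1 x hx).trans ?_)).trans hk
    have hp0 : 0 ≤ p := hp ▸ le_max_left _ _
    nlinarith [abs_nonneg C]
  have hone : complexSMul (1 : ℂ) ξ = ξ := by simp [complexSMul]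
  have hzero : complexSMul (0 : ℂ) ξ = 0 := by
    refine Prod.ext ?_ ?_ <;> simp [complexSMul]
  have hstep : ∀ᶠ ρ in 𝓝[>] (0 : ℝ),
      ∫ y, expFun (u + (ρ • a, 0)) y ∂κ₁ = ∫ y, expFun (u + (ρ • a, 0)) y ∂κ₂ := by
    have hρ₁ : 0 < (R - ‖q‖) / (‖a‖ + 1) := div_pos (by linarith) (by positivity)
    filter_upwards [Ioc_mem_nhdsGT hρ₀, Ioo_mem_nhdsGT hρ₁] with ρ hρ hρ'
    have hγc : Continuous (γ ρ) := by
      have := continuous_complexSMul ξ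
      fun_prop
    have hγ1 : γ ρ 1 = (ρ • a, q) := by
      change u + complexSMul (1 : ℂ) ξ + _ = _
      rw [hone, hξ, add_sub_cancel]; simp
    have hn1 : ‖γ ρ 1‖ < R := by
      have h2 : ρ * ‖a‖ < R - ‖q‖ := by
        have := (lt_div_iff₀ (by positivity)).1 hρ'.2
        have := hρ.1
        nlinarith
      rw [hγ1, Prod.norm_mk, norm_smul, Real.norm_of_nonneg hρ.1.le]
      exact max_lt (by linarith [norm_nonneg q]) hqR
    have hdiff : ∀ (κ : Measure (OnePoint E)) [IsFiniteMeasure κ],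
        DifferentiableOn ℂ (fun z => ∫ y, expFun (γ ρ z) y ∂κ) (strip ρ) := by
      intro κ _
      refine (differentiableOn_integral_expFun κ (isOpen_strip ρ)
        (u := u + (ρ • a, 0)) (ξ := ξ) (k := k) (fun z hz => by
          rw [add_right_comm]; exact hγk ρ hρ.1 hρ.2 z hz)).congr fun z _ => ?_
      simp only [γ]
      rw [add_right_comm]
    have h0s : (0 : ℂ) ∈ strip ρ := by simpa using ofReal_mem_strip hρ.1 le_rfl zero_le_one
    have h1s : (1 : ℂ) ∈ strip ρ := by simpa using ofReal_mem_strip hρ.1 zero_le_one le_rfl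
    -- Near z = 1 the interpolated bound (1 - p)|C| is below log 2, and the shift costs another log
    -- 2; this is the origin of the constant 4 in `hD`.
    have hev : (fun z => ∫ y, expFun (γ ρ z) y ∂κ₁) =ᶠ[𝓝 1] fun z => ∫ y, expFun (γ ρ z) y ∂κ₂ := by
      have e1 : ∀ᶠ z in 𝓝 (1 : ℂ), ‖γ ρ z‖ < R :=
        (hγc.norm.tendsto 1).eventually_lt_const hn1
      have e2 : ∀ᶠ z : ℂ in 𝓝 (1 : ℂ), (1 - max 0 (min 1 z.re)) * |C| < Real.log 2 := by
        have hc : Continuous fun z : ℂ => (1 - max 0 (min 1 z.re)) * |C| := by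
          have := Complex.continuous_re
          fun_prop
        refine (hc.tendsto 1).eventually_lt_const ?_
        simpa using hlog2
      filter_upwards [e1, e2, (isOpen_strip ρ).mem_nhds h1s] with z h1 h2 h3
      refine hD _ ?_ h1.le
      obtain ⟨p, hp, h4, -⟩ := hline ρ hρ.1 hρ.2 z h3.1 h3.2.1 h3.2.2
      refine mem_expBoundedBy.2 fun x hx => ?_
      rw [← hp] at h2
      have h5 : inner ℝ (γ ρ z).1 x ≤ Real.log 4 := by
        have : Real.log 4 = Real.log 2 + Real.log 2 := by
          rw [← Real.log_mul (by norm_num) (by norm_num)]; norm_num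
        refine (h4 x hx).trans ?_
        rw [this]; linarith
      refine (Real.exp_le_exp.2 h5).trans ?_
      rw [Real.exp_log (by norm_num)]; norm_num
    have := ((hdiff κ₁).analyticOnNhd (isOpen_strip ρ)).eqOn_of_preconnected_of_eventuallyEq
      ((hdiff κ₂).analyticOnNhd (isOpen_strip ρ)) (isPreconnected_strip ρ) h1s hev h0s
    simpa [γ, hzero] using this
  have hlim : ∀ (κ : Measure (OnePoint E)) [IsFiniteMeasure κ],
      Tendsto (fun ρ : ℝ => ∫ y, expFun (u + (ρ • a, 0)) y ∂κ) (𝓝[>] 0)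
        (𝓝 (∫ y, expFun u y ∂κ)) := by
    intro κ _
    have hmem : u ∈ expBoundedBy E k := mem_expBoundedBy.2 fun x hx =>
      (Real.exp_le_exp.2 ((hC' x hx).trans (by linarith))).trans hk
    refine (continuousOn_integral_expFun κ k u hmem).tendsto.comp
      (tendsto_nhdsWithin_iff.2 ⟨?_, ?_⟩)
    · have hc : Continuous fun ρ : ℝ => u + ((ρ • a, 0) : V × V) := by fun_prop
      have := hc.tendsto 0
      simp only [zero_smul, Prod.mk_zero_zero, add_zero] at this
      exact this.mono_left nhdsWithin_le_nhds
    · filter_upwards [Ioc_mem_nhdsGT hρ₀] with ρ hρ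
      have := hγk ρ hρ.1 hρ.2 0 (by simpa using ofReal_mem_strip hρ.1 le_rfl zero_le_one)
      simpa [γ, hzero] using this
  exact tendsto_nhds_unique ((hlim κ₁).congr' hstep) (hlim κ₂)

end Extension

end AffineProcess

namespace AffineProcess

/-! ### Stability of additivity, and products of nearly linear steps. -/

section Stability

variable {F : Type*} [NormedAddCommGroup F] [NormedSpace ℝ F]

/-- Stability of the additive functional equation on an interval. -/
lemma norm_sub_smul_le_of_approx_additive {f : ℝ → F} {R e M : ℝ} (hR : 0 < R)
    (hM : ∀ x, |x| ≤ R → ‖f x‖ ≤ M)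
    (hf : ∀ x y, |x| ≤ R → |y| ≤ R → |x + y| ≤ R → ‖f (x + y) - f x - f y‖ ≤ e)
    {x : ℝ} (hx : |x| ≤ R) : ‖f x - (x / R) • f R‖ ≤ 8 * e := by
  set g : ℝ → F := fun x => f x - (x / R) • f R with hg
  have hgR : g R = 0 := by simp [hg, div_self hR.ne']
  have hadd : ∀ x y, |x| ≤ R → |y| ≤ R → |x + y| ≤ R → ‖g (x + y) - g x - g y‖ ≤ e := by
    intro x y hx hy hxy
    have : g (x + y) - g x - g y = f (x + y) - f x - f y := by
      simp only [hg, add_div, add_smul]; abel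
    rw [this]; exact hf x y hx hy hxy
  have hRR : |R| ≤ R := (abs_of_pos hR).le
  have hmR : |-R| ≤ R := by rw [abs_neg]; exact hRR
  have h00 : |(0 : ℝ)| ≤ R := by rw [abs_zero]; exact hR.le
  have h0 : ‖g 0‖ ≤ e := by
    have := hadd 0 0 h00 h00 (by simpa using hR.le)
    simpa using this
  have hneg : ‖g (-R)‖ ≤ 2 * e := by
    have h1 := hadd R (-R) hRR hmR (by simpa using hR.le)
    rw [add_neg_cancel, hgR, sub_zero] at h1
    have : g (-R) = g 0 - (g 0 - g (-R)) := by abel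
    rw [this]
    linarith [norm_sub_le (g 0) (g 0 - g (-R))]
  have hM0 : ∀ x, |x| ≤ R → ‖g x‖ ≤ 2 * M := by
    intro x hx
    have h1 : ‖(x / R) • f R‖ ≤ M := by
      rw [norm_smul, Real.norm_eq_abs, abs_div, abs_of_pos hR]
      have h2 : |x| / R ≤ 1 := (div_le_one hR).2 hx
      have h3 := hM R hRR
      have h4 : 0 ≤ |x| / R := by positivity
      nlinarith [norm_nonneg (f R)]
    linarith [norm_sub_le (f x) ((x / R) • f R), hM x hx]
  -- Doubling improves a bound N to (N + e)/2 on the inner half |x| ≤ R/2. A point of the outer half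
  -- is moved there by ±R, at a cost of at most 3e because g(R) = 0 and |g(-R)| ≤ 2e. Iterating N ↦
  -- N/2 + 4e leads to the fixed point 8e.
  have hiter : ∀ N : ℝ, (∀ x, |x| ≤ R → ‖g x‖ ≤ N) → ∀ x, |x| ≤ R → ‖g x‖ ≤ N / 2 + 4 * e := by
    intro N hN x hx
    have he : 0 ≤ e := (norm_nonneg _).trans h0
    have hhalf : ∀ x, |x| ≤ R / 2 → ‖g x‖ ≤ (N + e) / 2 := by
      intro x hx
      have h2 : |x + x| ≤ R := (abs_add_le x x).trans (by linarith)
      have h1 := hadd x x (by linarith) (by linarith) h2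
      have h3 : (2 : ℝ) • g x = g (x + x) - (g (x + x) - g x - g x) := by rw [two_smul]; abel
      have h4 := norm_sub_le (g (x + x)) (g (x + x) - g x - g x)
      rw [← h3, norm_smul] at h4
      have := hN _ h2
      norm_num at h4
      linarith
    rcases le_or_gt |x| (R / 2) with h | h
    · have := hhalf x h; linarith
    · rw [abs_le] at hx
      rcases le_total 0 x with hx0 | hx0
      · rw [abs_of_nonneg hx0] at h
        have hs : |x - R| ≤ R / 2 := by rw [abs_le]; constructor <;> linarith
        have h1 := hadd R (x - R) hRR (by linarith) (by rw [add_sub_cancel, abs_le]; exact hx)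
        rw [add_sub_cancel, hgR, sub_zero] at h1
        have h2 : g x = (g x - g (x - R)) + g (x - R) := by abel
        rw [h2]
        linarith [norm_add_le (g x - g (x - R)) (g (x - R)), hhalf _ hs]
      · rw [abs_of_nonpos hx0] at h
        have hs : |x + R| ≤ R / 2 := by rw [abs_le]; constructor <;> linarith
        have h1 := hadd (-R) (x + R) hmR (by linarith)
          (by rw [neg_add_cancel_comm_assoc, abs_le]; exact hx)
        rw [neg_add_cancel_comm_assoc] at h1
        have h2 : g x = (g x - g (-R) - g (x + R)) + g (-R) + g (x + R) := by abel
        rw [h2]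
        linarith [norm_add_le (g x - g (-R) - g (x + R) + g (-R)) (g (x + R)), hhalf _ hs,
          norm_add_le (g x - g (-R) - g (x + R)) (g (-R))]
  have hall : ∀ n : ℕ, ∀ x, |x| ≤ R → ‖g x‖ ≤ 2 * M * (1 / 2) ^ n + 8 * e := by
    intro n
    induction n with
    | zero => intro x hx; have := hM0 x hx; have := (norm_nonneg _).trans h0; simp; linarith
    | succ n ih =>
      intro x hx
      refine (hiter _ ih x hx).trans (le_of_eq ?_)
      rw [pow_succ]; ring
  have hlim : Tendsto (fun n : ℕ => 2 * M * (1 / 2 : ℝ) ^ n + 8 * e) atTop (𝓝 (8 * e)) := by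
    have := (tendsto_pow_atTop_nhds_zero_of_lt_one (by norm_num : (0 : ℝ) ≤ 1 / 2)
      (by norm_num)).const_mul (2 * M)
    simpa using this.add_const (8 * e)
  exact ge_of_tendsto' hlim fun n => hall n x hx

/-- Stability of the additive functional equation on a ball. -/
lemma exists_linear_of_approx_additive {W : Type*} [NormedAddCommGroup W] [InnerProductSpace ℝ W]
    [FiniteDimensional ℝ W] {g : W → F} {R e M : ℝ} (hR : 0 < R)
    (hM : ∀ c, ‖c‖ ≤ R → ‖g c‖ ≤ M)
    (hg : ∀ c₁ c₂, ‖c₁‖ ≤ R → ‖c₂‖ ≤ R → ‖c₁ + c₂‖ ≤ R → ‖g (c₁ + c₂) - g c₁ - g c₂‖ ≤ e) :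
    ∃ A : W →L[ℝ] F, ∀ c, ‖c‖ ≤ R → ‖g c - A c‖ ≤ (9 * Module.finrank ℝ W + 1) * e := by
  set d := Module.finrank ℝ W with hd
  let v := stdOrthonormalBasis ℝ W
  let A : W →L[ℝ] F :=
    ∑ k, ((1 / R) • (innerSL ℝ (v k)).smulRight (g (R • v k)))
  refine ⟨A, fun c hc => ?_⟩
  have h00 : ‖(0 : W)‖ ≤ R := by simpa using hR.le
  have h0 : ‖g 0‖ ≤ e := by simpa using hg 0 0 h00 h00 (by simpa using hR.le)
  have he : 0 ≤ e := (norm_nonneg _).trans h0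
  have hvk : ∀ k, ‖v k‖ = 1 := fun k => v.orthonormal.1 k
  have hcoef : ∀ k, |inner ℝ (v k) c| ≤ R := fun k =>
    (abs_real_inner_le_norm _ _).trans (by rw [hvk, one_mul]; exact hc)
  -- Approximate additivity is known only inside the ball, so the partial sums of the orthonormal
  -- expansion must not leave it.
  have hpart : ∀ S : Finset (Fin d), ‖∑ k ∈ S, inner ℝ (v k) c • v k‖ ≤ R := by
    intro S
    refine le_trans ?_ hc
    have h1 : ‖∑ k ∈ S, inner ℝ (v k) c • v k‖ ^ 2 = ∑ k ∈ S, inner ℝ (v k) c ^ 2 := by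
      rw [← real_inner_self_eq_norm_sq, v.orthonormal.inner_sum]
      simp only [conj_trivial, sq]
      rfl
    have h2 : ‖c‖ ^ 2 = ∑ k, inner ℝ (v k) c ^ 2 := by
      rw [← real_inner_self_eq_norm_sq, ← v.sum_inner_mul_inner c c]
      exact Finset.sum_congr rfl fun k _ => by rw [real_inner_comm, sq]
    refine (abs_le_of_sq_le_sq' ?_ (norm_nonneg c)).2
    rw [h1, h2]
    exact Finset.sum_le_sum_of_subset_of_nonneg (Finset.subset_univ S) fun k _ _ => sq_nonneg _
  have hsingle : ∀ k, ‖inner ℝ (v k) c • v k‖ ≤ R := fun k => by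
    rw [norm_smul, hvk, mul_one]; exact hcoef k
  -- Splitting off the coordinates costs (d + 1)e, and linearizing each of the d coordinates costs
  -- 8e; together (9d + 1)e.
  have hsum : ∀ S : Finset (Fin d), ‖g (∑ k ∈ S, inner ℝ (v k) c • v k)
      - ∑ k ∈ S, g (inner ℝ (v k) c • v k)‖ ≤ (S.card + 1) * e := by
    intro S
    induction S using Finset.induction_on with
    | empty => simpa using h0
    | insert a S ha ih =>
      rw [Finset.sum_insert ha, Finset.sum_insert ha, Finset.card_insert_of_notMem ha]
      have h1 := hg _ _ (hsingle a) (hpart S) (by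
        have := hpart (insert a S); rwa [Finset.sum_insert ha] at this)
      set X := inner ℝ (v a) c • v a
      set Y := ∑ k ∈ S, inner ℝ (v k) c • v k
      have h2 : g (X + Y) - (g X + ∑ k ∈ S, g (inner ℝ (v k) c • v k))
          = (g (X + Y) - g X - g Y) + (g Y - ∑ k ∈ S, g (inner ℝ (v k) c • v k)) := by abel
      rw [h2]
      refine (norm_add_le _ _).trans ?_
      push_cast
      linarith
  have hone : ∀ k, ‖g (inner ℝ (v k) c • v k) - (inner ℝ (v k) c / R) • g (R • v k)‖ ≤ 8 * e := by
    intro k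
    have hn : ∀ x : ℝ, ‖x • v k‖ = |x| := fun x => by rw [norm_smul, hvk, mul_one, Real.norm_eq_abs]
    exact norm_sub_smul_le_of_approx_additive (f := fun x => g (x • v k)) hR
      (fun x hx => hM _ (by rwa [hn])) (fun x y hx hy hxy => by
        simp only [add_smul]
        exact hg _ _ (by rwa [hn]) (by rwa [hn]) (by rwa [← add_smul, hn])) (hcoef k)
  have hA : A c = ∑ k, (inner ℝ (v k) c / R) • g (R • v k) := by
    simp only [A, sum_apply, smul_apply,
      ContinuousLinearMap.smulRight_apply, innerSL_apply_apply, smul_smul]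
    exact Finset.sum_congr rfl fun k _ => by rw [one_div, inv_mul_eq_div]
  have hcsum : ∑ k, inner ℝ (v k) c • v k = c := v.sum_repr' c
  have h1 := hsum Finset.univ
  rw [hcsum, Finset.card_univ, Fintype.card_fin] at h1
  have h2 : ‖∑ k, g (inner ℝ (v k) c • v k) - A c‖ ≤ d * (8 * e) := by
    rw [hA, ← Finset.sum_sub_distrib]
    refine (norm_sum_le _ _).trans ?_
    refine (Finset.sum_le_sum fun k _ => hone k).trans ?_
    simp [hd]
  have h3 : g c - A c = (g c - ∑ k, g (inner ℝ (v k) c • v k))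
      + (∑ k, g (inner ℝ (v k) c • v k) - A c) := by abel
  rw [h3]
  refine (norm_add_le _ _).trans ?_
  nlinarith

/-- The partial products `A 0 ∘ A 1 ∘ ⋯ ∘ A (i - 1)`. -/
def leftProd (A : ℕ → F →L[ℝ] F) : ℕ → F →L[ℝ] F
  | 0 => ContinuousLinearMap.id ℝ F
  | i + 1 => (leftProd A i).comp (A i)

/-- A nonlinear backward flow with nearly linear steps is close to the linear flow of the
steps. -/
lemma norm_flow_sub_leftProd_le {A : ℕ → F →L[ℝ] F} {Y : ℕ → ℕ → F → F} {N : ℕ} {e : ℕ → ℝ}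
    {ρ M : ℝ} (hρ : 0 < ρ) (hM : ρ ≤ M) (hYself : ∀ i ≤ N, ∀ c, ‖c‖ ≤ ρ → Y i i c = c)
    (hYM : ∀ i j, i ≤ j → j ≤ N → ∀ c, ‖c‖ ≤ ρ → ‖Y i j c‖ ≤ M)
    (hstep : ∀ i j, i < j → j ≤ N → ∀ c, ‖c‖ ≤ ρ → ‖Y i j c - A i (Y (i + 1) j c)‖ ≤ e i)
    (he0 : ∀ i, 0 ≤ e i) (he : ∑ i ∈ Finset.range N, e i ≤ ρ / 2) {c : F} (hc : ‖c‖ ≤ ρ) :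
    ‖Y 0 N c - leftProd A N c‖ ≤ 2 * M / ρ * ∑ i ∈ Finset.range N, e i := by
  have htele : ∀ j ≤ N, ∀ c, ‖c‖ ≤ ρ →
      ‖Y 0 j c - leftProd A j c‖ ≤ ∑ i ∈ Finset.range j, ‖leftProd A i‖ * e i := by
    intro j hj c hc
    -- The linear steps are inserted from the left, so the error of step i is propagated only by the
    -- linear map `leftProd A i`. No Lipschitz bound for the nonlinear flow is needed.
    have h1 : ∀ m ≤ j, ‖Y 0 j c - leftProd A m (Y m j c)‖
        ≤ ∑ i ∈ Finset.range m, ‖leftProd A i‖ * e i := by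
      intro m
      induction m with
      | zero => intro _; simp [leftProd]
      | succ m ih =>
        intro hm
        rw [Finset.sum_range_succ]
        have h2 : Y 0 j c - leftProd A (m + 1) (Y (m + 1) j c)
            = (Y 0 j c - leftProd A m (Y m j c))
              + leftProd A m (Y m j c - A m (Y (m + 1) j c)) := by
          rw [map_sub]
          simp only [leftProd, ContinuousLinearMap.comp_apply]; abel
        rw [h2]
        refine (norm_add_le _ _).trans (add_le_add (ih (by omega)) ?_)
        exact (ContinuousLinearMap.le_opNorm _ _).trans
          (mul_le_mul_of_nonneg_left (hstep m j (by omega) hj c hc) (norm_nonneg _))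
    have := h1 j le_rfl
    rwa [hYself j hj c hc] at this
  have hM0 : 0 < M := hρ.trans_le hM
  -- Bootstrap: if all earlier products have norm at most 2M/ρ, the accumulated error on the ball of
  -- radius ρ is at most (2M/ρ)(ρ/2) = M, so the next product is bounded there by M + M.
  have hS : ∀ j ≤ N, ‖leftProd A j‖ ≤ 2 * M / ρ := by
    intro j
    induction j using Nat.strong_induction_on with
    | _ j ih =>
      intro hj
      have hbd : ∀ c, ‖c‖ ≤ ρ → ‖leftProd A j c‖ ≤ 2 * M := by
        intro c hc
        have h1 := htele j hj c hc
        have h2 : ∑ i ∈ Finset.range j, ‖leftProd A i‖ * e i ≤ 2 * M / ρ * (ρ / 2) := by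
          calc ∑ i ∈ Finset.range j, ‖leftProd A i‖ * e i
              ≤ ∑ i ∈ Finset.range j, 2 * M / ρ * e i :=
                Finset.sum_le_sum fun i hi => mul_le_mul_of_nonneg_right
                  (ih i (Finset.mem_range.1 hi) ((Finset.mem_range.1 hi).le.trans hj)) (he0 i)
            _ = 2 * M / ρ * ∑ i ∈ Finset.range j, e i := by rw [Finset.mul_sum]
            _ ≤ 2 * M / ρ * (ρ / 2) := by
                refine mul_le_mul_of_nonneg_left (le_trans ?_ he) (by positivity)
                exact Finset.sum_le_sum_of_subset_of_nonneg
                  (Finset.range_mono hj) fun i _ _ => he0 i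
        have h3 : 2 * M / ρ * (ρ / 2) = M := by field_simp
        have h4 := hYM 0 j (Nat.zero_le j) hj c hc
        have h5 : leftProd A j c = Y 0 j c - (Y 0 j c - leftProd A j c) := by abel
        rw [h5]
        linarith [norm_sub_le (Y 0 j c) (Y 0 j c - leftProd A j c)]
      refine ContinuousLinearMap.opNorm_le_bound _ (by positivity) fun c => ?_
      rcases eq_or_ne c 0 with rfl | hc0
      · simp
      have hcn : 0 < ‖c‖ := norm_pos_iff.2 hc0
      have h1 := hbd ((ρ / ‖c‖) • c) (by
        rw [norm_smul, Real.norm_eq_abs, abs_of_pos (by positivity), div_mul_cancel₀ _ hcn.ne'])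
      rw [map_smul, norm_smul, Real.norm_eq_abs, abs_of_pos (by positivity)] at h1
      rw [div_mul_eq_mul_div, le_div_iff₀ hρ]
      rw [div_mul_eq_mul_div, div_le_iff₀ hcn] at h1
      linarith
  refine (htele N le_rfl c hc).trans ?_
  rw [Finset.mul_sum]
  exact Finset.sum_le_sum fun i hi =>
    mul_le_mul_of_nonneg_right (hS i (Finset.mem_range.1 hi).le) (he0 i)

end Stability

end AffineProcess

namespace AffineProcess

/-! ### Near-additivity of the phase of a characteristic function. -/

section Phase

variable {V : Type*} [NormedAddCommGroup V] [InnerProductSpace ℝ V] {E : Set V}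

lemma expFun_imag_add (c₁ c₂ : V) (y : OnePoint E) :
    expFun (0, c₁ + c₂) y = expFun (0, c₁) y * expFun (0, c₂) y := by
  induction y using OnePoint.rec with
  | infty => simp [expFun_infty]
  | coe x =>
    rw [expFun_coe, expFun_coe, expFun_coe, ← Complex.exp_add, ← pairing_add]
    simp

variable [MeasurableSpace V] [BorelSpace V]

/-- If the characteristic function is close to the unit circle at `c₁` and `c₂`, then its phase is
almost additive there. -/
lemma abs_im_integral_expFun_add_le (κ : Measure (OnePoint E)) [IsProbabilityMeasure κ]
    {c₁ c₂ : V} {z₁ z₂ : ℂ} (hz₁ : ‖z₁‖ ≤ 1) (hz₂ : ‖z₂‖ ≤ 1)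
    (h₁ : (z₁ * ∫ y, expFun (0, c₁) y ∂κ).im = 0) (h₂ : (z₂ * ∫ y, expFun (0, c₂) y ∂κ).im = 0) :
    |(z₁ * z₂ * ∫ y, expFun (0, c₁ + c₂) y ∂κ).im|
      ≤ (1 - (z₁ * ∫ y, expFun (0, c₁) y ∂κ).re)
        + (1 - (z₂ * ∫ y, expFun (0, c₂) y ∂κ).re) := by
  have hint : ∀ (z : ℂ) (c : V), Integrable (fun y => z * expFun (0, c) y) κ := fun z c =>
    (integrable_expFun (expBoundedBy_subset 1 (imag_mem_expBoundedBy c le_rfl)) κ).const_mul z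
  rw [← integral_const_mul] at h₁ h₂ ⊢
  rw [← integral_const_mul, ← integral_const_mul]
  have him : ∀ (f : OnePoint E → ℂ), Integrable f κ → (∫ y, f y ∂κ).im = ∫ y, (f y).im ∂κ :=
    fun f hf => (integral_im hf).symm
  have hre : ∀ (f : OnePoint E → ℂ), Integrable f κ → (∫ y, f y ∂κ).re = ∫ y, (f y).re ∂κ :=
    fun f hf => (integral_re hf).symm
  rw [him _ (hint _ _)] at h₁ h₂ ⊢
  rw [hre _ (hint _ _), hre _ (hint _ _)]
  have i1 := (hint z₁ c₁).im
  have i2 := (hint z₂ c₂).im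
  have r1 := (hint z₁ c₁).re
  have r2 := (hint z₂ c₂).re
  have i3 := (hint (z₁ * z₂) (c₁ + c₂)).im
  simp only [RCLike.im_to_complex, RCLike.re_to_complex] at i1 i2 i3 r1 r2
  -- The two subtracted integrals vanish. Afterwards the claim is pointwise: for a, b in the unit
  -- disc, Im(ab) - Im a - Im b = -(1 - Re a) Im b - (1 - Re b) Im a.
  have e1 : ∫ y, (z₁ * z₂ * expFun (0, c₁ + c₂) y).im ∂κ
      = ∫ y, ((z₁ * z₂ * expFun (0, c₁ + c₂) y).im - (z₁ * expFun (0, c₁) y).im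
        - (z₂ * expFun (0, c₂) y).im) ∂κ := by
    have i31 : Integrable (fun y => (z₁ * z₂ * expFun (0, c₁ + c₂) y).im
        - (z₁ * expFun (0, c₁) y).im) κ := i3.sub i1
    rw [integral_sub i31 i2, integral_sub i3 i1, h₁, h₂]; simp
  have e2 : (1 - ∫ y, (z₁ * expFun (0, c₁) y).re ∂κ) + (1 - ∫ y, (z₂ * expFun (0, c₂) y).re ∂κ)
      = ∫ y, ((1 - (z₁ * expFun (0, c₁) y).re) + (1 - (z₂ * expFun (0, c₂) y).re)) ∂κ := by
    have hc : Integrable (fun _ : OnePoint E => (1 : ℝ)) κ := integrable_const _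
    have hr1 : Integrable (fun y => 1 - (z₁ * expFun (0, c₁) y).re) κ := hc.sub r1
    have hr2 : Integrable (fun y => 1 - (z₂ * expFun (0, c₂) y).re) κ := hc.sub r2
    rw [integral_add hr1 hr2, integral_sub hc r1, integral_sub hc r2]
    simp
  rw [e1, e2]
  refine (abs_integral_le_integral_abs).trans (integral_mono_of_nonneg
    (ae_of_all _ fun _ => abs_nonneg _) ((((integrable_const _).sub r1).add
      ((integrable_const _).sub r2))) (ae_of_all _ fun y => ?_))
  have hn : ∀ (z : ℂ) (c : V), ‖z‖ ≤ 1 → ‖z * expFun (0, c) y‖ ≤ 1 := fun z c hz => by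
    rw [norm_mul]; exact mul_le_one₀ hz (norm_nonneg _) (norm_expFun_imag_le c y)
  have hfac : z₁ * z₂ * expFun (0, c₁ + c₂) y = (z₁ * expFun (0, c₁) y) * (z₂ * expFun (0, c₂) y) := by
    rw [expFun_imag_add]; ring
  simp only [hfac]
  have a1 := hn z₁ c₁ hz₁
  have a2 := hn z₂ c₂ hz₂
  generalize z₁ * expFun (0, c₁) y = a at *
  generalize z₂ * expFun (0, c₂) y = b at *
  have b1 := (Complex.abs_re_le_norm a).trans a1
  have b2 := (Complex.abs_im_le_norm a).trans a1
  have b3 := (Complex.abs_re_le_norm b).trans a2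
  have b4 := (Complex.abs_im_le_norm b).trans a2
  rw [abs_le] at b1 b2 b3 b4
  rw [Complex.mul_im, abs_le]
  constructor <;> nlinarith [mul_nonneg (sub_nonneg.2 b1.2) (sub_nonneg.2 b4.2),
    mul_nonneg (sub_nonneg.2 b1.2) (sub_nonneg.2 b4.1),
    mul_nonneg (sub_nonneg.2 b3.2) (sub_nonneg.2 b2.2),
    mul_nonneg (sub_nonneg.2 b3.2) (sub_nonneg.2 b2.1)]

/-- Logarithmic form of `abs_im_integral_expFun_add_le`. -/
lemma abs_im_log_defect_le (κ : Measure (OnePoint E)) [IsProbabilityMeasure κ]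
    {c₁ c₂ : V} {l₀ l₁ l₂ : ℂ} {a₁ a₂ : ℝ}
    (h₁ : ∫ y, expFun (0, c₁) y ∂κ = Complex.exp (l₁ + a₁ * Complex.I))
    (h₂ : ∫ y, expFun (0, c₂) y ∂κ = Complex.exp (l₂ + a₂ * Complex.I))
    (h₀ : ∫ y, expFun (0, c₁ + c₂) y ∂κ = Complex.exp (l₀ + (a₁ + a₂) * Complex.I))
    (hl₀ : ‖l₀‖ ≤ 1 / 2) (hl₁ : ‖l₁‖ ≤ 1 / 2) (hl₂ : ‖l₂‖ ≤ 1 / 2) :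
    |(l₀ - l₁ - l₂).im| ≤ Real.pi * (-l₁.re + -l₂.re) := by
  -- Multiplication by z turns exp(l + ia) into the positive number exp(Re l), so that 1 minus its
  -- value is at most -Re l.
  set z : ℂ → ℝ → ℂ := fun l a => Complex.exp (-(((l.im + a : ℝ) : ℂ) * Complex.I)) with hz
  have hz1 : ∀ l a, ‖z l a‖ ≤ 1 := fun l a => by
    simp [hz, Complex.norm_exp]
  have key : ∀ (l : ℂ) (a : ℝ), z l a * Complex.exp (l + a * Complex.I) = Real.exp l.re := by
    intro l a
    rw [hz, ← Complex.exp_add, Complex.ofReal_exp]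
    congr 1
    apply Complex.ext <;> simp
  have h := abs_im_integral_expFun_add_le κ (hz1 l₁ a₁) (hz1 l₂ a₂)
    (by rw [h₁, key]; exact Complex.ofReal_im _) (by rw [h₂, key]; exact Complex.ofReal_im _)
  rw [h₁, h₂, key, key, h₀, Complex.ofReal_re, Complex.ofReal_re] at h
  have e0 : z l₁ a₁ * z l₂ a₂ * Complex.exp (l₀ + (a₁ + a₂) * Complex.I)
      = Complex.exp ((l₀.re : ℂ) + ((l₀ - l₁ - l₂).im : ℝ) * Complex.I) := by
    rw [hz, ← Complex.exp_add, ← Complex.exp_add]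
    congr 1
    apply Complex.ext <;> simp
    ring
  have e0' : ∀ a θ : ℝ, (Complex.exp ((a : ℂ) + (θ : ℂ) * Complex.I)).im
      = Real.exp a * Real.sin θ := fun a θ => by rw [Complex.exp_im]; simp
  rw [e0, e0', abs_mul, abs_of_pos (Real.exp_pos _)] at h
  have r0 := abs_le.1 ((Complex.abs_re_le_norm l₀).trans hl₀)
  have i0 := abs_le.1 ((Complex.abs_im_le_norm l₀).trans hl₀)
  have i1 := abs_le.1 ((Complex.abs_im_le_norm l₁).trans hl₁)
  have i2 := abs_le.1 ((Complex.abs_im_le_norm l₂).trans hl₂)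
  have hd : |(l₀ - l₁ - l₂).im| ≤ Real.pi / 2 := by
    have := Real.pi_gt_three
    rw [abs_le]; simp only [Complex.sub_im]; constructor <;> linarith
  -- Jordan's inequality applies because the defect is at most 3/2 < π/2. Its factor 2/π and the
  -- bound exp(Re l₀) ≥ 1/2 give the constant π.
  have hs := Real.mul_abs_le_abs_sin hd
  have he : 1 / 2 ≤ Real.exp l₀.re := by linarith [Real.add_one_le_exp l₀.re]
  have e1 := Real.add_one_le_exp l₁.re
  have e2 := Real.add_one_le_exp l₂.re
  set D := |(l₀ - l₁ - l₂).im|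
  have hD : 0 ≤ 2 / Real.pi * D := by positivity
  have h3 : 1 / 2 * (2 / Real.pi * D) ≤ -l₁.re + -l₂.re := by
    calc 1 / 2 * (2 / Real.pi * D) ≤ Real.exp l₀.re * |Real.sin (l₀ - l₁ - l₂).im| := by
          gcongr
      _ ≤ _ := by linarith
  have h4 : D = Real.pi * (1 / 2 * (2 / Real.pi * D)) := by field_simp
  rw [h4]
  gcongr

end Phase

/-! ### Slopes of nonnegative affine functions. -/

section Compactness

variable {V : Type*} [NormedAddCommGroup V] [InnerProductSpace ℝ V] {E : Set V} {ι : Type*} [Fintype ι]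

lemma affine_eq_sum_coord (b : AffineBasis ι ℝ V) (α : ℝ) (β x : V) :
    α + inner ℝ β x = ∑ j, b.coord j x * (α + inner ℝ β (b j)) := by
  conv_lhs => rw [← b.linear_combination_coord_eq_self x]
  simp only [mul_add, Finset.sum_add_distrib, ← Finset.sum_mul, inner_sum, inner_smul_right,
    b.sum_coord_apply_eq_one, one_mul]

/-- An affine function that is nonnegative on a sufficiently large finite subset of `E` has a small
slope in the neutral directions. -/
lemma exists_finset_norm_slope_le [FiniteDimensional ℝ V] [Nonempty ι] (b : AffineBasis ι ℝ V) {η : ℝ}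
    (hη : 0 < η) :
    ∃ F : Finset E, ∀ (α : ℝ) (β : V), (∀ j, 0 ≤ α + inner ℝ β (b j)) →
      (∀ x ∈ F, 0 ≤ α + inner ℝ β (x : V)) →
      ‖(neutralSpace E).starProjection β‖ ≤ η * ∑ j, (α + inner ℝ β (b j)) := by
  let Λ : ℝ × V →ₗ[ℝ] (ι → ℝ) := LinearMap.pi fun j =>
    LinearMap.fst ℝ ℝ V + ((innerSL ℝ).flip (b j)).toLinearMap ∘ₗ LinearMap.snd ℝ ℝ V
  have hΛ : ∀ p j, Λ p j = p.1 + inner ℝ p.2 (b j) := fun p j => by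
    simp only [Λ, LinearMap.pi_apply, LinearMap.add_apply, LinearMap.fst_apply,
      LinearMap.comp_apply, LinearMap.snd_apply]
    rfl
  have hinj : LinearMap.ker Λ = ⊥ := by
    refine LinearMap.ker_eq_bot'.2 fun p hp => ?_
    have h0 : ∀ j, p.1 + inner ℝ p.2 (b j) = 0 := fun j => by rw [← hΛ, hp]; rfl
    have h2 : p.2 = 0 := eq_zero_of_inner_affineBasis_sub b fun i j => by
      rw [inner_sub_right]; linarith [h0 i, h0 j]
    have h1 := h0 (Classical.arbitrary ι)
    rw [h2, inner_zero_left, add_zero] at h1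
    exact Prod.ext h1 h2
  have hcomp : IsCompact (Λ ⁻¹' stdSimplex ℝ ι) :=
    (LinearMap.isClosedEmbedding_of_injective hinj).isCompact_preimage (isCompact_stdSimplex ℝ ι)
  have hcomp' : IsCompact (Λ ⁻¹' stdSimplex ℝ ι ∩
      {p : ℝ × V | η ≤ ‖(neutralSpace E).starProjection p.2‖}) :=
    hcomp.inter_right (isClosed_le continuous_const
      (((neutralSpace E).starProjection.continuous.comp continuous_snd).norm))
  -- An affine function that is nonnegative on all of E has a slope in the negative of the barrier
  -- cone, hence no neutral slope. So the conditions for all x in E are incompatible with a neutral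
  -- slope of size at least η, and compactness of the normalized functions selects finitely many x.
  obtain ⟨F, hF⟩ := hcomp'.elim_finite_subfamily_closed
    (fun x : E => {p : ℝ × V | 0 ≤ p.1 + inner ℝ p.2 (x : V)})
    (fun x => isClosed_le continuous_const (by fun_prop)) (by
      rw [eq_empty_iff_forall_notMem]
      rintro p ⟨⟨-, hp⟩, hp'⟩
      have hmem : -p.2 ∈ barrierCone E := by
        refine ⟨p.1, fun x hx => ?_⟩
        have : 0 ≤ p.1 + inner ℝ p.2 x := mem_iInter.1 hp' ⟨x, hx⟩
        rw [inner_neg_left]; linarith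
      have h0 : (neutralSpace E).starProjection p.2 = 0 := by
        rw [Submodule.starProjection_apply_eq_zero_iff]
        have h1 : p.2 ∈ Submodule.span ℝ (barrierCone E) := by
          have := Submodule.neg_mem _ (Submodule.subset_span (R := ℝ) hmem)
          rwa [neg_neg] at this
        exact Submodule.le_orthogonal_orthogonal _ h1
      have : η ≤ ‖(neutralSpace E).starProjection p.2‖ := hp
      rw [h0, norm_zero] at this
      linarith)
  refine ⟨F, fun α β hb hx => ?_⟩
  have hS0 : 0 ≤ ∑ j, (α + inner ℝ β (b j)) := Finset.sum_nonneg fun j _ => hb j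
  rcases hS0.eq_or_lt with hS | hS
  · have h0 : (α, β) = (0 : ℝ × V) := by
      have : (α, β) ∈ LinearMap.ker Λ := by
        rw [LinearMap.mem_ker]
        ext j
        rw [hΛ]
        exact (Finset.sum_eq_zero_iff_of_nonneg fun j _ => hb j).1 hS.symm j (Finset.mem_univ j)
      rw [hinj] at this
      exact this
    have hβ : β = 0 := congrArg Prod.snd h0
    rw [← hS, hβ, map_zero]
    simp
  · set S := ∑ j, (α + inner ℝ β (b j)) with hSdef
    by_contra hcon
    push Not at hcon
    have hmem : (S⁻¹ • α, S⁻¹ • β) ∈ (Λ ⁻¹' stdSimplex ℝ ι ∩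
        {p : ℝ × V | η ≤ ‖(neutralSpace E).starProjection p.2‖}) ∩
        ⋂ i ∈ F, {p : ℝ × V | 0 ≤ p.1 + inner ℝ p.2 (i : V)} := by
      have hval : ∀ x : V, S⁻¹ • α + inner ℝ (S⁻¹ • β) x = S⁻¹ * (α + inner ℝ β x) := fun x => by
        rw [real_inner_smul_left, smul_eq_mul]; ring
      refine ⟨⟨⟨fun j => ?_, ?_⟩, ?_⟩, ?_⟩
      · rw [hΛ, hval]; exact mul_nonneg (inv_nonneg.2 hS0) (hb j)
      · simp only [hΛ, hval, ← Finset.mul_sum, ← hSdef]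
        exact inv_mul_cancel₀ hS.ne'
      · change η ≤ ‖(neutralSpace E).starProjection (S⁻¹ • β)‖
        rw [map_smul, norm_smul, norm_inv, Real.norm_eq_abs, abs_of_pos hS, inv_mul_eq_div,
          le_div_iff₀ hS]
        exact hcon.le
      · refine mem_iInter₂.2 fun x hxF => ?_
        change 0 ≤ S⁻¹ • α + inner ℝ (S⁻¹ • β) (x : V)
        rw [hval]; exact mul_nonneg (inv_nonneg.2 hS0) (hx x hxF)
    rw [hF] at hmem
    exact hmem

end Compactness

end AffineProcess

namespace AffineProcess

/-! ### Averaging lemmas, the test measure and characters. -/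

section Averaging

/-- Integrate the hypothesis over τ in [0, 1/2]: both τ and σ + τ stay in [0, 1], so u(σ)/2 is at
most four times the integral. -/
lemma le_eight_mul_integral {u : ℝ → ℝ} (hu : Continuous u) (h0 : ∀ τ, 0 ≤ u τ)
    (hs : ∀ σ τ, u σ ≤ 2 * u (σ + τ) + 2 * u τ) {σ : ℝ} (hσ0 : 0 ≤ σ) (hσ1 : σ ≤ 1 / 2) :
    u σ ≤ 8 * ∫ τ in (0 : ℝ)..1, u τ := by
  have hi : ∀ a b : ℝ, IntervalIntegrable u volume a b := fun a b => hu.intervalIntegrable a b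
  have hi' : ∀ a b : ℝ, IntervalIntegrable (fun τ => u (σ + τ)) volume a b := fun a b =>
    (hu.comp (continuous_const.add continuous_id)).intervalIntegrable a b
  have h1 : ∫ _ in (0 : ℝ)..(1 / 2), u σ
      ≤ ∫ τ in (0 : ℝ)..(1 / 2), (2 * u (σ + τ) + 2 * u τ) :=
    intervalIntegral.integral_mono_on (by norm_num) intervalIntegrable_const
      (((hi' _ _).const_mul 2).add ((hi _ _).const_mul 2)) fun τ _ => hs σ τ
  rw [intervalIntegral.integral_add ((hi' _ _).const_mul 2) ((hi _ _).const_mul 2),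
    intervalIntegral.integral_const_mul, intervalIntegral.integral_const_mul,
    intervalIntegral.integral_comp_add_left, intervalIntegral.integral_const] at h1
  have h2 : ∫ τ in (σ + 0)..(σ + 1 / 2), u τ ≤ ∫ τ in (0 : ℝ)..1, u τ :=
    intervalIntegral.integral_mono_interval (by linarith) (by linarith) (by linarith)
      (ae_of_all _ h0) (hi _ _)
  have h3 : ∫ τ in (0 : ℝ)..(1 / 2), u τ ≤ ∫ τ in (0 : ℝ)..1, u τ :=
    intervalIntegral.integral_mono_interval le_rfl (by norm_num) (by norm_num)
      (ae_of_all _ h0) (hi _ _)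
  simp only [smul_eq_mul] at h1
  linarith

/-- If the phase moved by π or more, it would take the value of an end point plus π, where the
cosine has the opposite sign. -/
lemma abs_sub_lt_pi_of_cos_pos {h : ℝ → ℝ} {a b : ℝ} (hab : a ≤ b)
    (hc : ContinuousOn h (Icc a b)) (hpos : ∀ τ ∈ Icc a b, 0 < Real.cos (h τ)) :
    |h b - h a| < Real.pi := by
  have himg : (h '' Icc a b).OrdConnected :=
    (isPreconnected_Icc.image h hc).ordConnected
  have ha : h a ∈ h '' Icc a b := mem_image_of_mem h (left_mem_Icc.2 hab)
  have hb : h b ∈ h '' Icc a b := mem_image_of_mem h (right_mem_Icc.2 hab)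
  have hcos : ∀ z ∈ h '' Icc a b, 0 < Real.cos z := by
    rintro _ ⟨τ, hτ, rfl⟩; exact hpos τ hτ
  have hpi := Real.pi_pos
  rw [abs_lt]
  constructor <;> by_contra hcon <;> push Not at hcon
  · have h1 := hcos (h b + Real.pi) (himg.out hb ha ⟨by linarith, by linarith⟩)
    rw [Real.cos_add_pi] at h1
    linarith [hcos _ hb]
  · have h1 := hcos (h a + Real.pi) (himg.out ha hb ⟨by linarith, by linarith⟩)
    rw [Real.cos_add_pi] at h1
    linarith [hcos _ ha]

end Averaging

section TestMeasure

variable (V : Type*) [NormedAddCommGroup V] [InnerProductSpace ℝ V] [FiniteDimensional ℝ V]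
  [MeasurableSpace V]

/-- The sum of the Dirac measure at `0` and of the length measures on the segments from `0` to the
vectors of an orthonormal basis. -/
noncomputable def testMeasure : Measure V :=
  Measure.dirac 0 + ∑ j, (volume.restrict (Icc (0 : ℝ) 1)).map
    (fun τ : ℝ => τ • stdOrthonormalBasis ℝ V j)

instance isFiniteMeasure_testMeasure : IsFiniteMeasure (testMeasure V) := by
  unfold testMeasure
  infer_instance

variable {V} [BorelSpace V]

lemma ae_testMeasure_norm_le : ∀ᵐ θ ∂(testMeasure V), ‖θ‖ ≤ 1 := by
  have hm : MeasurableSet {θ : V | ‖θ‖ ≤ 1} :=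
    (isClosed_le continuous_norm continuous_const).measurableSet
  rw [testMeasure, ae_add_measure_iff]
  refine ⟨(ae_dirac_iff hm).2 (by simp), ?_⟩
  rw [← Measure.sum_fintype, Measure.ae_sum_iff' hm]
  intro j
  have hcont : Continuous fun τ : ℝ => τ • stdOrthonormalBasis ℝ V j :=
    continuous_id.smul continuous_const
  rw [ae_map_iff hcont.aemeasurable hm, ae_restrict_iff' measurableSet_Icc]
  refine ae_of_all _ fun τ hτ => ?_
  rw [norm_smul, (stdOrthonormalBasis ℝ V).orthonormal.1 j, mul_one, Real.norm_eq_abs,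
    abs_of_nonneg hτ.1]
  exact hτ.2

lemma integral_testMeasure {F : V → ℝ} (hF : Continuous F) {C : ℝ} (hC : ∀ θ, ‖F θ‖ ≤ C) :
    ∫ θ, F θ ∂(testMeasure V)
      = F 0 + ∑ j, ∫ τ in (0 : ℝ)..1, F (τ • stdOrthonormalBasis ℝ V j) := by
  have hint : ∀ (μ : Measure V) [IsFiniteMeasure μ], Integrable F μ := fun μ _ =>
    Integrable.of_bound hF.aestronglyMeasurable C (ae_of_all _ hC)
  rw [testMeasure, integral_add_measure (hint _) (hint _), integral_dirac,
    integral_finsetSum_measure fun j _ => hint _]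
  congr 1
  refine Finset.sum_congr rfl fun j _ => ?_
  have hcont : Continuous fun τ : ℝ => τ • stdOrthonormalBasis ℝ V j :=
    continuous_id.smul continuous_const
  rw [integral_map hcont.aemeasurable hF.aestronglyMeasurable,
    intervalIntegral.integral_of_le zero_le_one, integral_Icc_eq_integral_Ioc]

lemma integral_testMeasure_ge_zero {F : V → ℝ} (hF : Continuous F) {C : ℝ} (hC : ∀ θ, ‖F θ‖ ≤ C)
    (h0 : ∀ θ, 0 ≤ F θ) : F 0 ≤ ∫ θ, F θ ∂(testMeasure V) := by
  rw [integral_testMeasure hF hC]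
  exact le_add_of_nonneg_right (Finset.sum_nonneg fun j _ =>
    intervalIntegral.integral_nonneg zero_le_one fun τ _ => h0 _)

lemma integral_testMeasure_ge_segment {F : V → ℝ} (hF : Continuous F) {C : ℝ}
    (hC : ∀ θ, ‖F θ‖ ≤ C) (h0 : ∀ θ, 0 ≤ F θ) (j) :
    ∫ τ in (0 : ℝ)..1, F (τ • stdOrthonormalBasis ℝ V j) ≤ ∫ θ, F θ ∂(testMeasure V) := by
  rw [integral_testMeasure hF hC]
  refine le_add_of_nonneg_of_le (h0 0) ?_
  exact Finset.single_le_sum (f := fun j => ∫ τ in (0 : ℝ)..1, F (τ • stdOrthonormalBasis ℝ V j))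
    (fun j _ => intervalIntegral.integral_nonneg zero_le_one fun τ _ => h0 _) (Finset.mem_univ j)

end TestMeasure

section CharFun

variable {V : Type*} [NormedAddCommGroup V] [InnerProductSpace ℝ V] {E : Set V}

lemma re_expFun_imag_mul_star (c : V) (x y : E) :
    (expFun (0, c) (x : OnePoint E) * star (expFun (0, c) (y : OnePoint E))).re
      = Real.cos (inner ℝ c ((x : V) - y)) := by
  rw [expFun_coe, expFun_coe, Complex.star_def, ← Complex.exp_conj, ← Complex.exp_add,
    Complex.exp_re]
  simp [pairing_re, pairing_im, inner_sub_right, ← sub_eq_add_neg]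

/-- On E this is 1 - cos(p - q) ≤ 2(1 - cos p) + 2(1 - cos q). If one of the points is the cemetery,
all products vanish and it reads 1 ≤ 4. -/
lemma one_sub_re_expFun_le (e : V) (a b : OnePoint E) (σ τ : ℝ) :
    1 - (expFun (0, σ • e) a * star (expFun (0, σ • e) b)).re
      ≤ 2 * (1 - (expFun (0, (σ + τ) • e) a * star (expFun (0, (σ + τ) • e) b)).re)
        + 2 * (1 - (expFun (0, τ • e) a * star (expFun (0, τ • e) b)).re) := by
  induction a using OnePoint.rec with
  | infty => norm_num [expFun_infty]
  | coe a =>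
    induction b using OnePoint.rec with
    | infty => norm_num [expFun_infty]
    | coe b =>
      simp only [re_expFun_imag_mul_star, real_inner_smul_left]
      set d := inner ℝ e ((a : V) - b)
      have h1 : σ * d = (σ + τ) * d - τ * d := by ring
      rw [h1, Real.cos_sub]
      generalize (σ + τ) * d = p
      generalize τ * d = q
      nlinarith [Real.sin_sq_add_cos_sq p, Real.sin_sq_add_cos_sq q, sq_nonneg (Real.sin p + Real.sin q),
        sq_nonneg (Real.cos p + Real.cos q - 2), sq_nonneg (Real.cos p - 1), Real.cos_le_one p,
        Real.cos_le_one q, sq_nonneg (Real.cos q - 1)]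

variable [MeasurableSpace V]

lemma norm_integral_expFun_imag_le (κ : Measure (OnePoint E)) [IsProbabilityMeasure κ] (θ : V) :
    ‖∫ y, expFun (0, θ) y ∂κ‖ ≤ 1 :=
  (norm_integral_le_of_norm_le_const (ae_of_all _ fun y => norm_expFun_imag_le θ y)).trans
    (by simp)

variable [BorelSpace V]

lemma continuous_integral_expFun_imag (κ : Measure (OnePoint E)) [IsFiniteMeasure κ] :
    Continuous fun θ : V => ∫ y, expFun (0, θ) y ∂κ := by
  have h := continuousOn_integral_expFun (E := E) κ 1
  exact h.comp_continuous (f := fun θ : V => ((0, θ) : V × V)) (by fun_prop)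
    fun θ => imag_mem_expBoundedBy θ le_rfl

lemma integrable_expFun_imag (κ : Measure (OnePoint E)) [IsFiniteMeasure κ] (θ : V) :
    Integrable (fun y => expFun (0, θ) y) κ :=
  integrable_expFun (expBoundedBy_subset 1 (imag_mem_expBoundedBy θ le_rfl)) κ

/-- The pointwise inequality is integrated over independent points with laws κ₁ and κ₂; the
expectation of the product factors into the two transforms. -/
lemma one_sub_re_integral_expFun_le (κ₁ κ₂ : Measure (OnePoint E)) [IsProbabilityMeasure κ₁]
    [IsProbabilityMeasure κ₂] (e : V) (σ τ : ℝ) :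
    1 - ((∫ y, expFun (0, σ • e) y ∂κ₁) * star (∫ y, expFun (0, σ • e) y ∂κ₂)).re
      ≤ 2 * (1 - ((∫ y, expFun (0, (σ + τ) • e) y ∂κ₁)
          * star (∫ y, expFun (0, (σ + τ) • e) y ∂κ₂)).re)
        + 2 * (1 - ((∫ y, expFun (0, τ • e) y ∂κ₁) * star (∫ y, expFun (0, τ • e) y ∂κ₂)).re) := by
  have hint : ∀ θ : V, Integrable (fun p : OnePoint E × OnePoint E =>
      expFun (0, θ) p.1 * star (expFun (0, θ) p.2)) (κ₁.prod κ₂) := fun θ =>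
    (integrable_expFun_imag κ₁ θ).mul_prod (Complex.conjCLE.toContinuousLinearMap.integrable_comp (integrable_expFun_imag κ₂ θ))
  have hprod : ∀ θ : V, 1 - ((∫ y, expFun (0, θ) y ∂κ₁) * star (∫ y, expFun (0, θ) y ∂κ₂)).re
      = ∫ p : OnePoint E × OnePoint E,
        (1 - (expFun (0, θ) p.1 * star (expFun (0, θ) p.2)).re) ∂(κ₁.prod κ₂) := by
    intro θ
    have h1 : star (∫ y, expFun (0, θ) y ∂κ₂) = ∫ y, star (expFun (0, θ) y) ∂κ₂ :=
      integral_conj.symm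
    have h2 := integral_re (hint θ)
    simp only [RCLike.re_to_complex] at h2
    have h3 : Integrable (fun p : OnePoint E × OnePoint E =>
        (expFun (0, θ) p.1 * star (expFun (0, θ) p.2)).re) (κ₁.prod κ₂) := (hint θ).re
    rw [integral_sub (integrable_const _) h3, h2, h1, integral_prod_mul (fun y => expFun (0, θ) y) (fun y => star (expFun (0, θ) y))]
    simp
  have hi : ∀ θ : V, Integrable (fun p : OnePoint E × OnePoint E =>
      1 - (expFun (0, θ) p.1 * star (expFun (0, θ) p.2)).re) (κ₁.prod κ₂) := fun θ =>
    (integrable_const _).sub (hint θ).re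
  rw [hprod, hprod, hprod, ← integral_const_mul, ← integral_const_mul,
    ← integral_add ((hi _).const_mul 2) ((hi _).const_mul 2)]
  exact integral_mono (hi _) (((hi _).const_mul 2).add ((hi _).const_mul 2))
    fun p => one_sub_re_expFun_le e p.1 p.2 σ τ

end CharFun

end AffineProcess

namespace AffineProcess

/-! ### Distinguishing starting points by short-time characteristic functions. -/

section Energy

variable {V : Type*} [NormedAddCommGroup V] [InnerProductSpace ℝ V] [FiniteDimensional ℝ V]
  [MeasurableSpace V] {E : Set V}

/-- The squared distance of the characteristic functions of `P_{w,s}(x, ·)` and `P_{w,s}(y, ·)`,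
integrated with respect to the test measure. -/
noncomputable def TransitionFunction.energyDist (P : TransitionFunction E) (w s : ℝ≥0)
    (x y : OnePoint E) : ℝ :=
  ∫ θ, ‖P.expTransform w s (0, θ) x - P.expTransform w s (0, θ) y‖ ^ 2 ∂(testMeasure V)

variable [BorelSpace V] {P : TransitionFunction E}
  {Φ : ℝ≥0 → ℝ≥0 → V × V → ℂ} {ψ : ℝ≥0 → ℝ≥0 → V × V → V × V}

lemma TransitionFunction.continuous_expTransform_imag (P : TransitionFunction E) {w s : ℝ≥0}
    (hws : w ≤ s) (x : OnePoint E) : Continuous fun θ : V => P.expTransform w s (0, θ) x := by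
  have := P.isMarkovKernel w s hws
  exact continuous_integral_expFun_imag _

lemma TransitionFunction.norm_expTransform_imag_le (P : TransitionFunction E) {w s : ℝ≥0}
    (hws : w ≤ s) (θ : V) (x : OnePoint E) : ‖P.expTransform w s (0, θ) x‖ ≤ 1 := by
  have := P.isMarkovKernel w s hws
  exact norm_integral_expFun_imag_le _ _

lemma TransitionFunction.norm_energy_integrand_le (P : TransitionFunction E) {w s : ℝ≥0}
    (hws : w ≤ s) (x y : OnePoint E) (θ : V) :
    ‖‖P.expTransform w s (0, θ) x - P.expTransform w s (0, θ) y‖ ^ 2‖ ≤ 4 := by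
  have h1 := (norm_sub_le _ _).trans (add_le_add (P.norm_expTransform_imag_le hws θ x)
    (P.norm_expTransform_imag_le hws θ y))
  rw [Real.norm_eq_abs, abs_of_nonneg (by positivity)]
  nlinarith [norm_nonneg (P.expTransform w s (0, θ) x - P.expTransform w s (0, θ) y)]

lemma TransitionFunction.continuous_energy_integrand (P : TransitionFunction E) {w s : ℝ≥0}
    (hws : w ≤ s) (x y : OnePoint E) :
    Continuous fun θ : V => ‖P.expTransform w s (0, θ) x - P.expTransform w s (0, θ) y‖ ^ 2 :=
  ((P.continuous_expTransform_imag hws x).sub (P.continuous_expTransform_imag hws y)).norm.pow 2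

lemma TransitionFunction.energyDist_nonneg (P : TransitionFunction E) (w s : ℝ≥0)
    (x y : OnePoint E) : 0 ≤ P.energyDist w s x y :=
  integral_nonneg fun _ => by positivity

lemma IsAffineData.le_norm_expTransform (h : IsAffineData P Φ ψ) {w s : ℝ≥0} (hws : w ≤ s)
    {η K : ℝ} {θ : V} (hΦ : ‖Φ w s (0, θ) - 1‖ ≤ η) (hψ : ‖ψ w s (0, θ) - (0, θ)‖ ≤ η)
    (hη : η * (1 + K) ≤ 1 / 100) {y : E} (hy : ‖(y : V)‖ ≤ K) :
    99 / 100 ≤ ‖P.expTransform w s (0, θ) (y : OnePoint E)‖ := by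
  have hη0 : 0 ≤ η := (norm_nonneg _).trans hΦ
  have hK : 0 ≤ K := (norm_nonneg _).trans hy
  rw [h.affine w s hws _ (expBoundedBy_subset 1 (imag_mem_expBoundedBy θ le_rfl)) y, norm_mul,
    norm_exp_pairing]
  have h1 : 1 - η ≤ ‖Φ w s (0, θ)‖ := by
    have := norm_sub_norm_le (1 : ℂ) (1 - Φ w s (0, θ))
    rw [sub_sub_cancel, norm_one, norm_sub_rev] at this
    linarith
  have h2 : ‖(ψ w s (0, θ)).1‖ ≤ η := by
    have := (norm_fst_le (ψ w s (0, θ) - (0, θ))).trans hψ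
    simpa using this
  have h3 : -(η * K) ≤ inner ℝ (ψ w s (0, θ)).1 (y : V) := by
    have := (abs_real_inner_le_norm (ψ w s (0, θ)).1 (y : V)).trans
      (mul_le_mul h2 hy (norm_nonneg _) hη0)
    exact (abs_le.1 this).1
  have h4 : 1 - η * K ≤ Real.exp (inner ℝ (ψ w s (0, θ)).1 (y : V)) := by
    linarith [Real.add_one_le_exp (inner ℝ (ψ w s (0, θ)).1 (y : V))]
  have h5 : 0 ≤ 1 - η := by nlinarith
  calc (99 : ℝ) / 100 ≤ (1 - η) * (1 - η * K) := by nlinarith [mul_nonneg hη0 hK]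
    _ ≤ _ := mul_le_mul h1 h4 (by nlinarith) (norm_nonneg _)

section Fixed

variable {w s : ℝ≥0} {η K : ℝ}

/-- The atom of the test measure at θ = 0 detects killing: the transform there is the survival
probability, which is 0 at the cemetery and at least 99/100 at y. -/
lemma IsAffineData.energyDist_infty_ge (h : IsAffineData P Φ ψ) (hws : w ≤ s)
    (hΦ : ∀ θ : V, ‖θ‖ ≤ 1 → ‖Φ w s (0, θ) - 1‖ ≤ η)
    (hψ : ∀ θ : V, ‖θ‖ ≤ 1 → ‖ψ w s (0, θ) - (0, θ)‖ ≤ η)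
    (hη : η * (1 + K) ≤ 1 / 100) {y : E} (hy : ‖(y : V)‖ ≤ K) :
    1 / 4 ≤ P.energyDist w s ∞ y := by
  refine le_trans ?_ (integral_testMeasure_ge_zero (P.continuous_energy_integrand hws ∞ y)
    (P.norm_energy_integrand_le hws ∞ y) fun θ => by positivity)
  have h1 := h.le_norm_expTransform hws (hΦ 0 (by simp)) (hψ 0 (by simp)) hη hy
  rw [P.expTransform_infty hws, zero_sub, norm_neg]
  nlinarith

/-- The sign is that of the cosine, so information about the phase is available even at a point x of
unknown size. -/
lemma IsAffineData.re_expTransform_mul_star (h : IsAffineData P Φ ψ) (hws : w ≤ s) (θ : V)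
    (x y : E) : (P.expTransform w s (0, θ) (x : OnePoint E)
        * star (P.expTransform w s (0, θ) (y : OnePoint E))).re
      = ‖Φ w s (0, θ)‖ ^ 2 * Real.exp (inner ℝ (ψ w s (0, θ)).1 (x : V)
          + inner ℝ (ψ w s (0, θ)).1 (y : V))
        * Real.cos (inner ℝ (ψ w s (0, θ)).2 ((x : V) - y)) := by
  have hu := expBoundedBy_subset 1 (imag_mem_expBoundedBy (E := E) θ le_rfl)
  rw [h.affine w s hws _ hu x, h.affine w s hws _ hu y]
  have h1 : Φ w s (0, θ) * Complex.exp (pairing (ψ w s (0, θ)) (x : V))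
      * star (Φ w s (0, θ) * Complex.exp (pairing (ψ w s (0, θ)) (y : V)))
      = ((‖Φ w s (0, θ)‖ ^ 2 : ℝ) : ℂ) * Complex.exp (pairing (ψ w s (0, θ)) (x : V)
        + star (pairing (ψ w s (0, θ)) (y : V))) := by
    rw [star_mul', Complex.star_def, ← Complex.exp_conj, Complex.exp_add,
      Complex.ofReal_pow, ← Complex.mul_conj']
    ring
  rw [h1, Complex.re_ofReal_mul, Complex.exp_re, mul_assoc]
  simp [pairing_re, pairing_im, inner_sub_right, ← sub_eq_add_neg]

/-- Only y is bounded, so the modulus at x is out of control and the phase is used instead. If the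
energy distance were small, the two transforms would correlate positively for all τ in [0, 1/2], and
the phase ⟨Im ψ, x - y⟩ would vary by less than π. But Im ψ is close to τe, so the phase varies by
nearly |⟨e, x - y⟩|/2, which is too much for far points. -/
lemma IsAffineData.energyDist_ge_of_far (h : IsAffineData P Φ ψ) (hws : w ≤ s)
    (hΦ : ∀ θ : V, ‖θ‖ ≤ 1 → ‖Φ w s (0, θ) - 1‖ ≤ η)
    (hψ : ∀ θ : V, ‖θ‖ ≤ 1 → ‖ψ w s (0, θ) - (0, θ)‖ ≤ η)
    (hψc : ContinuousOn (fun θ : V => ψ w s (0, θ)) (Metric.closedBall 0 1))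
    (hη : η * (1 + K) ≤ 1 / 100) {n : ℝ} (hn : 1 ≤ n) (hηn : η * (8 * n) ≤ 1)
    {x y : E} (hy : ‖(y : V)‖ ≤ K) {j}
    (hj : ‖(x : V) - y‖ ≤ n * |inner ℝ (stdOrthonormalBasis ℝ V j) ((x : V) - y)|)
    (hfar : 4 * Real.pi * n ≤ ‖(x : V) - y‖) :
    1 / 400 ≤ P.energyDist w s x y := by
  have := P.isMarkovKernel w s hws
  set e := stdOrthonormalBasis ℝ V j with he
  have hen : ‖e‖ = 1 := (stdOrthonormalBasis ℝ V).orthonormal.1 j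
  have hτn : ∀ τ : ℝ, 0 ≤ τ → τ ≤ 1 → ‖τ • e‖ ≤ 1 := fun τ h0 h1 => by
    rw [norm_smul, hen, mul_one, Real.norm_eq_abs, abs_of_nonneg h0]; exact h1
  by_contra hcon
  push Not at hcon
  have hJ := (integral_testMeasure_ge_segment (P.continuous_energy_integrand hws x y)
    (P.norm_energy_integrand_le hws x y) (fun θ => by positivity) j).trans_lt hcon
  set a : ℝ → ℝ := fun τ => ‖P.expTransform w s (0, τ • e) (x : OnePoint E)
    - P.expTransform w s (0, τ • e) (y : OnePoint E)‖ with ha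
  have hac : Continuous a :=
    (((P.continuous_expTransform_imag hws _).sub (P.continuous_expTransform_imag hws _)).norm).comp
      (continuous_id.smul continuous_const)
  set u : ℝ → ℝ := fun τ => 1 - (P.expTransform w s (0, τ • e) (x : OnePoint E)
    * star (P.expTransform w s (0, τ • e) (y : OnePoint E))).re with hu
  have huc : Continuous u := by
    have h1 : Continuous fun θ : V => (P.expTransform w s (0, θ) (x : OnePoint E)
        * star (P.expTransform w s (0, θ) (y : OnePoint E))).re :=
      Complex.continuous_re.comp ((P.continuous_expTransform_imag hws _).mul
        (P.continuous_expTransform_imag hws _).star)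
    exact continuous_const.sub (h1.comp (continuous_id.smul continuous_const))
  have hu0 : ∀ τ, 0 ≤ u τ := fun τ => by
    have : (P.expTransform w s (0, τ • e) (x : OnePoint E)
        * star (P.expTransform w s (0, τ • e) (y : OnePoint E))).re ≤ 1 :=
      (Complex.re_le_norm _).trans (by
        rw [norm_mul, norm_star]
        exact mul_le_one₀ (P.norm_expTransform_imag_le hws _ _) (norm_nonneg _)
          (P.norm_expTransform_imag_le hws _ _))
    exact sub_nonneg.2 this
  have hus : ∀ σ τ, u σ ≤ 2 * u (σ + τ) + 2 * u τ := fun σ τ =>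
    one_sub_re_integral_expFun_le _ _ e σ τ
  -- At y the modulus is at least 99/100; the linear term in a is absorbed by a ≤ 16a² + 1/64.
  have hua : ∀ τ ∈ Icc (0 : ℝ) 1, u τ ≤ 17 * a τ ^ 2 + (1 / 64 + 2 / 100) := by
    intro τ hτ
    have hy1 := h.le_norm_expTransform hws (hΦ _ (hτn τ hτ.1 hτ.2)) (hψ _ (hτn τ hτ.1 hτ.2)) hη hy
    have hx1 := P.norm_expTransform_imag_le hws (τ • e) (x : OnePoint E)
    have hy2 := P.norm_expTransform_imag_le hws (τ • e) (y : OnePoint E)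
    simp only [hu, ha]
    generalize P.expTransform w s (0, τ • e) (x : OnePoint E) = p at *
    generalize P.expTransform w s (0, τ • e) (y : OnePoint E) = q at *
    have h1 : ‖p - q‖ ^ 2 = ‖p‖ ^ 2 + ‖q‖ ^ 2 - 2 * (p * star q).re := by
      rw [← Complex.normSq_eq_norm_sq, ← Complex.normSq_eq_norm_sq, ← Complex.normSq_eq_norm_sq,
        Complex.normSq_sub]
      rfl
    have h2 : ‖q‖ ≤ ‖p‖ + ‖p - q‖ := by
      have := norm_sub_norm_le q p
      rw [norm_sub_rev] at this; linarith
    nlinarith [norm_nonneg p, norm_nonneg q, norm_nonneg (p - q), sq_nonneg (‖p - q‖ - 1 / 32),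
      sq_nonneg (1 - ‖p‖), sq_nonneg (1 - ‖q‖)]
  have hmean : ∫ τ in (0 : ℝ)..1, u τ ≤ 17 * (1 / 400) + (1 / 64 + 2 / 100) := by
    have hi1 : IntervalIntegrable (fun τ => 17 * a τ ^ 2) volume 0 1 :=
      (continuous_const.mul (hac.pow 2)).intervalIntegrable 0 1
    have h1 := intervalIntegral.integral_mono_on zero_le_one (huc.intervalIntegrable 0 1)
      (hi1.add (intervalIntegrable_const (c := (1 / 64 + 2 / 100 : ℝ)))) hua
    rw [intervalIntegral.integral_add hi1 intervalIntegrable_const,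
      intervalIntegral.integral_const_mul, intervalIntegral.integral_const] at h1
    simp only [sub_zero, one_smul] at h1
    linarith
  -- Numerically 8(17/400 + 1/64 + 2/100) = 5/8 < 1, so the averaged smallness of u becomes the
  -- pointwise bound u < 1.
  have hcos : ∀ τ ∈ Icc (0 : ℝ) (1 / 2),
      0 < Real.cos (inner ℝ (ψ w s (0, τ • e)).2 ((x : V) - y)) := by
    intro τ hτ
    have h1 := le_eight_mul_integral huc hu0 hus hτ.1 hτ.2
    have h2 : 0 < (P.expTransform w s (0, τ • e) (x : OnePoint E)
        * star (P.expTransform w s (0, τ • e) (y : OnePoint E))).re := by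
      have : u τ < 1 := by linarith
      simp only [hu] at this
      linarith
    rw [h.re_expTransform_mul_star hws] at h2
    exact pos_of_mul_pos_right h2 (by positivity)
  have hmaps : ∀ τ ∈ Icc (0 : ℝ) (1 / 2), τ • e ∈ Metric.closedBall (0 : V) 1 := fun τ hτ =>
    mem_closedBall_zero_iff.2 (hτn τ hτ.1 (by linarith [hτ.2]))
  have hc : ContinuousOn (fun τ : ℝ => inner ℝ (ψ w s (0, τ • e)).2 ((x : V) - y))
      (Icc 0 (1 / 2)) := by
    have h1 : ContinuousOn (fun τ : ℝ => ψ w s (0, τ • e)) (Icc 0 (1 / 2)) :=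
      hψc.comp (f := fun τ : ℝ => τ • e) (by fun_prop) hmaps
    exact (continuous_snd.comp_continuousOn h1).inner continuousOn_const
  have hvar := abs_sub_lt_pi_of_cos_pos (by norm_num) hc hcos
  have hclose : ∀ τ ∈ Icc (0 : ℝ) (1 / 2),
      |inner ℝ (ψ w s (0, τ • e)).2 ((x : V) - y) - τ * inner ℝ e ((x : V) - y)|
        ≤ η * ‖(x : V) - y‖ := by
    intro τ hτ
    have h1 : ‖(ψ w s (0, τ • e)).2 - τ • e‖ ≤ η :=
      (norm_snd_le (ψ w s (0, τ • e) - (0, τ • e))).trans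
        (hψ _ (hτn τ hτ.1 (by linarith [hτ.2])))
    rw [← real_inner_smul_left, ← inner_sub_left]
    exact (abs_real_inner_le_norm _ _).trans (mul_le_mul_of_nonneg_right h1 (norm_nonneg _))
  have c0 := hclose 0 ⟨le_rfl, by norm_num⟩
  have c1 := hclose (1 / 2) ⟨by norm_num, le_rfl⟩
  set D := ‖(x : V) - y‖
  have hη0 : 0 ≤ η := (norm_nonneg _).trans (hΦ 0 (by simp))
  have hD : 0 ≤ D := norm_nonneg _
  have hpi := Real.pi_pos
  rw [abs_le] at c0 c1
  rw [abs_lt] at hvar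
  have hin : |inner ℝ e ((x : V) - y)| < 2 * Real.pi + 4 * η * D := by
    rw [abs_lt]; constructor <;> linarith [hvar.1, hvar.2, c0.1, c0.2, c1.1, c1.2]
  have h8 : η * (8 * n) * D ≤ 1 * D := mul_le_mul_of_nonneg_right hηn hD
  have h9 : n * |inner ℝ e ((x : V) - y)| < n * (2 * Real.pi + 4 * η * D) :=
    mul_lt_mul_of_pos_left hin (by linarith)
  nlinarith

/-- The difference of the transforms is the transform at y times exp(G) - 1 with G = ⟨ψ, x - y⟩. For
τ in [τ₀/2, τ₀] the number G is at most 1/2 in modulus and at least proportional to |x - y|, so no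
wrap-around occurs and a quadratic lower bound follows. -/
lemma IsAffineData.energyDist_ge_of_near (h : IsAffineData P Φ ψ) (hws : w ≤ s)
    (hΦ : ∀ θ : V, ‖θ‖ ≤ 1 → ‖Φ w s (0, θ) - 1‖ ≤ η)
    (hψ : ∀ θ : V, ‖θ‖ ≤ 1 → ‖ψ w s (0, θ) - (0, θ)‖ ≤ η)
    (hη : η * (1 + K) ≤ 1 / 100) {n τ₀ : ℝ} (hn : 1 ≤ n) (hτ₀ : 0 < τ₀) (hτ₁ : τ₀ ≤ 1)
    (hητ : η * (8 * n) ≤ τ₀) {x y : E} (hy : ‖(y : V)‖ ≤ K) {j}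
    (hj : ‖(x : V) - y‖ ≤ n * |inner ℝ (stdOrthonormalBasis ℝ V j) ((x : V) - y)|)
    (hnear : τ₀ * ‖(x : V) - y‖ ≤ 1 / 4) :
    τ₀ / 2 * (τ₀ * ‖(x : V) - y‖ / (16 * n)) ^ 2 ≤ P.energyDist w s x y := by
  set e := stdOrthonormalBasis ℝ V j with he
  have hen : ‖e‖ = 1 := (stdOrthonormalBasis ℝ V).orthonormal.1 j
  have hτn : ∀ τ : ℝ, 0 ≤ τ → τ ≤ 1 → ‖τ • e‖ ≤ 1 := fun τ h0 h1 => by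
    rw [norm_smul, hen, mul_one, Real.norm_eq_abs, abs_of_nonneg h0]; exact h1
  refine le_trans ?_ (integral_testMeasure_ge_segment (P.continuous_energy_integrand hws x y)
    (P.norm_energy_integrand_le hws x y) (fun θ => by positivity) j)
  have hη0 : 0 ≤ η := (norm_nonneg _).trans (hΦ 0 (by simp))
  set D := ‖(x : V) - y‖ with hDdef
  have hD : 0 ≤ D := norm_nonneg _
  have hcont : Continuous fun τ : ℝ => ‖P.expTransform w s (0, τ • e) (x : OnePoint E)
      - P.expTransform w s (0, τ • e) (y : OnePoint E)‖ ^ 2 :=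
    (P.continuous_energy_integrand hws x y).comp (continuous_id.smul continuous_const)
  have hpt : ∀ τ ∈ Icc (τ₀ / 2) τ₀, (τ₀ * D / (16 * n)) ^ 2
      ≤ ‖P.expTransform w s (0, τ • e) (x : OnePoint E)
        - P.expTransform w s (0, τ • e) (y : OnePoint E)‖ ^ 2 := by
    intro τ hτ
    have hτ0 : 0 ≤ τ := by linarith [hτ.1]
    have hθ := hτn τ hτ0 (hτ.2.trans hτ₁)
    have hy1 := h.le_norm_expTransform hws (hΦ _ hθ) (hψ _ hθ) hη hy
    have hu := expBoundedBy_subset 1 (imag_mem_expBoundedBy (E := E) (τ • e) le_rfl)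
    set G := pairing (ψ w s (0, τ • e)) ((x : V) - y) with hG
    have h1 : P.expTransform w s (0, τ • e) (x : OnePoint E)
        - P.expTransform w s (0, τ • e) (y : OnePoint E)
        = P.expTransform w s (0, τ • e) (y : OnePoint E) * (Complex.exp G - 1) := by
      rw [h.affine w s hws _ hu x, h.affine w s hws _ hu y, hG, pairing_sub_right, mul_sub, mul_one,
        mul_assoc, ← Complex.exp_add]
      simp
    have h2 : ‖G - pairing (0, τ • e) ((x : V) - y)‖ ≤ 2 * η * D := by
      rw [hG, ← pairing_sub]
      exact (norm_pairing_le _ _).trans (by gcongr; exact hψ _ hθ)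
    have h3 : ‖pairing (0, τ • e) ((x : V) - y)‖ = τ * |inner ℝ e ((x : V) - y)| := by
      simp [pairing, real_inner_smul_left, abs_of_nonneg hτ0]
    have h4 : |inner ℝ e ((x : V) - y)| ≤ D := by
      have := abs_real_inner_le_norm e ((x : V) - y)
      rwa [hen, one_mul] at this
    have h8 : η * (8 * n) * D ≤ τ₀ * D := mul_le_mul_of_nonneg_right hητ hD
    have h8' : η * 8 * D ≤ τ₀ * D := by
      refine le_trans ?_ h8
      have : η * 8 ≤ η * (8 * n) := by nlinarith
      exact mul_le_mul_of_nonneg_right this hD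
    have h5 : ‖G‖ ≤ 1 / 2 := by
      have := norm_le_insert' G (pairing (0, τ • e) ((x : V) - y))
      have : τ * |inner ℝ e ((x : V) - y)| ≤ τ₀ * D := mul_le_mul hτ.2 h4 (abs_nonneg _) hτ₀.le
      linarith
    have h6 : τ₀ * D / (4 * n) ≤ ‖G‖ := by
      have e1 := norm_sub_norm_le (pairing (0, τ • e) ((x : V) - y))
        (pairing (0, τ • e) ((x : V) - y) - G)
      rw [sub_sub_cancel, norm_sub_rev, h3] at e1
      have e2 : τ₀ / 2 * |inner ℝ e ((x : V) - y)| ≤ τ * |inner ℝ e ((x : V) - y)| :=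
        mul_le_mul_of_nonneg_right hτ.1 (abs_nonneg _)
      rw [div_le_iff₀ (by linarith)]
      have e3 : τ₀ / 2 * |inner ℝ e ((x : V) - y)| - 2 * η * D ≤ ‖G‖ := by linarith
      have e4 := mul_le_mul_of_nonneg_right e3 (by linarith : 0 ≤ 4 * n)
      have e5 : τ₀ * D ≤ τ₀ * (n * |inner ℝ e ((x : V) - y)|) := mul_le_mul_of_nonneg_left hj hτ₀.le
      nlinarith
    have h7 : ‖G‖ / 2 ≤ ‖Complex.exp G - 1‖ := by
      have e1 := Complex.norm_exp_sub_one_sub_id_le (x := G) (by linarith)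
      have e2 := norm_sub_norm_le G (G - (Complex.exp G - 1))
      rw [sub_sub_cancel, norm_sub_rev] at e2
      nlinarith [norm_nonneg G]
    rw [h1, norm_mul]
    refine pow_le_pow_left₀ (by positivity) ?_ 2
    have h10 : τ₀ * D / (16 * n) = 1 / 2 * ((τ₀ * D / (4 * n)) / 2) := by field_simp; ring
    rw [h10]
    refine mul_le_mul (by linarith) (le_trans ?_ h7) (by positivity) (norm_nonneg _)
    linarith
  have h1 : ∫ _ in (τ₀ / 2)..τ₀, (τ₀ * D / (16 * n)) ^ 2
      ≤ ∫ τ in (τ₀ / 2)..τ₀, ‖P.expTransform w s (0, τ • e) (x : OnePoint E)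
        - P.expTransform w s (0, τ • e) (y : OnePoint E)‖ ^ 2 :=
    intervalIntegral.integral_mono_on (by linarith) intervalIntegrable_const
      (hcont.intervalIntegrable _ _) hpt
  rw [intervalIntegral.integral_const, smul_eq_mul] at h1
  have h2 : ∫ τ in (τ₀ / 2)..τ₀, ‖P.expTransform w s (0, τ • e) (x : OnePoint E)
        - P.expTransform w s (0, τ • e) (y : OnePoint E)‖ ^ 2
      ≤ ∫ τ in (0 : ℝ)..1, ‖P.expTransform w s (0, τ • e) (x : OnePoint E)
        - P.expTransform w s (0, τ • e) (y : OnePoint E)‖ ^ 2 :=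
    intervalIntegral.integral_mono_interval (by linarith) (by linarith) hτ₁
      (ae_of_all _ fun τ => by positivity) (hcont.intervalIntegrable _ _)
  have h3 : τ₀ / 2 = τ₀ - τ₀ / 2 := by ring
  rw [h3]
  linarith

end Fixed

/-- In short time, `energyDist` controls the variation of the characters. -/
lemma IsAffineData.exists_le_energyDist (h : IsAffineData P Φ ψ) (hE : E.Nonempty) {R K : ℝ}
    (hK : 0 ≤ K) (T : ℝ≥0) :
    ∃ C : ℝ, 0 < C ∧ ∃ δ : ℝ≥0, 0 < δ ∧ ∀ w s, w ≤ s → s ≤ T → s ≤ w + δ →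
      ∀ (y : E), ‖(y : V)‖ ≤ K → ∀ (x : OnePoint E) (c : V), ‖c‖ ≤ R →
        1 - (expFun (0, c) x * star (expFun (0, c) (y : OnePoint E))).re
          ≤ C * P.energyDist w s x y := by
  set n : ℝ := Module.finrank ℝ V + 1 with hn
  have hn1 : 1 ≤ n := by simp [hn]
  have hpi := Real.pi_gt_three
  -- With this choice τ₀ · 4πn = 1/4, so every point that fails the far condition satisfies the near
  -- one.
  set τ₀ : ℝ := 1 / (16 * Real.pi * n) with hτ₀
  have hτ0 : 0 < τ₀ := by positivity
  have hτ1 : τ₀ ≤ 1 := by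
    rw [hτ₀, div_le_one (by positivity)]; nlinarith
  set η : ℝ := min (τ₀ / (8 * n)) (1 / (100 * (1 + K))) with hη
  have hη0 : 0 < η := by positivity
  have hη1 : η * (8 * n) ≤ τ₀ := by
    rw [← le_div_iff₀ (by positivity)]; exact min_le_left _ _
  have hη2 : η * (1 + K) ≤ 1 / 100 := by
    have : η ≤ 1 / (100 * (1 + K)) := min_le_right _ _
    rw [le_div_iff₀ (by positivity)] at this
    linarith
  obtain ⟨δ, hδ, hsmall⟩ := h.exists_small_time hE 1 1 T hη0
  have hnear0 : 0 < τ₀ / 2 * (τ₀ / (16 * n)) ^ 2 := by positivity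
  -- One summand for each case: 4 for the cemetery, 800 for far points, where 1 - cos ≤ 2 meets
  -- 1/400, and the last for near points, where 1 - cos is at most quadratic.
  refine ⟨4 + 800 + R ^ 2 / (τ₀ / 2 * (τ₀ / (16 * n)) ^ 2), by positivity, δ, hδ,
    fun w s hws hsT hsw y hy x c hc => ?_⟩
  have hmem : ∀ θ : V, ((0, θ) : V × V) ∈ expBoundedBy E 1 := fun θ => imag_mem_expBoundedBy θ le_rfl
  have hnθ : ∀ θ : V, ‖θ‖ ≤ 1 → ‖((0, θ) : V × V)‖ ≤ 1 := fun θ hθ => by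
    rw [Prod.norm_mk, norm_zero]; exact max_le zero_le_one hθ
  have hΦ : ∀ θ : V, ‖θ‖ ≤ 1 → ‖Φ w s (0, θ) - 1‖ ≤ η := fun θ hθ =>
    (hsmall w s _ hws hsT hsw (hmem θ) (hnθ θ hθ)).1
  have hψ : ∀ θ : V, ‖θ‖ ≤ 1 → ‖ψ w s (0, θ) - (0, θ)‖ ≤ η := fun θ hθ =>
    (hsmall w s _ hws hsT hsw (hmem θ) (hnθ θ hθ)).2
  have hψc : ContinuousOn (fun θ : V => ψ w s (0, θ)) (Metric.closedBall 0 1) := by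
    refine (h.continuousOn_psi 1).comp (f := fun θ : V => (w, s, ((0, θ) : V × V))) (by fun_prop)
      fun θ hθ => ⟨⟨hws, hmem θ⟩, fun v hwv hvs h0 => ?_⟩
    have h1 := (hsmall v s _ hvs hsT (hsw.trans (by gcongr)) (hmem θ)
      (hnθ θ (mem_closedBall_zero_iff.1 hθ))).1
    simp only at h0
    rw [h0, zero_sub, norm_neg, norm_one] at h1
    nlinarith
  have hJ0 := P.energyDist_nonneg w s x y
  have hC1 : 0 ≤ R ^ 2 / (τ₀ / 2 * (τ₀ / (16 * n)) ^ 2) := by positivity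
  set C1 := R ^ 2 / (τ₀ / 2 * (τ₀ / (16 * n)) ^ 2) with hC1def
  induction x using OnePoint.rec with
  | infty =>
    have := h.energyDist_infty_ge hws hΦ hψ hη2 hy
    simp only [expFun_infty, zero_mul, Complex.zero_re, sub_zero]
    nlinarith
  | coe x =>
    rw [re_expFun_imag_mul_star]
    rcases eq_or_ne ((x : V) - y) 0 with hxy | hxy
    · rw [hxy, inner_zero_right, Real.cos_zero, sub_self]; positivity
    -- Pigeonhole over the coordinates; n is the dimension plus one, so that the contradiction is
    -- strict.
    obtain ⟨j, hj⟩ : ∃ j, ‖(x : V) - y‖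
        ≤ n * |inner ℝ (stdOrthonormalBasis ℝ V j) ((x : V) - y)| := by
      by_contra hcon
      push Not at hcon
      have h1 : ‖(x : V) - y‖ ≤ ∑ j, |inner ℝ (stdOrthonormalBasis ℝ V j) ((x : V) - y)| := by
        conv_lhs => rw [← (stdOrthonormalBasis ℝ V).sum_repr' ((x : V) - y)]
        refine (norm_sum_le _ _).trans (Finset.sum_le_sum fun j _ => ?_)
        rw [norm_smul, (stdOrthonormalBasis ℝ V).orthonormal.1 j, mul_one, Real.norm_eq_abs]
      have h2 : n * ∑ j, |inner ℝ (stdOrthonormalBasis ℝ V j) ((x : V) - y)|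
          ≤ ∑ _j : Fin (Module.finrank ℝ V), ‖(x : V) - y‖ := by
        rw [Finset.mul_sum]; exact Finset.sum_le_sum fun j _ => (hcon j).le
      rw [Finset.sum_const, Finset.card_univ, Fintype.card_fin, nsmul_eq_mul] at h2
      have h3 : 0 < ‖(x : V) - y‖ := norm_pos_iff.2 hxy
      nlinarith
    rcases le_total (4 * Real.pi * n) ‖(x : V) - y‖ with hfar | hnear
    · have := h.energyDist_ge_of_far hws hΦ hψ hψc hη2 hn1 (hη1.trans hτ1) hy hj hfar
      have := Real.neg_one_le_cos (inner ℝ c ((x : V) - y))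
      nlinarith
    · have h1 : τ₀ * ‖(x : V) - y‖ ≤ 1 / 4 := by
        rw [hτ₀, div_mul_eq_mul_div, one_mul, div_le_iff₀ (by positivity)]
        linarith
      have h2 := h.energyDist_ge_of_near hws hΦ hψ hη2 hn1 hτ0 hτ1 hη1 hy hj h1
      have h3 := Real.one_sub_sq_div_two_le_cos (x := inner ℝ c ((x : V) - y))
      have h4 : (inner ℝ c ((x : V) - y)) ^ 2 ≤ (R * ‖(x : V) - y‖) ^ 2 := by
        rw [← sq_abs]
        exact pow_le_pow_left₀ (abs_nonneg _) ((abs_real_inner_le_norm _ _).trans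
          (mul_le_mul_of_nonneg_right hc (norm_nonneg _))) 2
      have h5 : (R * ‖(x : V) - y‖) ^ 2 = C1 * (τ₀ / 2 * (τ₀ * ‖(x : V) - y‖ / (16 * n)) ^ 2) := by
        rw [hC1def]; field_simp
      have h6 := mul_le_mul_of_nonneg_left h2 hC1
      nlinarith

end Energy

end AffineProcess

namespace AffineProcess

/-! ### Concentration of the transition probabilities in short time. -/

section MeasureHelpers

lemma half_le_integral_of_le_on {α : Type*} [MeasurableSpace α] {μ : Measure α}
    [IsFiniteMeasure μ] {f : α → ℝ} (hf0 : ∀ y, 0 ≤ f y) (hint : Integrable f μ) {S : Set α}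
    (hS : 1 / 2 ≤ μ.real S) {A : ℝ} (hA : ∀ y ∈ S, A ≤ f y) : A / 2 ≤ ∫ y, f y ∂μ := by
  rcases le_total A 0 with h | h
  · exact (by linarith : A / 2 ≤ 0).trans (integral_nonneg hf0)
  · have h1 := mul_meas_ge_le_integral_of_nonneg (ae_of_all μ hf0) hint A
    have h2 : μ.real S ≤ μ.real {y | A ≤ f y} := measureReal_mono hA
    nlinarith

/-- The variance decomposition of a complex function. -/
lemma integral_norm_sub_sq {α : Type*} [MeasurableSpace α] {μ : Measure α}
    [IsProbabilityMeasure μ] {g : α → ℂ} (hg : Measurable g) {C : ℝ} (hC : ∀ y, ‖g y‖ ≤ C)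
    (w : ℂ) :
    ∫ y, ‖g y - w‖ ^ 2 ∂μ
      = ∫ y, ‖g y‖ ^ 2 ∂μ + ‖w‖ ^ 2 - 2 * ((∫ y, g y ∂μ) * star w).re := by
  have hgi : Integrable g μ := Integrable.of_bound hg.aestronglyMeasurable C (ae_of_all _ hC)
  have h1 : ∀ y, ‖g y - w‖ ^ 2 = (‖g y‖ ^ 2 + ‖w‖ ^ 2) - 2 * (g y * star w).re := fun y => by
    rw [← Complex.normSq_eq_norm_sq, ← Complex.normSq_eq_norm_sq, ← Complex.normSq_eq_norm_sq,
      Complex.normSq_sub]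
    rfl
  have i1 : Integrable (fun y => ‖g y‖ ^ 2) μ :=
    Integrable.of_bound (hg.norm.pow_const 2).aestronglyMeasurable (C ^ 2) (ae_of_all _ fun y => by
      rw [norm_pow, norm_norm]; exact pow_le_pow_left₀ (norm_nonneg _) (hC y) 2)
  have i2 : Integrable (fun y => (g y * star w).re) μ := (hgi.mul_const _).re
  have i3 : Integrable (fun y => ‖g y‖ ^ 2 + ‖w‖ ^ 2) μ := i1.add (integrable_const _)
  have h2 := integral_re (hgi.mul_const (star w))
  simp only [RCLike.re_to_complex] at h2
  simp only [h1]
  rw [integral_sub i3 (i2.const_mul 2), integral_add i1 (integrable_const _), integral_const_mul,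
    h2, integral_mul_const]
  simp

end MeasureHelpers

variable {V : Type*} [NormedAddCommGroup V] [InnerProductSpace ℝ V] [FiniteDimensional ℝ V]
  [MeasurableSpace V] {E : Set V} [BorelSpace V]

lemma integrable_testMeasure_prod (κ : Measure (OnePoint E)) [IsFiniteMeasure κ]
    {F : V → OnePoint E → ℝ} (hc : ∀ y, Continuous fun θ => F θ y) (hm : ∀ θ, Measurable (F θ))
    {C : ℝ} (hC : ∀ θ y, ‖F θ y‖ ≤ C) :
    Integrable (Function.uncurry F) ((testMeasure V).prod κ) :=
  Integrable.of_bound (measurable_uncurry_of_continuous_of_measurable hc hm).aestronglyMeasurable C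
    (ae_of_all _ fun p => hC p.1 p.2)

variable {P : TransitionFunction E} {Φ : ℝ≥0 → ℝ≥0 → V × V → ℂ} {ψ : ℝ≥0 → ℝ≥0 → V × V → V × V}

lemma IsAffineData.measurable_expTransform (h : IsAffineData P Φ ψ) {w s : ℝ≥0} (hws : w ≤ s)
    {u : V × V} (hu : u ∈ expBounded E) : Measurable (P.expTransform w s u) := by
  have h1 : P.expTransform w s u = fun x => Φ w s u * expFun (ψ w s u) x :=
    funext fun x => h.affine.expTransform_eq hws hu x
  rw [h1]
  exact (measurable_expFun _).const_mul _

lemma imag_mem_expBounded (θ : V) : ((0, θ) : V × V) ∈ expBounded E :=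
  expBoundedBy_subset 1 (imag_mem_expBoundedBy θ le_rfl)

/-- The points of `E` at distance at most `ε` from `x`. -/
def nearSet (x : V) (ε : ℝ) : Set (OnePoint E) := (fun z : E => (z : OnePoint E)) '' {z | ‖(z : V) - x‖ ≤ ε}

lemma measurableSet_nearSet (x : V) (ε : ℝ) : MeasurableSet (nearSet (E := E) x ε) := by
  change MeasurableSet ((fun z : E => (z : OnePoint E)) ⁻¹' _)
  rw [nearSet, preimage_image_eq _ (OnePoint.coe_injective)]
  have hc : Continuous fun z : E => ‖(z : V) - x‖ := by fun_prop
  exact (isClosed_le hc continuous_const).measurableSet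

/-- The transition probabilities are concentrated near the starting point in short time. -/
lemma IsAffineData.exists_half_le_nearSet (h : IsAffineData P Φ ψ) (hE : E.Nonempty) {K ε : ℝ}
    (hK : 0 ≤ K) (hε : 0 < ε) (T : ℝ≥0) :
    ∃ δ : ℝ≥0, 0 < δ ∧ ∀ r w, r ≤ w → w ≤ T → w ≤ r + δ → ∀ x : E, ‖(x : V)‖ ≤ K →
      1 / 2 ≤ (P.kernel r w x).real (nearSet (x : V) ε) := by
  obtain ⟨C, hC, δ₁, hδ₁, hCJ⟩ := h.exists_le_energyDist hE (R := 1) hK T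
  set a := min ε Real.pi with ha
  have ha0 : 0 < a := lt_min hε Real.pi_pos
  -- The factor 2 accommodates the cemetery, where only the bound 1 is available while 1 - cos a may
  -- reach 2.
  set A := (1 - Real.cos a) / (2 * C) with hA
  have hA0 : 0 < A := by
    have : Real.cos a < 1 := by
      rw [← Real.cos_zero]
      exact Real.cos_lt_cos_of_nonneg_of_le_pi le_rfl (min_le_right _ _) ha0
    exact div_pos (by linarith) (by linarith)
  set m := (testMeasure V).real univ with hm
  have hm0 : 0 ≤ m := measureReal_nonneg
  set η := min (1 / (2 * (1 + K))) (A / (4 * (m + 1) * (3 + 4 * K))) with hη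
  have hη0 : 0 < η := by positivity
  obtain ⟨δ, hδ, hsmall⟩ := h.exists_small_time hE 1 1 T hη0
  refine ⟨δ, hδ, fun r w hrw hwT hwr x hx => ?_⟩
  have := P.isMarkovKernel r w hrw
  set κ := P.kernel r w x with hκ
  -- At equal times the kernels are Dirac measures, so J(y) is the integrated squared distance of
  -- the characters at y and at x. It is at least A away from x, while its mean is at most A/2, and
  -- Markov's inequality concludes.
  set J : OnePoint E → ℝ := fun y => P.energyDist w w y x with hJ
  have hJA : ∀ y ∉ nearSet (E := E) (x : V) ε, A ≤ J y := by
    intro y hy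
    rw [hA, div_le_iff₀ (by positivity)]
    have hJ0 : 0 ≤ J y := P.energyDist_nonneg w w y x
    induction y using OnePoint.rec with
    | infty =>
      have h1 := hCJ w w le_rfl hwT le_self_add x hx ∞ 0 (by simp)
      simp only [expFun_infty, zero_mul, Complex.zero_re, sub_zero] at h1
      have : 0 ≤ Real.cos a + 1 := by linarith [Real.neg_one_le_cos a]
      simp only [hJ]
      linarith
    | coe y =>
      have hd : ε < ‖(y : V) - x‖ := by
        by_contra hcon
        exact hy ⟨y, not_lt.1 hcon, rfl⟩
      set D := (y : V) - x with hD
      have hD0 : 0 < ‖D‖ := hε.trans hd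
      -- This frequency satisfies ⟨c, D⟩ = a exactly, however far y is, so a single value 1 - cos a
      -- bounds J from below.
      have hc : ‖(a / ‖D‖ ^ 2) • D‖ ≤ 1 := by
        rw [norm_smul, Real.norm_eq_abs, abs_of_nonneg (by positivity), sq, ← div_div,
          div_mul_cancel₀ _ hD0.ne', div_le_one hD0]
        exact (min_le_left _ _).trans hd.le
      have h1 := hCJ w w le_rfl hwT le_self_add x hx y _ hc
      rw [re_expFun_imag_mul_star, ← hD, real_inner_smul_left, real_inner_self_eq_norm_sq,
        div_mul_cancel₀ _ (by positivity)] at h1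
      have h2 : 0 ≤ C * J y := by positivity
      linarith
  have hJint : Integrable J κ ∧ ∫ y, J y ∂κ ≤ A / 2 := by
    set F : V → OnePoint E → ℝ := fun θ y => ‖expFun (0, θ) y - expFun (0, θ) (x : OnePoint E)‖ ^ 2
      with hF
    have hFc : ∀ y, Continuous fun θ => F θ y := fun y => by
      have h1 : ∀ y : OnePoint E, Continuous fun θ : V => expFun (0, θ) y := fun y =>
        (continuous_expFun y).comp (by fun_prop : Continuous fun θ : V => ((0, θ) : V × V))
      exact ((h1 y).sub (h1 x)).norm.pow 2
    have hFm : ∀ θ, Measurable (F θ) := fun θ =>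
      ((measurable_expFun _).sub_const _).norm.pow_const 2
    have hF4 : ∀ θ y, ‖F θ y‖ ≤ 4 := fun θ y => by
      have h1 := (norm_sub_le _ _).trans (add_le_add (norm_expFun_imag_le θ y)
        (norm_expFun_imag_le θ (x : OnePoint E)))
      rw [Real.norm_eq_abs, abs_of_nonneg (by positivity)]
      nlinarith [norm_nonneg (expFun (0, θ) y - expFun (0, θ) (x : OnePoint E))]
    have hJF : ∀ y, J y = ∫ θ, F θ y ∂(testMeasure V) := fun y => by
      simp only [hJ, TransitionFunction.energyDist, P.expTransform_self, hF]
    have hFi := integrable_testMeasure_prod κ hFc hFm hF4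
    rw [funext hJF]
    refine ⟨hFi.integral_prod_right, ?_⟩
    rw [← integral_integral_swap hFi]
    have hbd : ∀ θ : V, ‖θ‖ ≤ 1 → ∫ y, F θ y ∂κ ≤ 2 * (η * (3 + 4 * K)) := by
      intro θ hθ
      have h1 := integral_norm_sub_sq (μ := κ) (measurable_expFun (E := E) (0, θ))
        (norm_expFun_imag_le θ) (expFun (0, θ) (x : OnePoint E))
      have hx1 : ‖expFun (0, θ) (x : OnePoint E)‖ = 1 := by
        rw [expFun_coe, norm_exp_pairing]; simp
      have h2 : ∫ y, ‖expFun (0, θ) y‖ ^ 2 ∂κ ≤ 1 := by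
        have := integral_mono_of_nonneg (μ := κ) (f := fun y => ‖expFun (0, θ) y‖ ^ 2)
          (g := fun _ => (1 : ℝ)) (ae_of_all _ fun y => by positivity) (integrable_const _)
          (ae_of_all _ fun y => pow_le_one₀ (norm_nonneg _) (norm_expFun_imag_le θ y))
        simpa using this
      obtain ⟨hs1, hs2⟩ := hsmall r w (0, θ) hrw hwT hwr (imag_mem_expBoundedBy θ le_rfl) (by
        rw [Prod.norm_mk, norm_zero]; exact max_le zero_le_one hθ)
      have h3 : ∫ y, expFun (0, θ) y ∂κ
          = expFun (0, θ) (x : OnePoint E)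
            * (Φ r w (0, θ) * Complex.exp (pairing (ψ r w (0, θ) - (0, θ)) (x : V))) := by
        have := h.affine r w hrw _ (imag_mem_expBounded (E := E) θ) x
        rw [TransitionFunction.expTransform] at this
        rw [this, expFun_coe, mul_left_comm, ← Complex.exp_add, ← pairing_add, add_sub_cancel]
      set q := pairing (ψ r w (0, θ) - (0, θ)) (x : V)
      have hq : ‖q‖ ≤ 2 * η * K := (norm_pairing_le _ _).trans (by gcongr)
      have hq1 : ‖q‖ ≤ 1 := by
        refine hq.trans ?_
        have : η ≤ 1 / (2 * (1 + K)) := min_le_left _ _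
        rw [le_div_iff₀ (by positivity)] at this
        nlinarith
      have h4 : ‖Φ r w (0, θ) * Complex.exp q - 1‖ ≤ η * (3 + 4 * K) := by
        have e1 := Complex.norm_exp_sub_one_le hq1
        have e2 : Φ r w (0, θ) * Complex.exp q - 1
            = (Φ r w (0, θ) - 1) * (1 + (Complex.exp q - 1)) + (Complex.exp q - 1) := by ring
        rw [e2]
        refine (norm_add_le _ _).trans ?_
        rw [norm_mul]
        have e3 := norm_add_le (1 : ℂ) (Complex.exp q - 1)
        rw [norm_one] at e3
        have e4 : ‖Φ r w (0, θ) - 1‖ * ‖1 + (Complex.exp q - 1)‖ ≤ η * 3 :=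
          mul_le_mul hs1 (by linarith) (norm_nonneg _) hη0.le
        linarith
      have h5 : 1 - ((∫ y, expFun (0, θ) y ∂κ) * star (expFun (0, θ) (x : OnePoint E))).re
          ≤ η * (3 + 4 * K) := by
        rw [h3]
        have e1 : expFun (0, θ) (x : OnePoint E) * (Φ r w (0, θ) * Complex.exp q)
            * star (expFun (0, θ) (x : OnePoint E)) = Φ r w (0, θ) * Complex.exp q := by
          have : expFun (0, θ) (x : OnePoint E) * star (expFun (0, θ) (x : OnePoint E)) = 1 := by
            rw [Complex.star_def, Complex.mul_conj', hx1]; simp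
          calc _ = (expFun (0, θ) (x : OnePoint E) * star (expFun (0, θ) (x : OnePoint E)))
              * (Φ r w (0, θ) * Complex.exp q) := by ring
            _ = _ := by rw [this, one_mul]
        rw [e1]
        have e2 := (Complex.abs_re_le_norm _).trans h4
        rw [Complex.sub_re, Complex.one_re, abs_le] at e2
        linarith
      rw [h1, hx1]
      linarith
    have hbd' : ∀ᵐ θ ∂(testMeasure V), ∫ y, F θ y ∂κ ≤ 2 * (η * (3 + 4 * K)) := by
      filter_upwards [ae_testMeasure_norm_le (V := V)] with θ hθ using hbd θ hθ
    have h6 := integral_mono_ae hFi.integral_prod_left (integrable_const _) hbd'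
    refine h6.trans ?_
    rw [integral_const, smul_eq_mul]
    have h7 : η ≤ A / (4 * (m + 1) * (3 + 4 * K)) := min_le_right _ _
    rw [le_div_iff₀ (by positivity)] at h7
    have h8 : 0 ≤ η * (3 + 4 * K) := by positivity
    change m * _ ≤ _
    nlinarith
  have h1 := mul_meas_ge_le_integral_of_nonneg
    (ae_of_all κ fun y => P.energyDist_nonneg w w y x) hJint.1 A
  have h2 : κ.real (nearSet (E := E) (x : V) ε)ᶜ ≤ κ.real {y | A ≤ J y} := measureReal_mono hJA
  rw [probReal_compl_eq_one_sub (measurableSet_nearSet _ _)] at h2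
  have h3 : A * (1 - κ.real (nearSet (E := E) (x : V) ε)) ≤ A / 2 :=
    (mul_le_mul_of_nonneg_left h2 hA0.le).trans (h1.trans hJint.2)
  have h4 := le_of_mul_le_mul_left (h3.trans_eq (by ring : A / 2 = A * (1 / 2))) hA0
  linarith

end AffineProcess

namespace AffineProcess

/-! ### Loss of modulus and its control by the energy. -/

section Loss

variable {V : Type*} [NormedAddCommGroup V] [InnerProductSpace ℝ V] {E : Set V}

/-- The logarithm of the ratio of `P_{a,t} f_{ic}(x)` and `f_{ic}(x)`. -/
noncomputable def logIncr (Φ : ℝ≥0 → ℝ≥0 → V × V → ℂ) (ψ : ℝ≥0 → ℝ≥0 → V × V → V × V) (a t : ℝ≥0)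
    (c x : V) : ℂ :=
  Complex.log (Φ a t (0, c)) + pairing (ψ a t (0, c) - (0, c)) x

variable [MeasurableSpace V] {P : TransitionFunction E}
  {Φ : ℝ≥0 → ℝ≥0 → V × V → ℂ} {ψ : ℝ≥0 → ℝ≥0 → V × V → V × V}

lemma IsAffineData.expTransform_eq_exp_logIncr (h : IsAffineData P Φ ψ) {a t : ℝ≥0} (hat : a ≤ t)
    {c : V} (hΦ : Φ a t (0, c) ≠ 0) (x : E) :
    P.expTransform a t (0, c) (x : OnePoint E)
      = Complex.exp (logIncr Φ ψ a t c x + (inner ℝ c (x : V) : ℝ) * Complex.I) := by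
  rw [h.affine a t hat _ (expBoundedBy_subset 1 (imag_mem_expBoundedBy c le_rfl)) x, logIncr,
    add_assoc, Complex.exp_add, Complex.exp_log hΦ]
  congr 2
  rw [pairing_sub]
  simp [pairing]

lemma IsAffineData.norm_expTransform_eq (h : IsAffineData P Φ ψ) {a t : ℝ≥0} (hat : a ≤ t)
    {c : V} (hΦ : Φ a t (0, c) ≠ 0) (x : E) :
    ‖P.expTransform a t (0, c) (x : OnePoint E)‖ = Real.exp (logIncr Φ ψ a t c x).re := by
  rw [h.expTransform_eq_exp_logIncr hat hΦ, Complex.norm_exp]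
  simp

lemma IsAffineData.logIncr_re_nonpos (h : IsAffineData P Φ ψ) {a t : ℝ≥0} (hat : a ≤ t)
    {c : V} (hΦ : Φ a t (0, c) ≠ 0) (x : E) : (logIncr Φ ψ a t c x).re ≤ 0 := by
  have := P.isMarkovKernel a t hat
  have h1 := norm_integral_expFun_imag_le (P.kernel a t x) c
  change ‖P.expTransform a t (0, c) (x : OnePoint E)‖ ≤ 1 at h1
  rw [h.norm_expTransform_eq hat hΦ] at h1
  exact Real.exp_le_one_iff.1 h1

lemma norm_logIncr_le {a t : ℝ≥0} {c x : V} {η : ℝ} (hη : η ≤ 1 / 2)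
    (hΦ : ‖Φ a t (0, c) - 1‖ ≤ η) (hψ : ‖ψ a t (0, c) - (0, c)‖ ≤ η) :
    ‖logIncr Φ ψ a t c x‖ ≤ 2 * η * (1 + ‖x‖) := by
  have hη0 : 0 ≤ η := (norm_nonneg _).trans hΦ
  have h1 := Complex.norm_log_one_add_half_le_self (z := Φ a t (0, c) - 1) (hΦ.trans hη)
  rw [add_sub_cancel] at h1
  have h2 : ‖pairing (ψ a t (0, c) - (0, c)) x‖ ≤ 2 * η * ‖x‖ :=
    (norm_pairing_le _ _).trans (by gcongr)
  refine (norm_add_le _ _).trans ?_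
  linarith

/-- The loss of modulus is affine in x. Together with its nonnegativity on E this makes barycentric
coordinates and the compactness lemma applicable. -/
lemma neg_logIncr_re_eq (a t : ℝ≥0) (c x : V) : -(logIncr Φ ψ a t c x).re
    = -(Complex.log (Φ a t (0, c))).re + inner ℝ (-(ψ a t (0, c)).1) x := by
  rw [logIncr, Complex.add_re, pairing_re, inner_neg_left]
  simp; ring

lemma neg_log_le_two_mul {l : ℝ} (hl : -(1 / 2) ≤ l) (hl0 : l ≤ 0) : -l ≤ 2 * (1 - Real.exp l) := by
  have h1 : Real.exp l * Real.exp (-l) = 1 := by rw [← Real.exp_add]; simp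
  have h2 := Real.add_one_le_exp (-l)
  have h3 : 0 < Real.exp l := Real.exp_pos l
  have h4 : Real.exp l * (1 - l) ≤ 1 := by nlinarith
  nlinarith

end Loss

section Energy

variable {V : Type*} [NormedAddCommGroup V] [InnerProductSpace ℝ V] [FiniteDimensional ℝ V]
  [MeasurableSpace V] {E : Set V}

/-- The integral of the squared modulus of the characteristic function of `P_{w,s}(x, ·)` with
respect to the test measure. -/
noncomputable def TransitionFunction.energy (P : TransitionFunction E) (w s : ℝ≥0)
    (x : OnePoint E) : ℝ :=
  ∫ θ, ‖P.expTransform w s (0, θ) x‖ ^ 2 ∂(testMeasure V)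

/-- The variance of the characteristic function of `P_{t,s}(Y, ·)` for `Y` with the law
`P_{a,t}(x, ·)`, integrated with respect to the test measure. -/
noncomputable def TransitionFunction.energyVar (P : TransitionFunction E) (a t s : ℝ≥0)
    (x : OnePoint E) : ℝ :=
  ∫ y, (∫ θ, ‖P.expTransform t s (0, θ) y - P.expTransform a s (0, θ) x‖ ^ 2 ∂(testMeasure V))
    ∂(P.kernel a t x)

variable [BorelSpace V] {P : TransitionFunction E}
  {Φ : ℝ≥0 → ℝ≥0 → V × V → ℂ} {ψ : ℝ≥0 → ℝ≥0 → V × V → V × V}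

lemma TransitionFunction.energyVar_nonneg (P : TransitionFunction E) (a t s : ℝ≥0)
    (x : OnePoint E) : 0 ≤ P.energyVar a t s x :=
  integral_nonneg fun _ => integral_nonneg fun _ => by positivity

lemma IsAffineData.integrable_energy_prod (h : IsAffineData P Φ ψ) {w s : ℝ≥0} (hws : w ≤ s)
    (κ : Measure (OnePoint E)) [IsFiniteMeasure κ] {z : V → ℂ} (hz : Continuous z)
    (hz1 : ∀ θ, ‖z θ‖ ≤ 1) : Integrable (Function.uncurry fun (θ : V) (y : OnePoint E) =>
      ‖P.expTransform w s (0, θ) y - z θ‖ ^ 2) ((testMeasure V).prod κ) := by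
  refine integrable_testMeasure_prod κ
    (fun y => ((P.continuous_expTransform_imag hws y).sub hz).norm.pow 2)
    (fun θ => (((h.measurable_expTransform hws (imag_mem_expBounded θ)).sub_const _).norm.pow_const
      2)) (C := 4) fun θ y => ?_
  have h1 := (norm_sub_le _ _).trans (add_le_add (P.norm_expTransform_imag_le hws θ y) (hz1 θ))
  rw [Real.norm_eq_abs, abs_of_nonneg (by positivity)]
  nlinarith [norm_nonneg (P.expTransform w s (0, θ) y - z θ)]

lemma IsAffineData.integrable_energy_prod' (h : IsAffineData P Φ ψ) {w s : ℝ≥0} (hws : w ≤ s)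
    (κ : Measure (OnePoint E)) [IsFiniteMeasure κ] :
    Integrable (Function.uncurry fun (θ : V) (y : OnePoint E) =>
      ‖P.expTransform w s (0, θ) y‖ ^ 2) ((testMeasure V).prod κ) := by
  simpa using h.integrable_energy_prod hws κ (z := fun _ => 0) continuous_const (by simp)

lemma TransitionFunction.energy_le (P : TransitionFunction E) {w s : ℝ≥0} (hws : w ≤ s)
    (x : OnePoint E) : P.energy w s x ≤ (testMeasure V).real univ := by
  have h1 := integral_mono_of_nonneg (μ := testMeasure V)
    (f := fun θ => ‖P.expTransform w s (0, θ) x‖ ^ 2) (g := fun _ => (1 : ℝ))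
    (ae_of_all _ fun y => by positivity) (integrable_const _)
    (ae_of_all _ fun θ => pow_le_one₀ (norm_nonneg _) (P.norm_expTransform_imag_le hws θ x))
  rw [integral_const, smul_eq_mul, mul_one] at h1
  exact h1

lemma TransitionFunction.energy_nonneg (P : TransitionFunction E) (w s : ℝ≥0) (x : OnePoint E) :
    0 ≤ P.energy w s x := integral_nonneg fun _ => by positivity

lemma IsAffineData.integrable_energy (h : IsAffineData P Φ ψ) {w s : ℝ≥0} (hws : w ≤ s)
    (κ : Measure (OnePoint E)) [IsFiniteMeasure κ] : Integrable (P.energy w s) κ :=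
  (h.integrable_energy_prod' hws κ).integral_prod_right

/-- Variance decomposition: the mean of P_{t,s}f_θ under P_{a,t}(x, ·) is P_{a,s}f_θ(x). -/
lemma IsAffineData.energyVar_eq (h : IsAffineData P Φ ψ) {a t s : ℝ≥0} (hat : a ≤ t)
    (hts : t ≤ s) (x : OnePoint E) :
    P.energyVar a t s x = ∫ y, P.energy t s y ∂(P.kernel a t x) - P.energy a s x := by
  have := P.isMarkovKernel a t hat
  have has := hat.trans hts
  have i1 := h.integrable_energy_prod hts (P.kernel a t x)
    (P.continuous_expTransform_imag has x) fun θ => P.norm_expTransform_imag_le has θ x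
  have i2 := h.integrable_energy_prod' hts (P.kernel a t x)
  simp only [TransitionFunction.energyVar, TransitionFunction.energy]
  rw [← integral_integral_swap i1, ← integral_integral_swap i2, ← integral_sub]
  · refine integral_congr_ae (ae_of_all _ fun θ => ?_)
    change ∫ y, ‖P.expTransform t s (0, θ) y - P.expTransform a s (0, θ) x‖ ^ 2 ∂(P.kernel a t x)
      = ∫ y, ‖P.expTransform t s (0, θ) y‖ ^ 2 ∂(P.kernel a t x) - ‖P.expTransform a s (0, θ) x‖ ^ 2
    rw [integral_norm_sub_sq (h.measurable_expTransform hts (imag_mem_expBounded θ))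
      (fun y => P.norm_expTransform_imag_le hts θ y),
      ← P.expTransform_comp hat hts (imag_mem_expBounded θ), Complex.star_def, Complex.mul_conj']
    norm_cast
    ring
  · exact i2.integral_prod_left
  · exact Integrable.of_bound
      ((P.continuous_expTransform_imag has x).norm.pow 2).aestronglyMeasurable 1
      (ae_of_all _ fun θ => by
        rw [norm_pow, norm_norm]
        exact pow_le_one₀ (norm_nonneg _) (P.norm_expTransform_imag_le has θ x))

lemma IsAffineData.integrable_energyVar (h : IsAffineData P Φ ψ) {a t s : ℝ≥0} (hat : a ≤ t)
    (hts : t ≤ s) (κ : Measure (OnePoint E)) [IsFiniteMeasure κ] :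
    Integrable (P.energyVar a t s) κ := by
  have := P.isMarkovKernel a t hat
  have hm : StronglyMeasurable (P.energy t s) := by
    have := measurable_uncurry_of_continuous_of_measurable
      (u := fun (θ : V) (y : OnePoint E) => ‖P.expTransform t s (0, θ) y‖ ^ 2)
      (fun y => (P.continuous_expTransform_imag hts y).norm.pow 2)
      (fun θ => (h.measurable_expTransform hts (imag_mem_expBounded θ)).norm.pow_const 2)
    exact this.stronglyMeasurable.integral_prod_left
  have h1 : Integrable (fun x => ∫ y, P.energy t s y ∂(P.kernel a t x)) κ := by
    refine Integrable.of_bound (hm.integral_kernel (κ := P.kernel a t)).aestronglyMeasurable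
      ((testMeasure V).real univ) (ae_of_all _ fun x => ?_)
    refine (norm_integral_le_of_norm_le_const (C := (testMeasure V).real univ)
      (ae_of_all _ fun y => ?_)).trans (by simp)
    rw [Real.norm_eq_abs, abs_of_nonneg (P.energy_nonneg _ _ _)]
    exact P.energy_le hts y
  have h2 : P.energyVar a t s = fun x => ∫ y, P.energy t s y ∂(P.kernel a t x) - P.energy a s x :=
    funext fun x => h.energyVar_eq hat hts x
  rw [h2]
  exact h1.sub (h.integrable_energy (hat.trans hts) κ)

/-- The mean energy is that of a martingale of predictions. Its increments are mean variances, hence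
nonnegative, and they telescope over a partition to a quantity bounded by the mass of the test
measure. -/
lemma IsAffineData.integral_energy_sub (h : IsAffineData P Φ ψ) {r a t s : ℝ≥0} (hra : r ≤ a)
    (hat : a ≤ t) (hts : t ≤ s) (x : OnePoint E) :
    ∫ y, P.energy t s y ∂(P.kernel r t x) - ∫ y, P.energy a s y ∂(P.kernel r a x)
      = ∫ y, P.energyVar a t s y ∂(P.kernel r a x) := by
  have := P.isMarkovKernel r a hra
  have := P.isMarkovKernel a t hat
  have : IsMarkovKernel (P.kernel a t ∘ₖ P.kernel r a) := inferInstance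
  have h1 : ∫ y, P.energy t s y ∂(P.kernel r t x)
      = ∫ x', ∫ y, P.energy t s y ∂(P.kernel a t x') ∂(P.kernel r a x) := by
    rw [← P.comp_of_le hra hat, Kernel.integral_comp]
    exact h.integrable_energy hts _
  have h2 : ∀ x', ∫ y, P.energy t s y ∂(P.kernel a t x') = P.energyVar a t s x' + P.energy a s x' :=
    fun x' => by rw [h.energyVar_eq hat hts]; ring
  rw [h1]
  simp only [h2]
  rw [integral_add (h.integrable_energyVar hat hts _) (h.integrable_energy (hat.trans hts) _)]
  ring

/-- The loss of modulus of the characteristic function in one step is controlled by the variance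
of the characteristic function of the future. -/
lemma IsAffineData.one_sub_norm_le_energyVar (h : IsAffineData P Φ ψ) {a t s : ℝ≥0} (hat : a ≤ t)
    (hts : t ≤ s) {C K ε R : ℝ} (hC : 0 < C)
    (hJ : ∀ y : E, ‖(y : V)‖ ≤ K → ∀ (x : OnePoint E) (c : V), ‖c‖ ≤ R →
        1 - (expFun (0, c) x * star (expFun (0, c) (y : OnePoint E))).re
          ≤ C * P.energyDist t s x y) {x : E} (hx : ‖(x : V)‖ + ε ≤ K)
    (hnear : 1 / 2 ≤ (P.kernel a t x).real (nearSet (x : V) ε)) {c : V} (hc : ‖c‖ ≤ R) :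
    1 - ‖P.expTransform a t (0, c) (x : OnePoint E)‖ ≤ 6 * C * P.energyVar a t s x := by
  have := P.isMarkovKernel a t hat
  set κ := P.kernel a t x with hκ
  set z : V → ℂ := fun θ => P.expTransform a s (0, θ) (x : OnePoint E) with hz
  have has := hat.trans hts
  set v : OnePoint E → ℝ := fun y => ∫ θ, ‖P.expTransform t s (0, θ) y - z θ‖ ^ 2 ∂(testMeasure V)
    with hv
  have hprod := h.integrable_energy_prod hts κ (z := z)
    (P.continuous_expTransform_imag has x) fun θ => P.norm_expTransform_imag_le has θ x
  have hvi : Integrable v κ := hprod.integral_prod_right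
  have hv0 : ∀ y, 0 ≤ v y := fun y => integral_nonneg fun _ => by positivity
  have hvar : P.energyVar a t s x = ∫ y, v y ∂κ := rfl
  have hzi : ∀ y : OnePoint E, Integrable (fun θ => ‖P.expTransform t s (0, θ) y - z θ‖ ^ 2)
      (testMeasure V) := fun y =>
    Integrable.of_bound (((P.continuous_expTransform_imag hts y).sub
      (P.continuous_expTransform_imag has x)).norm.pow 2).aestronglyMeasurable 4
      (ae_of_all _ fun θ => by
        have h1 := (norm_sub_le _ _).trans (add_le_add (P.norm_expTransform_imag_le hts θ y)
          (P.norm_expTransform_imag_le has θ (x : OnePoint E)))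
        rw [Real.norm_eq_abs, abs_of_nonneg (by positivity)]
        nlinarith [norm_nonneg (P.expTransform t s (0, θ) y - P.expTransform a s (0, θ) x)])
  have hJv : ∀ y y', P.energyDist t s y' y ≤ 2 * v y' + 2 * v y := by
    intro y y'
    rw [TransitionFunction.energyDist, hv]
    simp only
    rw [← integral_const_mul, ← integral_const_mul,
      ← integral_add ((hzi y').const_mul 2) ((hzi y).const_mul 2)]
    refine integral_mono_of_nonneg (ae_of_all _ fun θ => by positivity)
      (((hzi y').const_mul 2).add ((hzi y).const_mul 2)) (ae_of_all _ fun θ => ?_)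
    have h1 := norm_sub_le_norm_sub_add_norm_sub (P.expTransform t s (0, θ) y') (z θ)
      (P.expTransform t s (0, θ) y)
    rw [norm_sub_rev (z θ)] at h1
    have h2 := pow_le_pow_left₀ (norm_nonneg _) h1 2
    simp only
    nlinarith [sq_nonneg (‖P.expTransform t s (0, θ) y' - z θ‖ - ‖P.expTransform t s (0, θ) y - z θ‖)]
  set χ := P.expTransform a t (0, c) (x : OnePoint E) with hχ
  -- An independent copy y' is averaged first, with y fixed near x. Averaging over such y, which
  -- carry mass at least 1/2, then gives (1 - |χ| - 2C Var)/2 ≤ 2C Var, hence the constant 6.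
  have hY : ∀ y ∈ nearSet (E := E) (x : V) ε,
      1 - ‖χ‖ - 2 * C * P.energyVar a t s x ≤ 2 * C * v y := by
    rintro _ ⟨y, hy, rfl⟩
    have hyK : ‖(y : V)‖ ≤ K := by
      have := norm_sub_norm_le (y : V) x
      have hy' : ‖(y : V) - x‖ ≤ ε := hy
      linarith
    have hpt : ∀ y', 1 - (expFun (0, c) y' * star (expFun (0, c) (y : OnePoint E))).re
        ≤ 2 * C * v y' + 2 * C * v y := fun y' => by
      have h1 := hJ y hyK y' c hc
      have h2 := mul_le_mul_of_nonneg_left (hJv y y') hC.le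
      linarith
    have hfi : Integrable (fun y' => (expFun (0, c) y'
        * star (expFun (0, c) (y : OnePoint E))).re) κ :=
      ((integrable_expFun_imag κ c).mul_const _).re
    have hli : Integrable (fun y' => 1 - (expFun (0, c) y'
        * star (expFun (0, c) (y : OnePoint E))).re) κ := (integrable_const _).sub hfi
    have hri : Integrable (fun y' => 2 * C * v y' + 2 * C * v y) κ :=
      (hvi.const_mul _).add (integrable_const _)
    have h1 := integral_mono hli hri hpt
    have h2 := integral_re ((integrable_expFun_imag κ c).mul_const
      (star (expFun (0, c) (y : OnePoint E))))
    simp only [RCLike.re_to_complex] at h2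
    rw [integral_sub (integrable_const _) hfi, h2, integral_mul_const,
      integral_add (hvi.const_mul _) (integrable_const _), integral_const_mul] at h1
    simp only [integral_const, probReal_univ, one_smul] at h1
    have h3 : (χ * star (expFun (0, c) (y : OnePoint E))).re ≤ ‖χ‖ := by
      refine (Complex.re_le_norm _).trans ?_
      rw [norm_mul, norm_star]
      exact mul_le_of_le_one_right (norm_nonneg _) (norm_expFun_imag_le _ _)
    change 1 - (χ * star (expFun (0, c) (y : OnePoint E))).re ≤ _ at h1
    rw [hvar]
    linarith
  have h1 := half_le_integral_of_le_on (μ := κ) (f := fun y => 2 * C * v y)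
    (fun y => mul_nonneg (by positivity) (hv0 y)) (hvi.const_mul _) hnear hY
  rw [integral_const_mul, ← hvar] at h1
  linarith

variable {ι : Type*} [Fintype ι]

lemma exists_coord_close (b : AffineBasis ι ℝ V) {ξ : ℝ} (hξ : 0 < ξ) :
    ∃ ε : ℝ, 0 < ε ∧ ∀ j k x, ‖x - b j‖ ≤ ε → |b.coord k x - b.coord k (b j)| ≤ ξ := by
  have h1 : ∀ j, ∃ ε : ℝ, 0 < ε ∧ ∀ k x, ‖x - b j‖ ≤ ε → |b.coord k x - b.coord k (b j)| ≤ ξ := by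
    intro j
    have h2 : ∀ᶠ x in 𝓝 (b j), ∀ k, |b.coord k x - b.coord k (b j)| < ξ :=
      Filter.eventually_all.2 fun k => by
        have := ((continuous_barycentric_coord b k).tendsto (b j)).eventually
          (Metric.ball_mem_nhds _ hξ)
        exact this
    obtain ⟨ε, hε, h3⟩ := Metric.nhds_basis_closedBall.eventually_iff.1 h2
    exact ⟨ε, hε, fun k x hx => (h3 (mem_closedBall_iff_norm.2 hx) k).le⟩
  choose ε hε h2 using h1
  rcases isEmpty_or_nonempty ι with hι | hι
  · exact ⟨1, one_pos, fun j => hι.elim j⟩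
  · refine ⟨Finset.univ.inf' Finset.univ_nonempty ε, ?_, fun j k x hx => h2 j k x ?_⟩
    · rw [Finset.lt_inf'_iff]; exact fun j _ => hε j
    · exact hx.trans (Finset.inf'_le _ (Finset.mem_univ j))

/-- Barycentric coordinates express the value at x by the nonnegative values at the vertices; a
change of each coordinate by at most ξ costs at most ξ times their sum. -/
lemma loss_ge_of_coord_close (b : AffineBasis ι ℝ V) {α ξ : ℝ} {β x : V} {j : ι}
    (h0 : ∀ k, 0 ≤ α + inner ℝ β (b k)) (hx : ∀ k, |b.coord k x - b.coord k (b j)| ≤ ξ) :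
    α + inner ℝ β (b j) - ξ * ∑ k, (α + inner ℝ β (b k)) ≤ α + inner ℝ β x := by
  rw [affine_eq_sum_coord b α β x, affine_eq_sum_coord b α β (b j), Finset.mul_sum,
    ← Finset.sum_sub_distrib]
  refine Finset.sum_le_sum fun k _ => ?_
  have := (abs_le.1 (hx k)).1
  nlinarith [h0 k]

/-- The sum over the starting points `x j` of the mean energies at time `w`. -/
noncomputable def TransitionFunction.meanEnergy (P : TransitionFunction E) (x : ι → OnePoint E)
    (r w s : ℝ≥0) : ℝ :=
  ∑ j, ∫ y, P.energy w s y ∂(P.kernel r w (x j))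

lemma IsAffineData.meanEnergy_le (h : IsAffineData P Φ ψ) (x : ι → OnePoint E) {r w s : ℝ≥0}
    (hrw : r ≤ w) (hws : w ≤ s) :
    P.meanEnergy x r w s ≤ Fintype.card ι * (testMeasure V).real univ := by
  have := P.isMarkovKernel r w hrw
  refine (Finset.sum_le_card_nsmul Finset.univ _ ((testMeasure V).real univ) fun j _ => ?_).trans_eq
    (by rw [nsmul_eq_mul, Finset.card_univ])
  have h1 := integral_mono (h.integrable_energy hws (P.kernel r w (x j))) (integrable_const _)
    (fun y => P.energy_le hws y)
  simpa using h1

lemma TransitionFunction.meanEnergy_nonneg (P : TransitionFunction E) (x : ι → OnePoint E)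
    (r w s : ℝ≥0) : 0 ≤ P.meanEnergy x r w s :=
  Finset.sum_nonneg fun _ _ => integral_nonneg fun _ => P.energy_nonneg _ _ _

lemma IsAffineData.meanEnergy_mono (h : IsAffineData P Φ ψ) (x : ι → OnePoint E) {r a t s : ℝ≥0}
    (hra : r ≤ a) (hat : a ≤ t) (hts : t ≤ s) :
    P.meanEnergy x r a s ≤ P.meanEnergy x r t s := by
  refine Finset.sum_le_sum fun j _ => ?_
  have h1 := h.integral_energy_sub hra hat hts (x j)
  have h2 : 0 ≤ ∫ y, P.energyVar a t s y ∂(P.kernel r a (x j)) :=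
    integral_nonneg fun y => P.energyVar_nonneg a t s y
  linarith

/-- In short time, the loss of modulus in one step is controlled by the increment of the mean
energy. -/
lemma IsAffineData.exists_sum_loss_le (h : IsAffineData P Φ ψ) (b : AffineBasis ι ℝ V)
    [Nonempty ι] (hb : ∀ j, b j ∈ E) {R : ℝ} (hR : 0 ≤ R) (T : ℝ≥0) :
    ∃ C : ℝ, 0 < C ∧ ∃ δ : ℝ≥0, 0 < δ ∧ ∀ r a t s, r ≤ a → a ≤ t → t ≤ s → s ≤ T → s ≤ r + δ →
      ∀ c : V, ‖c‖ ≤ R → ∑ j, -(logIncr Φ ψ a t c (b j)).re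
        ≤ C * (P.meanEnergy (fun j => ((⟨b j, hb j⟩ : E) : OnePoint E)) r t s
          - P.meanEnergy (fun j => ((⟨b j, hb j⟩ : E) : OnePoint E)) r a s) := by
  have hE : E.Nonempty := ⟨_, hb (Classical.arbitrary ι)⟩
  obtain ⟨n, hn⟩ : ∃ n : ℝ, n = Fintype.card ι := ⟨_, rfl⟩
  have hn0 : 0 < n := by rw [hn]; exact_mod_cast Fintype.card_pos
  obtain ⟨ε₀, hε₀, hcoord⟩ := exists_coord_close b (ξ := 1 / (4 * n)) (by positivity)
  set ε := min ε₀ 1 with hε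
  have hε0 : 0 < ε := lt_min hε₀ one_pos
  set K : ℝ := ∑ j, ‖b j‖ + 2 with hK
  have hbK : ∀ j, ‖b j‖ + 2 ≤ K := fun j => by
    have := Finset.single_le_sum (f := fun j => ‖b j‖) (fun j _ => norm_nonneg (b j))
      (Finset.mem_univ j)
    simp only [hK]; linarith
  have hK0 : 0 ≤ K := by positivity
  obtain ⟨C, hC, δ₁, hδ₁, hJ⟩ := h.exists_le_energyDist hE (R := R) hK0 T
  obtain ⟨δ₂, hδ₂, hnear⟩ := h.exists_half_le_nearSet hE hK0 hε0 T
  set η : ℝ := 1 / (4 * (1 + K)) with hη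
  have hη0 : 0 < η := by positivity
  have hη1 : 2 * η * (1 + K) ≤ 1 / 2 := by rw [hη]; field_simp; norm_num
  have hη2 : η ≤ 1 / 2 := by nlinarith
  obtain ⟨δ₃, hδ₃, hsmall⟩ := h.exists_small_time hE 1 R T hη0
  -- Passing from b j to nearby starting points costs S/(4n) for each j, so 3S/4 of the total loss S
  -- survives; the factor 12C from the variance bound and a final 2 give 24C/(3/4) = 32C.
  refine ⟨32 * C, by positivity, min δ₁ (min δ₂ δ₃), lt_min hδ₁ (lt_min hδ₂ hδ₃),
    fun r a t s hra hat hts hsT hsr c hc => ?_⟩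
  have htT := hts.trans hsT
  have hstep : ∀ δ, min δ₁ (min δ₂ δ₃) ≤ δ → ∀ p q, r ≤ p → q ≤ s → q ≤ p + δ :=
    fun δ hδ p q hp hq => hq.trans (hsr.trans (by gcongr))
  have hδ1 : min δ₁ (min δ₂ δ₃) ≤ δ₁ := min_le_left _ _
  have hδ2 : min δ₁ (min δ₂ δ₃) ≤ δ₂ := (min_le_right _ _).trans (min_le_left _ _)
  have hδ3 : min δ₁ (min δ₂ δ₃) ≤ δ₃ := (min_le_right _ _).trans (min_le_right _ _)
  obtain ⟨hΦ, hψ⟩ := hsmall a t (0, c) hat htT (hstep _ hδ3 a t hra hts)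
    (imag_mem_expBoundedBy c le_rfl) (by
      rw [Prod.norm_mk, norm_zero]; exact max_le hR hc)
  have hΦ0 : Φ a t (0, c) ≠ 0 := by
    intro h0
    rw [h0, zero_sub, norm_neg, norm_one] at hΦ
    linarith
  have hra' := P.isMarkovKernel r a hra
  set L : V → ℝ := fun x => -(logIncr Φ ψ a t c x).re with hL
  have hLaff : ∀ x, L x = -(Complex.log (Φ a t (0, c))).re + inner ℝ (-(ψ a t (0, c)).1) x :=
    fun x => neg_logIncr_re_eq a t c x
  have hL0 : ∀ j, 0 ≤ L (b j) := fun j => neg_nonneg.2 (h.logIncr_re_nonpos hat hΦ0 ⟨b j, hb j⟩)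
  set S := ∑ k, L (b k) with hS
  have hpt : ∀ j, ∀ y ∈ nearSet (E := E) (b j) ε,
      (L (b j) - 1 / (4 * n) * S) / (12 * C) ≤ P.energyVar a t s y := by
    rintro j _ ⟨y, hy, rfl⟩
    have hy' : ‖(y : V) - b j‖ ≤ ε := hy
    have hyK : ‖(y : V)‖ + ε ≤ K := by
      have h1 := norm_sub_norm_le (y : V) (b j)
      have h2 : ε ≤ 1 := min_le_right _ _
      have h3 := hbK j
      linarith
    have h1 : L (b j) - 1 / (4 * n) * S ≤ L y := by
      have := loss_ge_of_coord_close b (α := -(Complex.log (Φ a t (0, c))).re)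
        (β := -(ψ a t (0, c)).1) (x := (y : V)) (j := j) (ξ := 1 / (4 * n))
        (fun k => by rw [← hLaff]; exact hL0 k)
        (fun k => hcoord j k y (hy'.trans (min_le_left _ _)))
      simpa only [← hLaff, hS] using this
    have h2 : L y ≤ 2 * (1 - ‖P.expTransform a t (0, c) (y : OnePoint E)‖) := by
      rw [h.norm_expTransform_eq hat hΦ0]
      refine neg_log_le_two_mul ?_ (h.logIncr_re_nonpos hat hΦ0 y)
      have h3 := norm_logIncr_le (x := (y : V)) hη2 hΦ hψ
      have h4 : 2 * η * (1 + ‖(y : V)‖) ≤ 2 * η * (1 + K) := by gcongr; linarith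
      exact (abs_le.1 ((Complex.abs_re_le_norm _).trans (h3.trans (h4.trans hη1)))).1
    have h3 := h.one_sub_norm_le_energyVar hat hts hC
      (hJ t s hts hsT (hstep _ hδ1 t s (hra.trans hat) le_rfl)) hyK
      (hnear a t hat htT (hstep _ hδ2 a t hra hts) y (by linarith)) hc
    rw [div_le_iff₀ (by positivity)]
    linarith
  have hsum : ∀ j, (L (b j) - 1 / (4 * n) * S) / (12 * C) / 2
      ≤ ∫ y, P.energyVar a t s y ∂(P.kernel r a ((⟨b j, hb j⟩ : E) : OnePoint E)) := fun j =>
    half_le_integral_of_le_on (fun y => P.energyVar_nonneg a t s y)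
      (h.integrable_energyVar hat hts _)
      (hnear r a hra (hat.trans htT) (hstep _ hδ2 r a le_rfl (hat.trans hts)) ⟨b j, hb j⟩
        (by have := hbK j; simp only; linarith)) (hpt j)
  have htot := Finset.sum_le_sum fun j (_ : j ∈ Finset.univ) => hsum j
  have hleft : ∑ j, (L (b j) - 1 / (4 * n) * S) / (12 * C) / 2 = S / (32 * C) := by
    rw [← Finset.sum_div, ← Finset.sum_div, Finset.sum_sub_distrib, ← hS, Finset.sum_const,
      Finset.card_univ, nsmul_eq_mul, ← hn]
    field_simp
    ring
  have hright : ∑ j, ∫ y, P.energyVar a t s y ∂(P.kernel r a ((⟨b j, hb j⟩ : E) : OnePoint E))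
      = P.meanEnergy (fun j => ((⟨b j, hb j⟩ : E) : OnePoint E)) r t s
        - P.meanEnergy (fun j => ((⟨b j, hb j⟩ : E) : OnePoint E)) r a s := by
    simp only [TransitionFunction.meanEnergy]
    rw [← Finset.sum_sub_distrib]
    exact Finset.sum_congr rfl fun j _ => (h.integral_energy_sub hra hat hts _).symm
  rw [hleft, hright, div_le_iff₀ (by positivity)] at htot
  linarith

end Energy

end AffineProcess

namespace AffineProcess

/-! ### The flow on the neutral space and its additivity. -/

section NeutralFlow

variable {V : Type*} [NormedAddCommGroup V] [InnerProductSpace ℝ V] [FiniteDimensional ℝ V]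

/-- The component of the imaginary part of `u` in the neutral space. -/
noncomputable def neutralPart (E : Set V) (u : V × V) : neutralSpace E :=
  (neutralSpace E).orthogonalProjectionOnto u.2

/-- The flow induced by `ψ` on the neutral space. -/
noncomputable def neutralFlow (E : Set V) (ψ : ℝ≥0 → ℝ≥0 → V × V → V × V) (r s : ℝ≥0)
    (c : neutralSpace E) : neutralSpace E :=
  neutralPart E (ψ r s (0, (c : V)))

variable {E : Set V}

lemma neutralPart_imag (c : neutralSpace E) : neutralPart E (0, (c : V)) = c :=
  Submodule.orthogonalProjectionOnto_mem_subspace_eq_self c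

lemma norm_neutralPart_le (u : V × V) : ‖neutralPart E u‖ ≤ ‖u‖ :=
  ((neutralSpace E).norm_orthogonalProjectionOnto_apply_le _).trans (norm_snd_le u)

lemma norm_imag (c : V) : ‖((0, c) : V × V)‖ = ‖c‖ := by
  rw [Prod.norm_mk, norm_zero, max_eq_right (norm_nonneg _)]

lemma neutralPart_sub (u v : V × V) : neutralPart E (u - v) = neutralPart E u - neutralPart E v :=
  map_sub _ _ _

lemma sub_mem_span_barrierCone_iff {v w : V} :
    v - w ∈ Submodule.span ℝ (barrierCone E) ↔
      (neutralSpace E).orthogonalProjectionOnto v = (neutralSpace E).orthogonalProjectionOnto w := by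
  rw [← sub_eq_zero, ← map_sub, Submodule.orthogonalProjectionOnto_eq_zero_iff, neutralSpace,
    Submodule.orthogonal_orthogonal]

lemma neutralPart_sub_mem (u : V × V) :
    ((neutralPart E u : neutralSpace E) : V) - u.2 ∈ Submodule.span ℝ (barrierCone E) := by
  rw [sub_mem_span_barrierCone_iff]
  exact Submodule.orthogonalProjectionOnto_mem_subspace_eq_self _

variable [MeasurableSpace V] [BorelSpace V] {P : TransitionFunction E}
  {Φ : ℝ≥0 → ℝ≥0 → V × V → ℂ} {ψ : ℝ≥0 → ℝ≥0 → V × V → V × V} {ι : Type*}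

lemma ne_zero_of_norm_sub_one_le {z : ℂ} {η : ℝ} (hη : η < 1) (hz : ‖z - 1‖ ≤ η) : z ≠ 0 := by
  rintro rfl
  rw [zero_sub, norm_neg, norm_one] at hz
  linarith

/-- In short time the neutral component of `ψ` depends only on the neutral component of the
argument. -/
lemma IsAffineData.exists_neutralPart_psi_eq (h : IsAffineData P Φ ψ) [Nonempty ι]
    (b : AffineBasis ι ℝ V) (hb : range b ⊆ E) (k : ℕ) (R : ℝ) (T : ℝ≥0) :
    ∃ δ : ℝ≥0, 0 < δ ∧ ∀ r s u, r ≤ s → s ≤ T → s ≤ r + δ → u ∈ expBoundedBy E k → ‖u‖ ≤ R →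
      neutralPart E (ψ r s u) = neutralFlow E ψ r s (neutralPart E u) := by
  have hE : E.Nonempty := ⟨_, hb (mem_range_self (Classical.arbitrary ι))⟩
  obtain ⟨δ, hδ, hsmall⟩ := h.exists_small_time hE (2 * max k 1) (R + 1) T one_half_pos
  refine ⟨δ, hδ, fun r s u hrs hsT hsr hu huR => ?_⟩
  have h1 : ∀ w ∈ neutralSpace E, inner ℝ (ψ r s u).2 w
      = inner ℝ (ψ r s (0, (neutralPart E u : V))).2 w := fun w hw =>
    h.inner_psi_snd_eq b hb hrs (k := max k 1) (l := 2 * max k 1) (R := R)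
      (fun u hu huR v hv => ne_zero_of_norm_sub_one_le one_half_lt_one
        (hsmall v s u hv.2 hsT (hsr.trans (by gcongr; exact hv.1)) hu huR).1)
      (le_max_right _ _) le_rfl (expBoundedBy_mono (le_max_left _ _) hu)
      (imag_mem_expBoundedBy _ (le_max_right _ _)) huR
      (by rw [norm_imag]; exact (norm_neutralPart_le u).trans huR) (neutralPart_sub_mem u) hw
  rw [neutralFlow, ← sub_eq_zero, ← neutralPart_sub, neutralPart,
    Submodule.orthogonalProjectionOnto_eq_zero_iff, Submodule.mem_orthogonal']
  intro w hw
  rw [Prod.snd_sub, inner_sub_left, h1 w hw, sub_self]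

lemma IsAffineData.exists_norm_neutralFlow_le (h : IsAffineData P Φ ψ) (hE : E.Nonempty) (R : ℝ)
    (T : ℝ≥0) :
    ∃ δ : ℝ≥0, 0 < δ ∧ ∀ r s, r ≤ s → s ≤ T → s ≤ r + δ → ∀ c : neutralSpace E, ‖c‖ ≤ R →
      ‖neutralFlow E ψ r s c‖ ≤ R + 1 := by
  obtain ⟨δ, hδ, hsmall⟩ := h.exists_small_time hE 1 R T one_pos
  refine ⟨δ, hδ, fun r s hrs hsT hsr c hc => (norm_neutralPart_le _).trans ?_⟩
  have h1 := (hsmall r s (0, (c : V)) hrs hsT hsr (imag_mem_expBoundedBy _ le_rfl)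
    (by rw [norm_imag]; exact hc)).2
  have h2 := norm_le_insert' (ψ r s (0, (c : V))) (0, (c : V))
  rw [norm_imag] at h2
  have hc' : ‖(c : V)‖ ≤ R := hc
  linarith

/-- The semiflow property of the neutral flow. -/
lemma IsAffineData.exists_neutralFlow_comp (h : IsAffineData P Φ ψ) [Nonempty ι]
    (b : AffineBasis ι ℝ V) (hb : range b ⊆ E) (R : ℝ) (T : ℝ≥0) :
    ∃ δ : ℝ≥0, 0 < δ ∧ ∀ r w s, r ≤ w → w ≤ s → s ≤ T → s ≤ r + δ →
      ∀ c : neutralSpace E, ‖c‖ ≤ R →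
        neutralFlow E ψ r s c = neutralFlow E ψ r w (neutralFlow E ψ w s c) := by
  have hE : E.Nonempty := ⟨_, hb (mem_range_self (Classical.arbitrary ι))⟩
  obtain ⟨δ₁, hδ₁, hsmall⟩ := h.exists_small_time hE 1 R T one_half_pos
  obtain ⟨δ₂, hδ₂, haut⟩ := h.exists_neutralPart_psi_eq b hb 2 (R + 1) T
  refine ⟨min δ₁ δ₂, lt_min hδ₁ hδ₂, fun r w s hrw hws hsT hsr c hc => ?_⟩
  have hmem : ((0, (c : V)) : V × V) ∈ expBoundedBy E 1 := imag_mem_expBoundedBy _ le_rfl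
  have hs : ∀ v, r ≤ v → v ≤ s → ‖Φ v s (0, (c : V)) - 1‖ ≤ 1 / 2 ∧
      ‖ψ v s (0, (c : V)) - (0, (c : V))‖ ≤ 1 / 2 := fun v hrv hvs =>
    hsmall v s _ hvs hsT (hsr.trans (add_le_add hrv (min_le_left _ _))) hmem
      (by rw [norm_imag]; exact hc)
  have hne : ∀ v, r ≤ v → v ≤ s → Φ v s (0, (c : V)) ≠ 0 := fun v hrv hvs =>
    ne_zero_of_norm_sub_one_le one_half_lt_one (hs v hrv hvs).1
  have hpsi := h.psi_cocycle b hb hrw hws (expBoundedBy_subset 1 hmem)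
    fun v hv => hne v hv.1 hv.2
  rw [neutralFlow, ← hpsi]
  -- |Φ_{w,s}| ≥ 1/2 puts ψ_{w,s}(ic) into 𝒰_2, and its norm is at most R + 1; these are the
  -- parameters chosen for `haut`.
  refine haut r w _ hrw (hws.trans hsT)
    (hws.trans (hsr.trans (by gcongr; exact min_le_right _ _))) ?_ ?_
  · refine h.affine.psi_mem hws hmem ?_ (hne w hrw hws)
    have h1 := (hs w hrw hws).1
    have h2 := norm_sub_norm_le (1 : ℂ) (1 - Φ w s (0, (c : V)))
    rw [sub_sub_cancel, norm_one, norm_sub_rev] at h2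
    push_cast
    linarith
  · have h1 := (hs w hrw hws).2
    have h2 := norm_le_insert' (ψ w s (0, (c : V))) (0, (c : V))
    rw [norm_imag] at h2
    have hc' : ‖(c : V)‖ ≤ R := hc
    linarith

variable [Fintype ι]

/-- The defect of additivity of the neutral flow is small compared to the loss of modulus. -/
lemma IsAffineData.norm_neutralFlow_defect_le (h : IsAffineData P Φ ψ) (b : AffineBasis ι ℝ V)
    (hb : ∀ j, b j ∈ E) {η : ℝ} {F : Finset E}
    (hF : ∀ (α : ℝ) (β : V), (∀ j, 0 ≤ α + inner ℝ β (b j)) →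
      (∀ x ∈ F, 0 ≤ α + inner ℝ β (x : V)) →
      ‖(neutralSpace E).starProjection β‖ ≤ η * ∑ j, (α + inner ℝ β (b j)))
    {a t : ℝ≥0} (hat : a ≤ t) {c₁ c₂ : neutralSpace E}
    (hΦ : ∀ c ∈ ({c₁, c₂, c₁ + c₂} : Set (neutralSpace E)), Φ a t (0, (c : V)) ≠ 0)
    (hlb : ∀ c ∈ ({c₁, c₂, c₁ + c₂} : Set (neutralSpace E)), ∀ j,
      ‖logIncr Φ ψ a t (c : V) (b j)‖ ≤ 1 / 2)
    (hlF : ∀ c ∈ ({c₁, c₂, c₁ + c₂} : Set (neutralSpace E)), ∀ x ∈ F,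
      ‖logIncr Φ ψ a t (c : V) (x : V)‖ ≤ 1 / 2) :
    ‖neutralFlow E ψ a t (c₁ + c₂) - neutralFlow E ψ a t c₁ - neutralFlow E ψ a t c₂‖
      ≤ η * (Real.pi * (∑ j, -(logIncr Φ ψ a t (c₁ : V) (b j)).re
        + ∑ j, -(logIncr Φ ψ a t (c₂ : V) (b j)).re)) := by
  have := P.isMarkovKernel a t hat
  have m₁ : c₁ ∈ ({c₁, c₂, c₁ + c₂} : Set (neutralSpace E)) := by simp
  have m₂ : c₂ ∈ ({c₁, c₂, c₁ + c₂} : Set (neutralSpace E)) := by simp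
  have m₀ : c₁ + c₂ ∈ ({c₁, c₂, c₁ + c₂} : Set (neutralSpace E)) := by simp
  set l₀ := logIncr Φ ψ a t ((c₁ + c₂ : neutralSpace E) : V) with hl₀
  set l₁ := logIncr Φ ψ a t (c₁ : V) with hl₁
  set l₂ := logIncr Φ ψ a t (c₂ : V) with hl₂
  have hx : ∀ x : E, ‖l₀ x‖ ≤ 1 / 2 → ‖l₁ x‖ ≤ 1 / 2 → ‖l₂ x‖ ≤ 1 / 2 →
      |(l₀ x - l₁ x - l₂ x).im| ≤ Real.pi * (-(l₁ x).re + -(l₂ x).re) := by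
    intro x h0 h1 h2
    refine abs_im_log_defect_le (P.kernel a t x) (c₁ := c₁) (c₂ := c₂)
      (a₁ := inner ℝ (c₁ : V) (x : V)) (a₂ := inner ℝ (c₂ : V) (x : V))
      (h.expTransform_eq_exp_logIncr hat (hΦ _ m₁) x)
      (h.expTransform_eq_exp_logIncr hat (hΦ _ m₂) x) ?_ h0 h1 h2
    have := h.expTransform_eq_exp_logIncr hat (hΦ _ m₀) x
    rw [Submodule.coe_add, inner_add_left, Complex.ofReal_add] at this
    exact this
  set δψ := ψ a t (0, ((c₁ + c₂ : neutralSpace E) : V)) - ψ a t (0, (c₁ : V)) - ψ a t (0, (c₂ : V))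
    with hδψ
  obtain ⟨αΛ, hΛ⟩ : ∃ αΛ : ℝ, ∀ x : V, (l₀ x - l₁ x - l₂ x).im = αΛ + inner ℝ δψ.2 x := by
    refine ⟨(Complex.log (Φ a t (0, ((c₁ + c₂ : neutralSpace E) : V)))).im
      - (Complex.log (Φ a t (0, (c₁ : V)))).im - (Complex.log (Φ a t (0, (c₂ : V)))).im,
      fun x => ?_⟩
    simp only [hl₀, hl₁, hl₂, logIncr, hδψ, Complex.sub_im, Complex.add_im, pairing_im,
      Prod.snd_sub, inner_sub_left, Submodule.coe_add, inner_add_left]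
    ring
  obtain ⟨αl, βl, hl⟩ : ∃ (αl : ℝ) (βl : V), ∀ x : V,
      Real.pi * (-(l₁ x).re + -(l₂ x).re) = αl + inner ℝ βl x := by
    refine ⟨Real.pi * (-(Complex.log (Φ a t (0, (c₁ : V)))).re
      + -(Complex.log (Φ a t (0, (c₂ : V)))).re),
      Real.pi • (-(ψ a t (0, (c₁ : V))).1 + -(ψ a t (0, (c₂ : V))).1), fun x => ?_⟩
    rw [hl₁, hl₂, neg_logIncr_re_eq, neg_logIncr_re_eq, real_inner_smul_left, inner_add_left]
    ring
  -- π times the loss dominates the phase defect in absolute value, so loss plus defect and loss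
  -- minus defect are both nonnegative at the test points. Half the difference of their slopes is
  -- the defect of ψ, and their values add up to twice π times the loss.
  have hpos : ∀ x : E, ‖l₀ x‖ ≤ 1 / 2 → ‖l₁ x‖ ≤ 1 / 2 → ‖l₂ x‖ ≤ 1 / 2 →
      0 ≤ (αl + αΛ) + inner ℝ (βl + δψ.2) (x : V) ∧
        0 ≤ (αl - αΛ) + inner ℝ (βl - δψ.2) (x : V) := by
    intro x h0 h1 h2
    have h3 := hx x h0 h1 h2
    rw [hΛ, hl, abs_le] at h3
    rw [inner_add_left, inner_sub_left]
    constructor <;> linarith [h3.1, h3.2]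
  have hposb := fun j => hpos ⟨b j, hb j⟩ (hlb _ m₀ j) (hlb _ m₁ j) (hlb _ m₂ j)
  have hposF := fun x hxF => hpos x (hlF _ m₀ x hxF) (hlF _ m₁ x hxF) (hlF _ m₂ x hxF)
  have h1 := hF _ _ (fun j => (hposb j).1) fun x hxF => (hposF x hxF).1
  have h2 := hF _ _ (fun j => (hposb j).2) fun x hxF => (hposF x hxF).2
  have h3 : neutralFlow E ψ a t (c₁ + c₂) - neutralFlow E ψ a t c₁ - neutralFlow E ψ a t c₂
      = neutralPart E δψ := by
    rw [hδψ, neutralPart_sub, neutralPart_sub]; rfl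
  have h4 : ‖neutralPart E δψ‖ = ‖(neutralSpace E).starProjection δψ.2‖ := by
    rw [Submodule.starProjection_apply]; rfl
  have h5 : ‖(2 : ℝ) • (neutralSpace E).starProjection δψ.2‖
      ≤ η * ∑ j, ((αl + αΛ) + inner ℝ (βl + δψ.2) (b j))
        + η * ∑ j, ((αl - αΛ) + inner ℝ (βl - δψ.2) (b j)) := by
    have : (2 : ℝ) • (neutralSpace E).starProjection δψ.2
        = (neutralSpace E).starProjection (βl + δψ.2)
          - (neutralSpace E).starProjection (βl - δψ.2) := by
      rw [← map_sub, ← map_smul]; congr 1; rw [two_smul]; abel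
    rw [this]
    exact (norm_sub_le _ _).trans (add_le_add h1 h2)
  have h6 : ∑ j, ((αl + αΛ) + inner ℝ (βl + δψ.2) (b j))
      + ∑ j, ((αl - αΛ) + inner ℝ (βl - δψ.2) (b j))
      = 2 * (Real.pi * (∑ j, -(l₁ (b j)).re + ∑ j, -(l₂ (b j)).re)) := by
    rw [← Finset.sum_add_distrib, ← Finset.sum_add_distrib, Finset.mul_sum, Finset.mul_sum]
    refine Finset.sum_congr rfl fun j _ => ?_
    rw [hl, inner_add_left, inner_sub_left]; ring
  rw [← mul_add, h6, norm_smul, Real.norm_eq_abs, abs_of_pos two_pos] at h5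
  rw [h3, h4]
  linarith

/-- In short time the neutral flow is additive on bounded sets. -/
lemma IsAffineData.exists_neutralFlow_add (h : IsAffineData P Φ ψ) [Nonempty ι]
    (b : AffineBasis ι ℝ V) (hb : range b ⊆ E) (R : ℝ) (T : ℝ≥0) :
    ∃ δ : ℝ≥0, 0 < δ ∧ ∀ r s, r ≤ s → s ≤ T → s ≤ r + δ → ∀ c₁ c₂ : neutralSpace E,
      ‖c₁‖ ≤ R → ‖c₂‖ ≤ R → ‖c₁ + c₂‖ ≤ R →
        neutralFlow E ψ r s (c₁ + c₂) = neutralFlow E ψ r s c₁ + neutralFlow E ψ r s c₂ := by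
  have hbE : ∀ j, b j ∈ E := fun j => hb (mem_range_self j)
  have hE : E.Nonempty := ⟨_, hbE (Classical.arbitrary ι)⟩
  set ρ := max R 1 with hρ
  have hρ0 : 0 < ρ := lt_max_of_lt_right one_pos
  set M := ρ + 1 with hM
  have hM0 : 0 < M := by positivity
  set xb : ι → OnePoint E := fun j => ((⟨b j, hbE j⟩ : E) : OnePoint E) with hxb
  obtain ⟨C, hC, δ₁, hδ₁, hloss⟩ := h.exists_sum_loss_le b hbE hM0.le T
  obtain ⟨δ₂, hδ₂, hcomp⟩ := h.exists_neutralFlow_comp b hb ρ T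
  obtain ⟨δ₃, hδ₃, hbd⟩ := h.exists_norm_neutralFlow_le hE ρ T
  obtain ⟨δ₄, hδ₄, hbdM⟩ := h.exists_norm_neutralFlow_le hE M T
  set δ := min (min δ₁ δ₂) (min δ₃ δ₄) with hδdef
  have hδ1 : δ ≤ δ₁ := (min_le_left _ _).trans (min_le_left _ _)
  have hδ2 : δ ≤ δ₂ := (min_le_left _ _).trans (min_le_right _ _)
  have hδ3 : δ ≤ δ₃ := (min_le_right _ _).trans (min_le_left _ _)
  have hδ4 : δ ≤ δ₄ := (min_le_right _ _).trans (min_le_right _ _)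
  refine ⟨δ, lt_min (lt_min hδ₁ hδ₂) (lt_min hδ₃ hδ₄), fun r s hrs hsT hsr => ?_⟩
  set m := (testMeasure V).real univ with hm
  have hm0 : 0 ≤ m := measureReal_nonneg
  set D : ℝ := (9 * Module.finrank ℝ (neutralSpace E) + 1) * (Real.pi * (2 * C)) with hD
  have hpi := Real.pi_pos
  have hD0 : 0 < D := by positivity
  -- The time interval is fixed before ε; only the partition and the finite test set depend on ε.
  -- Approximation by linear maps to every accuracy then forces exact additivity.
  have key : ∀ ε : ℝ, 0 < ε → ε ≤ ρ / 2 → ∃ Q : neutralSpace E →L[ℝ] neutralSpace E,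
      ∀ c, ‖c‖ ≤ ρ → ‖neutralFlow E ψ r s c - Q c‖ ≤ 2 * M / ρ * ε := by
    intro ε hε hερ
    set n : ℝ := Fintype.card ι * m + 1 with hn
    have hn0 : 0 < n := by positivity
    -- n exceeds the total energy and D collects the stability constants, so the errors of all steps
    -- add up to at most Dηn = ε.
    set η := ε / (D * n) with hη
    have hη0 : 0 < η := by positivity
    obtain ⟨F, hF⟩ := exists_finset_norm_slope_le (E := E) b hη0
    obtain ⟨K, hKF, hKb⟩ : ∃ K : ℝ, (∀ x ∈ F, ‖(x : V)‖ ≤ K) ∧ ∀ j, ‖b j‖ ≤ K := by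
      refine ⟨∑ x ∈ F, ‖(x : V)‖ + ∑ j, ‖b j‖, fun x hx => ?_, fun j => ?_⟩
      · have := Finset.single_le_sum (f := fun x : E => ‖(x : V)‖) (fun x _ => norm_nonneg _) hx
        have h2 : 0 ≤ ∑ j, ‖b j‖ := Finset.sum_nonneg fun j _ => norm_nonneg _
        linarith
      · have := Finset.single_le_sum (f := fun j => ‖b j‖) (fun j _ => norm_nonneg _)
          (Finset.mem_univ j)
        have h2 : 0 ≤ ∑ x ∈ F, ‖(x : V)‖ := Finset.sum_nonneg fun j _ => norm_nonneg _
        linarith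
    have hK0 : 0 ≤ K := (norm_nonneg _).trans (hKb (Classical.arbitrary ι))
    set ζ : ℝ := 1 / (4 * (1 + K)) with hζ
    have hζ0 : 0 < ζ := by positivity
    have hζ1 : 2 * ζ * (1 + K) ≤ 1 / 2 := by rw [hζ]; field_simp; norm_num
    have hζ2 : ζ ≤ 1 / 2 := by nlinarith
    obtain ⟨δ₅, hδ₅, hsmall⟩ := h.exists_small_time hE 1 M T hζ0
    obtain ⟨N, hN⟩ := exists_nat_gt ((s - r) / δ₅)
    have hN0 : (0 : ℝ≥0) < N := zero_le.trans_lt hN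
    set τ : ℕ → ℝ≥0 := fun i => r + (s - r) * (i / N) with hτ
    have hτ0 : τ 0 = r := by simp [hτ]
    have hτN : τ N = s := by
      simp only [hτ]; rw [div_self hN0.ne', mul_one, add_tsub_cancel_of_le hrs]
    have hτmono : Monotone τ := fun i j hij => by
      simp only [hτ]; gcongr
    have hrτ : ∀ i, r ≤ τ i := fun i => le_self_add
    have hτs : ∀ i ≤ N, τ i ≤ s := fun i hi => (hτmono hi).trans_eq hτN
    have hτstep : ∀ i, τ (i + 1) ≤ τ i + δ₅ := fun i => by
      simp only [hτ]
      rw [add_assoc]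
      gcongr
      have : (s - r) * (((i + 1 : ℕ) : ℝ≥0) / N) = (s - r) * (i / N) + (s - r) / N := by
        push_cast; rw [add_div, mul_add]; congr 1; rw [mul_one_div]
      rw [this]
      gcongr
      rw [div_le_iff₀ hN0]
      rw [div_lt_iff₀ hδ₅] at hN
      rw [mul_comm]; exact hN.le
    have hτδ : ∀ i j, j ≤ N → τ j ≤ τ i + δ := fun i j hj =>
      (hτs j hj).trans (hsr.trans (by gcongr; exact hrτ i))
    set W : ℕ → ℝ := fun i => P.meanEnergy xb r (τ i) s with hW
    -- The error of a step is proportional to its energy increment, so refining the partition does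
    -- not enlarge the sum. The value 0 beyond N is a default that keeps e nonnegative.
    set e : ℕ → ℝ := fun i => if i < N then D * η * (W (i + 1) - W i) else 0 with he
    have hWmono : ∀ i, i < N → 0 ≤ W (i + 1) - W i := fun i hi => sub_nonneg.2
      (h.meanEnergy_mono xb (hrτ i) (hτmono i.le_succ) (hτs _ hi))
    have he0 : ∀ i, 0 ≤ e i := fun i => by
      simp only [he]
      split_ifs with hi
      · exact mul_nonneg (by positivity) (hWmono i hi)
      · exact le_rfl
    have hesum : ∑ i ∈ Finset.range N, e i ≤ ε := by
      have h1 : ∑ i ∈ Finset.range N, e i = D * η * (W N - W 0) := by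
        rw [← Finset.sum_range_sub, Finset.mul_sum]
        exact Finset.sum_congr rfl fun i hi => if_pos (Finset.mem_range.1 hi)
      have h2 : W N ≤ n := by
        have := h.meanEnergy_le xb (r := r) (w := τ N) (s := s) (hrτ N) (hτs N le_rfl)
        simp only [hW]; linarith
      have h3 : 0 ≤ W 0 := P.meanEnergy_nonneg xb _ _ _
      have h4 : D * η * n = ε := by rw [hη]; field_simp
      rw [h1]
      have : D * η * (W N - W 0) ≤ D * η * n := mul_le_mul_of_nonneg_left (by linarith) (by positivity)
      linarith
    have hlin : ∀ i, i < N → ∃ A : neutralSpace E →L[ℝ] neutralSpace E, ∀ c, ‖c‖ ≤ M →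
        ‖neutralFlow E ψ (τ i) (τ (i + 1)) c - A c‖ ≤ e i := by
      intro i hi
      have hii := hτmono i.le_succ
      have hiT : τ (i + 1) ≤ T := (hτs _ hi).trans hsT
      have hsm : ∀ c : neutralSpace E, ‖c‖ ≤ M → ‖Φ (τ i) (τ (i + 1)) (0, (c : V)) - 1‖ ≤ ζ ∧
          ‖ψ (τ i) (τ (i + 1)) (0, (c : V)) - (0, (c : V))‖ ≤ ζ := fun c hc =>
        hsmall _ _ _ hii hiT (hτstep i) (imag_mem_expBoundedBy _ le_rfl)
          (by rw [norm_imag]; exact hc)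
      have hlog : ∀ c : neutralSpace E, ‖c‖ ≤ M → ∀ x : V, ‖x‖ ≤ K →
          ‖logIncr Φ ψ (τ i) (τ (i + 1)) (c : V) x‖ ≤ 1 / 2 := fun c hc x hx =>
        (norm_logIncr_le hζ2 (hsm c hc).1 (hsm c hc).2).trans
          (le_trans (by gcongr) hζ1)
      have hls : ∀ c : neutralSpace E, ‖c‖ ≤ M →
          ∑ j, -(logIncr Φ ψ (τ i) (τ (i + 1)) (c : V) (b j)).re ≤ C * (W (i + 1) - W i) :=
        fun c hc => hloss r (τ i) (τ (i + 1)) s (hrτ i) hii (hτs _ hi) hsT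
          (hsr.trans (by gcongr)) c hc
      obtain ⟨A, hA⟩ := exists_linear_of_approx_additive
        (g := neutralFlow E ψ (τ i) (τ (i + 1))) (R := M) (M := M + 1)
        (e := η * (Real.pi * (2 * C * (W (i + 1) - W i)))) hM0
        (fun c hc => hbdM _ _ hii hiT ((hτδ i (i + 1) hi).trans (by gcongr)) c hc)
        (fun c₁ c₂ h₁ h₂ h₁₂ => by
          have hall : ∀ c ∈ ({c₁, c₂, c₁ + c₂} : Set (neutralSpace E)), ‖c‖ ≤ M := by
            rintro c (rfl | rfl | rfl) <;> assumption
          refine (h.norm_neutralFlow_defect_le b hbE hF hii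
            (fun c hc => ne_zero_of_norm_sub_one_le (by linarith) (hsm c (hall c hc)).1)
            (fun c hc j => hlog c (hall c hc) _ (hKb j))
            (fun c hc x hx => hlog c (hall c hc) _ (hKF x hx))).trans ?_
          have := hls c₁ h₁
          have := hls c₂ h₂
          gcongr
          linarith)
      refine ⟨A, fun c hc => (hA c hc).trans_eq ?_⟩
      simp only [he, if_pos hi, hD]
      ring
    choose! A hA using hlin
    refine ⟨leftProd A N, fun c hc => ?_⟩
    have hflow := norm_flow_sub_leftProd_le (A := A)
      (Y := fun i j c => neutralFlow E ψ (τ i) (τ j) c) (N := N) (e := e) hρ0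
      (by linarith : ρ ≤ M) (fun i _ c _ => by
        have : ψ (τ i) (τ i) (0, (c : V)) = (0, (c : V)) :=
          h.diag _ _ (imag_mem_expBounded _)
        simp only [neutralFlow, this, neutralPart_imag])
      (fun i j hij hj c hc => hbd _ _ (hτmono hij) ((hτs j hj).trans hsT)
        ((hτδ i j hj).trans (by gcongr)) c hc)
      (fun i j hij hj c hc => by
        have h1 := hcomp (τ i) (τ (i + 1)) (τ j) (hτmono i.le_succ) (hτmono hij)
          ((hτs j hj).trans hsT) ((hτδ i j hj).trans (by gcongr)) c hc
        rw [h1]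
        exact hA i (hij.trans_le hj) _ (hbd _ _ (hτmono hij) ((hτs j hj).trans hsT)
          ((hτδ (i + 1) j hj).trans (by gcongr)) c hc))
      he0 (hesum.trans hερ) hc
    simp only [hτ0, hτN] at hflow
    exact hflow.trans (by gcongr)
  intro c₁ c₂ h₁ h₂ h₁₂
  have hRρ : R ≤ ρ := le_max_left _ _
  rw [← sub_eq_zero, ← norm_le_zero_iff]
  refine le_of_forall_pos_le_add fun ε hε => ?_
  obtain ⟨Q, hQ⟩ := key (min (ρ / 2) (ε / (6 * M / ρ))) (by positivity) (min_le_left _ _)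
  have e1 := hQ _ (h₁.trans hRρ)
  have e2 := hQ _ (h₂.trans hRρ)
  have e0 := hQ _ (h₁₂.trans hRρ)
  have h3 : 2 * M / ρ * min (ρ / 2) (ε / (6 * M / ρ)) ≤ ε / 3 := by
    refine (mul_le_mul_of_nonneg_left (min_le_right _ _) (by positivity)).trans_eq ?_
    field_simp
    norm_num
  have h4 : neutralFlow E ψ r s (c₁ + c₂) - (neutralFlow E ψ r s c₁ + neutralFlow E ψ r s c₂)
      = (neutralFlow E ψ r s (c₁ + c₂) - Q (c₁ + c₂)) - (neutralFlow E ψ r s c₁ - Q c₁)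
        - (neutralFlow E ψ r s c₂ - Q c₂) := by
    rw [map_add]; abel
  rw [h4]
  have h5 := norm_sub_le ((neutralFlow E ψ r s (c₁ + c₂) - Q (c₁ + c₂))
    - (neutralFlow E ψ r s c₁ - Q c₁)) (neutralFlow E ψ r s c₂ - Q c₂)
  have h6 := norm_sub_le (neutralFlow E ψ r s (c₁ + c₂) - Q (c₁ + c₂))
    (neutralFlow E ψ r s c₁ - Q c₁)
  linarith

end NeutralFlow

end AffineProcess

namespace AffineProcess

/-! ### Bounded neutral components and removal of the zeros of Φ. -/

section Globalization

variable {V : Type*} [NormedAddCommGroup V] [InnerProductSpace ℝ V] [FiniteDimensional ℝ V]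
  {E : Set V} [MeasurableSpace V] [BorelSpace V] {P : TransitionFunction E}
  {Φ : ℝ≥0 → ℝ≥0 → V × V → ℂ} {ψ : ℝ≥0 → ℝ≥0 → V × V → V × V} {ι : Type*} [Fintype ι]

lemma map_nsmul_of_add_on_ball {W : Type*} [NormedAddCommGroup W] {g : W → W} {R : ℝ}
    (hR : 0 ≤ R) (hg : ∀ c₁ c₂, ‖c₁‖ ≤ R → ‖c₂‖ ≤ R → ‖c₁ + c₂‖ ≤ R → g (c₁ + c₂) = g c₁ + g c₂)
    {p : W} {m : ℕ} (hm : ∀ k ≤ m, ‖k • p‖ ≤ R) : g (m • p) = m • g p := by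
  have h00 : ‖(0 : W)‖ ≤ R := by simpa using hR
  have h0 : g 0 = 0 := by simpa using hg 0 0 h00 h00 (by simpa using hR)
  induction m with
  | zero => simpa using h0
  | succ m ih =>
    rw [succ_nsmul, succ_nsmul, ← ih fun k hk => hm k (by omega)]
    refine hg _ _ (hm m (by omega)) ?_ (by rw [← succ_nsmul]; exact hm _ le_rfl)
    simpa using hm 1 (by omega)

/-- As long as `Φ` does not vanish, the neutral component of `ψ` stays bounded. -/
lemma IsAffineData.exists_norm_neutralPart_psi_le (h : IsAffineData P Φ ψ) [Nonempty ι]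
    (b : AffineBasis ι ℝ V) (hb : range b ⊆ E) (T : ℝ≥0) :
    ∃ δ : ℝ≥0, 0 < δ ∧ ∀ t s, t ≤ s → s ≤ T → s ≤ t + δ → ∀ u ∈ expBounded E,
      (∀ r, t < r → r ≤ s → Φ r s u ≠ 0) →
      ∃ Q : ℝ, ∀ r, t < r → r ≤ s → ‖neutralPart E (ψ r s u)‖ ≤ Q := by
  obtain ⟨δ₁, hδ₁, hcomp⟩ := h.exists_neutralFlow_comp b hb 1 T
  have hE : E.Nonempty := ⟨_, hb (mem_range_self (Classical.arbitrary ι))⟩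
  obtain ⟨δ₂, hδ₂, hbd⟩ := h.exists_norm_neutralFlow_le hE 1 T
  refine ⟨min δ₁ δ₂, lt_min hδ₁ hδ₂, fun t s hts hsT hst u hu hne => ?_⟩
  have hdist : ∀ δ, min δ₁ δ₂ ≤ δ → ∀ r, t ≤ r → s ≤ r + δ := fun δ hδ r hr =>
    hst.trans (add_le_add hr hδ)
  set c := neutralPart E u with hc
  -- Dividing c by m puts it into the unit ball, where the flow is bounded by 2 up to and including
  -- time t. The resulting bound 2m depends on u only through c.
  obtain ⟨m, hm⟩ := exists_nat_ge (max ‖c‖ 1)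
  have hm1 : (1 : ℝ) ≤ m := (le_max_right _ _).trans hm
  have hm0 : (0 : ℝ) < m := one_pos.trans_le hm1
  set p₀ : neutralSpace E := (m : ℝ)⁻¹ • c with hp₀
  have hp₀1 : ‖p₀‖ ≤ 1 := by
    rw [hp₀, norm_smul, norm_inv, Real.norm_eq_abs, abs_of_pos hm0, inv_mul_le_iff₀ hm0, mul_one]
    exact (le_max_left _ _).trans hm
  have hmp₀ : m • p₀ = c := by
    rw [hp₀, ← Nat.cast_smul_eq_nsmul ℝ, smul_smul, mul_inv_cancel₀ hm0.ne', one_smul]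
  set p : ℝ≥0 → neutralSpace E := fun r => neutralFlow E ψ r s p₀ with hp
  suffices hmain : ∀ r, t < r → r ≤ s → neutralPart E (ψ r s u) = m • p r by
    refine ⟨m * 2, fun r htr hrs => ?_⟩
    rw [hmain r htr hrs, ← Nat.cast_smul_eq_nsmul ℝ, norm_smul, Real.norm_eq_abs, abs_of_pos hm0]
    have := hbd r s hrs hsT (hdist _ (min_le_right _ _) r htr.le) p₀ hp₀1
    have h2 : ‖p r‖ ≤ 2 := by simp only [hp]; linarith
    gcongr
  -- On [r₁, s] the values of ψ are bounded by some R that may blow up as r₁ ↓ t. It only determines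
  -- the step length δ for which additivity holds; the identity itself is propagated backwards from
  -- s by induction on the number of steps.
  intro r₁ htr₁ hr₁s
  have hne' : ∀ v ∈ Icc r₁ s, Φ v s u ≠ 0 := fun v hv => hne v (htr₁.trans_le hv.1) hv.2
  obtain ⟨l, hl⟩ := h.exists_psi_mem_Icc hu hne'
  obtain ⟨R, hR⟩ := isCompact_Icc.exists_bound_of_continuousOn (h.continuousOn_left_psi hu hne')
  have hR0 : 0 ≤ R := (norm_nonneg _).trans (hR r₁ ⟨le_rfl, hr₁s⟩)
  obtain ⟨δ₃, hδ₃, haut⟩ := h.exists_neutralPart_psi_eq b hb l R T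
  obtain ⟨δ₄, hδ₄, hadd⟩ := h.exists_neutralFlow_add b hb R T
  set δ := min δ₃ δ₄ with hδ
  have hδ0 : 0 < δ := lt_min hδ₃ hδ₄
  have hind : ∀ n : ℕ, ∀ r ∈ Icc r₁ s, s ≤ r + n * δ → neutralPart E (ψ r s u) = m • p r := by
    intro n
    induction n with
    | zero =>
      intro r hr hs
      have hrs : r = s := le_antisymm hr.2 (by simpa using hs)
      subst hrs
      simp only [hp, neutralFlow]
      rw [h.diag _ _ hu, h.diag _ _ (imag_mem_expBounded _), neutralPart_imag, hmp₀]
    | succ n ih =>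
      intro r hr hs
      set v := min (r + δ) s with hv
      have hrv : r ≤ v := le_min le_self_add hr.2
      have hvs : v ≤ s := min_le_right _ _
      have hvr : v ≤ r + δ := min_le_left _ _
      have hvmem : v ∈ Icc r₁ s := ⟨hr.1.trans hrv, hvs⟩
      have hsv : s ≤ v + n * δ := by
        rcases le_total (r + δ) s with h1 | h1
        · rw [hv, min_eq_left h1]
          refine hs.trans_eq ?_
          push_cast; ring
        · rw [hv, min_eq_right h1]; exact le_self_add
      have hq := ih v hvmem hsv
      have hqR : ‖m • p v‖ ≤ R := by
        rw [← hq]; exact (norm_neutralPart_le _).trans (hR v hvmem)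
      have h1 := h.psi_cocycle b hb hrv hvs hu fun w hw => hne' w ⟨hr.1.trans hw.1, hw.2⟩
      rw [← h1, haut r v _ hrv (hvs.trans hsT) (hvr.trans (by gcongr; exact min_le_left _ _))
        (hl v hvmem) (hR v hvmem), hq,
        map_nsmul_of_add_on_ball hR0 (hadd r v hrv (hvs.trans hsT)
          (hvr.trans (by gcongr; exact min_le_right _ _))) (m := m) (p := p v) ?_]
      · congr 1
        exact (hcomp r v s hrv hvs hsT (hdist _ (min_le_left _ _) r (htr₁.le.trans hr.1)) p₀
          hp₀1).symm
      · intro k hk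
        refine le_trans ?_ hqR
        rw [← Nat.cast_smul_eq_nsmul ℝ, ← Nat.cast_smul_eq_nsmul ℝ m, norm_smul, norm_smul]
        gcongr
        simpa using hk
  obtain ⟨n, hn⟩ := exists_nat_ge (s / δ)
  refine hind n r₁ ⟨le_rfl, hr₁s⟩ ?_
  rw [div_le_iff₀ hδ0] at hn
  exact hn.trans le_add_self

/-- Two families of measures that evolve according to the transition function after time `t` and
agree on `f_u` whenever `Φ t s u ≠ 0` agree on all `f_u`. -/
lemma IsAffineData.integral_expFun_eq_of_nonvanishing (h : IsAffineData P Φ ψ) [Nonempty ι]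
    (b : AffineBasis ι ℝ V) (hb : range b ⊆ E) {t : ℝ≥0} {κ₁ κ₂ : ℝ≥0 → Measure (OnePoint E)}
    [∀ w, IsFiniteMeasure (κ₁ w)] [∀ w, IsFiniteMeasure (κ₂ w)]
    (h₁ : ∀ w s, t < w → w ≤ s → ∀ u ∈ expBounded E,
      ∫ y, expFun u y ∂(κ₁ s) = Φ w s u * ∫ y, expFun (ψ w s u) y ∂(κ₁ w))
    (h₂ : ∀ w s, t < w → w ≤ s → ∀ u ∈ expBounded E,
      ∫ y, expFun u y ∂(κ₂ s) = Φ w s u * ∫ y, expFun (ψ w s u) y ∂(κ₂ w))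
    (hbase : ∀ s, t < s → ∀ u ∈ expBounded E, Φ t s u ≠ 0 →
      ∫ y, expFun u y ∂(κ₁ s) = ∫ y, expFun u y ∂(κ₂ s))
    {s : ℝ≥0} (hts : t < s) {u : V × V} (hu : u ∈ expBounded E) :
    ∫ y, expFun u y ∂(κ₁ s) = ∫ y, expFun u y ∂(κ₂ s) := by
  have hE : E.Nonempty := ⟨_, hb (mem_range_self (Classical.arbitrary ι))⟩
  -- A zero of Φ strictly after t annihilates both sides.
  by_cases hz : ∃ r, t < r ∧ r ≤ s ∧ Φ r s u = 0
  · obtain ⟨r, htr, hrs, hr0⟩ := hz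
    rw [h₁ r s htr hrs u hu, h₂ r s htr hrs u hu, hr0, zero_mul, zero_mul]
  push Not at hz
  obtain ⟨δ, hδ, hQ⟩ := h.exists_norm_neutralPart_psi_le b hb s
  -- δ does not depend on the argument, so after moving from s to s' the neutral bound applies to
  -- ψ_{s',s}(u), however large it is.
  set s' := min s (t + δ) with hs'
  have hts' : t < s' := lt_min hts (lt_add_of_pos_right t hδ)
  have hs's : s' ≤ s := min_le_left _ _
  have hne : ∀ v w, t < v → v ≤ w → w ≤ s → Φ v w (ψ w s u) ≠ 0 := fun v w hv hvw hws =>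
    h.phi_cocycle_ne_zero hE hvw hws hu (hz v hv (hvw.trans hws))
  have hmem : ∀ w, t < w → w ≤ s → ψ w s u ∈ expBounded E := fun w hw hws =>
    h.affine.psi_mem_expBounded hws hu (hz w hw hws)
  obtain ⟨Q, hQ⟩ := hQ t s' hts'.le hs's (min_le_right _ _) (ψ s' s u) (hmem s' hts' hs's)
    fun r hr hrs => hne r s' hr hrs hs's
  -- Q is fixed first, and w is then taken so close to t that Φ_{t,w} has no zero in 𝒰_4 within norm
  -- Q + 1. This covers the neighbourhood of iq from which the transforms are continued to
  -- ψ_{w,s}(u).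
  obtain ⟨δ', hδ', hsmall⟩ := h.exists_small_time hE 4 (Q + 1) s one_half_pos
  set w := min s' (t + δ') with hw
  have htw : t < w := lt_min hts' (lt_add_of_pos_right t hδ')
  have hws' : w ≤ s' := min_le_left _ _
  have hws : w ≤ s := hws'.trans hs's
  rw [h₁ w s htw hws u hu, h₂ w s htw hws u hu]
  congr 1
  have hq := hQ w htw hws'
  rw [h.psi_cocycle b hb hws' hs's hu fun v hv => hz v (htw.trans_le hv.1) hv.2] at hq
  refine integral_expFun_eq_of_eqOn (κ₁ w) (κ₂ w) (q := (neutralPart E (ψ w s u) : V))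
    (R := Q + 1) (lt_of_le_of_lt hq (by linarith)) (fun v hv hvR => ?_) (hmem w htw hws)
    (neutralPart_sub_mem _)
  refine hbase w htw v (expBoundedBy_subset 4 hv) ?_
  exact ne_zero_of_norm_sub_one_le one_half_lt_one
    (hsmall t w v htw.le hws (min_le_right _ _) hv hvR).1

end Globalization

end AffineProcess

namespace AffineProcess

/-! ### Determination of laws by transforms, and the Markov property for laws on events. -/

section Composition

lemma integral_comp_measure {α β F : Type*} [MeasurableSpace α] [MeasurableSpace β]
    [NormedAddCommGroup F] [NormedSpace ℝ F] {μ : Measure α} [SFinite μ] {κ : Kernel α β}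
    [IsSFiniteKernel κ] {f : β → F} (hf : Integrable f (κ ∘ₘ μ)) :
    ∫ y, f y ∂(κ ∘ₘ μ) = ∫ x, ∫ y, f y ∂(κ x) ∂μ := by
  have h1 : Integrable (fun p : α × β => f p.2) (μ ⊗ₘ κ) :=
    (Measure.integrable_compProd_snd_iff hf.aestronglyMeasurable).2 hf
  rw [← Measure.integral_compProd h1, ← Measure.snd_compProd, Measure.snd,
    integral_map measurable_snd.aemeasurable]
  have := hf.aestronglyMeasurable
  rwa [← Measure.snd_compProd, Measure.snd] at this

end Composition

section Uniqueness

variable {V : Type*} [NormedAddCommGroup V] [InnerProductSpace ℝ V] [FiniteDimensional ℝ V]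
  [MeasurableSpace V] [BorelSpace V] {E : Set V}

/-- Finite measures on `E ∪ {∞}` are determined by their mass and their characteristic
functions. -/
lemma ext_of_integral_expFun (hE : IsClosed E) {κ₁ κ₂ : Measure (OnePoint E)}
    [IsFiniteMeasure κ₁] [IsFiniteMeasure κ₂] (hmass : κ₁ univ = κ₂ univ)
    (hchar : ∀ c : V, ∫ y, expFun (0, c) y ∂κ₁ = ∫ y, expFun (0, c) y ∂κ₂) : κ₁ = κ₂ := by
  set S : Set (OnePoint E) := range fun x : E => (x : OnePoint E) with hS
  have hSm : MeasurableSet S := by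
    change MeasurableSet ((fun x : E => (x : OnePoint E)) ⁻¹' S)
    rw [hS, preimage_range]; exact MeasurableSet.univ
  -- The value 0 at the cemetery is a default: every measure is restricted to S before being mapped
  -- to V.
  set g : OnePoint E → V := fun y => y.elim 0 fun x => (x : V) with hg
  have hgm : Measurable g := measurable_of_coe (by
    change Measurable fun x : E => (x : V)
    exact measurable_subtype_coe)
  have hcharg : ∀ (κ : Measure (OnePoint E)) [IsFiniteMeasure κ] (c : V),
      charFun ((κ.restrict S).map g) c = ∫ y, expFun (0, c) y ∂κ := by
    intro κ _ c
    have hm : AEStronglyMeasurable (fun x : V => Complex.exp ((inner ℝ x c : ℝ) * Complex.I))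
        ((κ.restrict S).map g) := by
      refine Continuous.aestronglyMeasurable ?_
      fun_prop
    rw [charFun_apply, integral_map hgm.aemeasurable hm, ← integral_indicator hSm]
    refine integral_congr_ae (ae_of_all _ fun y => ?_)
    induction y using OnePoint.rec with
    | infty =>
      have : (∞ : OnePoint E) ∉ S := by simp [hS]
      simp only [indicator_of_notMem this, expFun_infty]
    | coe x =>
      have : (x : OnePoint E) ∈ S := mem_range_self x
      simp only [indicator_of_mem this, expFun_coe]
      change Complex.exp ((inner ℝ (x : V) c : ℝ) * Complex.I) = _
      simp [pairing, real_inner_comm]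
  have hmap : (κ₁.restrict S).map g = (κ₂.restrict S).map g := by
    refine Measure.ext_of_charFun (funext fun c => ?_)
    rw [hcharg, hcharg, hchar]
  have hSeq : ∀ B : Set (OnePoint E), MeasurableSet B → κ₁ (B ∩ S) = κ₂ (B ∩ S) := by
    intro B hB
    set B' : Set V := Subtype.val '' ((fun x : E => (x : OnePoint E)) ⁻¹' B) with hB'
    have hB'm : MeasurableSet B' :=
      (MeasurableEmbedding.subtype_coe hE.measurableSet).measurableSet_image.2
        (measurable_coe_onePoint hB)
    have hpre : B ∩ S = g ⁻¹' B' ∩ S := by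
      ext y
      refine and_congr_left fun hy => ?_
      obtain ⟨x, rfl⟩ := hy
      change _ ↔ (x : V) ∈ B'
      rw [hB', Subtype.val_injective.mem_set_image]
      rfl
    have h1 := congrArg (fun m => m B') hmap
    simp only [Measure.map_apply hgm hB'm, Measure.restrict_apply (hgm hB'm)] at h1
    rwa [hpre]
  have hcompl : Sᶜ = {(∞ : OnePoint E)} := by
    rw [hS, OnePoint.compl_range_coe]
  have hinf : κ₁ Sᶜ = κ₂ Sᶜ := by
    have h1 := hSeq univ MeasurableSet.univ
    rw [univ_inter] at h1
    rw [measure_compl hSm (measure_ne_top _ _), measure_compl hSm (measure_ne_top _ _), h1, hmass]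
  ext B hB
  rw [← measure_inter_add_sdiff B hSm, ← measure_inter_add_sdiff (μ := κ₂) B hSm, hSeq B hB]
  congr 1
  rw [sdiff_eq]
  by_cases hB' : (∞ : OnePoint E) ∈ B
  · have : B ∩ Sᶜ = Sᶜ := inter_eq_right.2 (by rw [hcompl]; exact singleton_subset_iff.2 hB')
    rw [this, hinf]
  · have : B ∩ Sᶜ = ∅ := by
      rw [hcompl]; exact inter_singleton_eq_empty.2 hB'
    rw [this, measure_empty, measure_empty]

end Uniqueness

section Markov

variable {E : Type*} [MeasurableSpace E] {Ω : Type*} {mΩ : MeasurableSpace Ω}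
  {X : ℝ≥0 → Ω → OnePoint E} {ℱ : Filtration ℝ≥0 mΩ} {μ : Measure Ω} {P : TransitionFunction E}

lemma IsMarkovProcess.measurable (hM : IsMarkovProcess X ℱ μ P) (t : ℝ≥0) : Measurable (X t) :=
  (hM.adapted t).mono (ℱ.le t) le_rfl

/-- The Markov property for the law of `X` under the restriction of `μ` to an event. -/
lemma IsMarkovProcess.map_restrict_eq (hM : IsMarkovProcess X ℱ μ P) {s t : ℝ≥0} (hst : s ≤ t)
    {A B : Set Ω} (hB : MeasurableSet[ℱ s] B) (hAB : A =ᵐ[μ] B) :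
    (μ.restrict A).map (X t) = (P.kernel s t) ∘ₘ ((μ.restrict A).map (X s)) := by
  have := hM.isProbabilityMeasure
  have := P.isMarkovKernel s t hst
  rw [Measure.restrict_congr_set hAB]
  rcases hst.eq_or_lt with rfl | hlt
  · rw [P.refl, Measure.id_comp]
  ext C hC
  rw [Measure.map_apply (hM.measurable t) hC, Measure.bind_apply hC (Kernel.aemeasurable _),
    lintegral_map ((P.kernel s t).measurable_coe hC) (hM.measurable s)]
  have hind : Measurable (C.indicator fun _ => (1 : ℝ)) := measurable_const.indicator hC
  have h1 := hM.markov s t hlt (C.indicator fun _ => 1) hind ⟨1, fun y => by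
    by_cases hy : y ∈ C <;> simp [hy]⟩
  have hint : Integrable (fun ω => C.indicator (fun _ => (1 : ℝ)) (X t ω)) μ :=
    Integrable.of_bound (hind.comp (hM.measurable t)).aestronglyMeasurable 1
      (ae_of_all _ fun ω => by by_cases hy : X t ω ∈ C <;> simp [hy])
  have h2 := setIntegral_condExp (ℱ.le s) hint hB
  rw [setIntegral_congr_ae (ℱ.le s _ hB) (h1.mono fun ω hω _ => hω)] at h2
  have h3 : ∀ ω, ∫ y, C.indicator (fun _ => (1 : ℝ)) y ∂(P.kernel s t (X s ω))
      = (P.kernel s t (X s ω) C).toReal := fun ω => by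
    rw [integral_indicator hC]; simp [Measure.real]
  have h4 : ∫ ω in B, C.indicator (fun _ => (1 : ℝ)) (X t ω) ∂μ
      = ((μ.restrict B) (X t ⁻¹' C)).toReal := by
    have : (fun ω => C.indicator (fun _ => (1 : ℝ)) (X t ω))
        = (X t ⁻¹' C).indicator fun _ => (1 : ℝ) := rfl
    rw [this, integral_indicator (hM.measurable t hC)]; simp [Measure.real]
  simp only [h3] at h2
  have h5 := integral_toReal (μ := μ.restrict B) (f := fun ω => P.kernel s t (X s ω) C)
    (((P.kernel s t).measurable_coe hC).comp (hM.measurable s)).aemeasurable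
    (ae_of_all _ fun ω => measure_lt_top _ _)
  rw [h4, h5] at h2
  refine ((ENNReal.toReal_eq_toReal_iff' ?_ (measure_ne_top _ _)).1 h2).symm
  refine ne_top_of_le_ne_top (measure_ne_top (μ.restrict B) univ) ?_
  calc ∫⁻ ω in B, P.kernel s t (X s ω) C ∂μ ≤ ∫⁻ _ in B, 1 ∂μ :=
        lintegral_mono fun ω => prob_le_one
    _ = _ := by simp

/-- The joint law of a Markov process at two times. -/
lemma IsMarkovProcess.map_prod_eq (hM : IsMarkovProcess X ℱ μ P) {s t : ℝ≥0} (hst : s ≤ t) :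
    μ.map (fun ω => (X s ω, X t ω)) = (μ.map (X s)) ⊗ₘ (P.kernel s t) := by
  have := hM.isProbabilityMeasure
  have := P.isMarkovKernel s t hst
  refine Measure.ext_prod fun {B C} hB hC => ?_
  rw [Measure.compProd_apply_prod hB hC, Measure.map_apply
    ((hM.measurable s).prodMk (hM.measurable t)) (hB.prod hC), setLIntegral_map hB
    ((P.kernel s t).measurable_coe hC) (hM.measurable s)]
  have h1 := congrArg (fun m => m C)
    (hM.map_restrict_eq hst (A := X s ⁻¹' B) (hM.adapted s hB) (EventuallyEq.refl _ _))
  rw [Measure.map_apply (hM.measurable t) hC, Measure.bind_apply hC (Kernel.aemeasurable _),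
    lintegral_map ((P.kernel s t).measurable_coe hC) (hM.measurable s),
    Measure.restrict_apply (hM.measurable t hC)] at h1
  rw [← h1, mk_preimage_prod, inter_comm]

/-- The events that belong to the completion of `ℱ s` for every `s > t`. -/
def IsGermEvent (ℱ : Filtration ℝ≥0 mΩ) (μ : Measure Ω) (t : ℝ≥0) (A : Set Ω) : Prop :=
  ∀ s, t < s → ∃ B, MeasurableSet[ℱ s] B ∧ A =ᵐ[μ] B

end Markov

/-! ### Right-continuity of conditional second moments. -/

section Continuity

variable {V : Type*} [NormedAddCommGroup V] [InnerProductSpace ℝ V] [FiniteDimensional ℝ V]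
  [MeasurableSpace V] [BorelSpace V] {E : Set V} {P : TransitionFunction E}
  {Φ : ℝ≥0 → ℝ≥0 → V × V → ℂ} {ψ : ℝ≥0 → ℝ≥0 → V × V → V × V}

/-- The squared modulus of an exponential is again one, with doubled real exponent; second moments
thus become transforms to which the affine formula applies. -/
lemma norm_expFun_sq (u : V × V) (y : OnePoint E) :
    ‖expFun u y‖ ^ 2 = (expFun ((2 : ℝ) • u.1, 0) y).re := by
  induction y using OnePoint.rec with
  | infty => simp [expFun_infty]
  | coe x =>
    rw [expFun_coe, expFun_coe, norm_exp_pairing, ← Real.exp_nat_mul]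
    have : pairing ((2 : ℝ) • u.1, 0) (x : V) = ((2 * inner ℝ u.1 (x : V) : ℝ) : ℂ) := by
      simp [pairing, real_inner_smul_left]
    rw [this, ← Complex.ofReal_exp, Complex.ofReal_re]
    norm_num

/-- The conditional second moments are right-continuous as long as `Φ` does not vanish. -/
lemma IsAffineData.tendsto_integral_norm_expTransform_sq (h : IsAffineData P Φ ψ)
    (hE : E.Nonempty) {t s : ℝ≥0} (hts : t < s) {u : V × V} (hu : u ∈ expBounded E)
    (hne : Φ t s u ≠ 0) (x : OnePoint E) :
    Tendsto (fun r => ∫ y, ‖P.expTransform r s u y‖ ^ 2 ∂(P.kernel t r x)) (𝓝[>] t)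
      (𝓝 (‖P.expTransform t s u x‖ ^ 2)) := by
  have hne' : ∀ v ∈ Icc t s, Φ v s u ≠ 0 := fun v hv h0 =>
    hne (h.affine.phi_eq_zero_of_le hE hv.1 hv.2 hu h0)
  have htm : t ∈ Icc t s := ⟨le_rfl, hts.le⟩
  set v : ℝ≥0 → V × V := fun r => ((2 : ℝ) • (ψ r s u).1, 0) with hv
  obtain ⟨l, hl⟩ := h.exists_psi_mem_Icc hu hne'
  have hψc := h.continuousOn_left_psi hu hne'
  obtain ⟨R, hR⟩ := isCompact_Icc.exists_bound_of_continuousOn hψc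
  have hvmem : ∀ r ∈ Icc t s, v r ∈ expBoundedBy E (l ^ 2) := by
    intro r hr
    rw [mem_expBoundedBy]
    intro x hx
    have := mem_expBoundedBy.1 (hl r hr) x hx
    rw [hv, real_inner_smul_left, two_mul, Real.exp_add, Nat.cast_pow, sq]
    exact mul_le_mul this this (Real.exp_pos _).le (Nat.cast_nonneg _)
  have hvR : ∀ r ∈ Icc t s, ‖v r‖ ≤ 2 * R := by
    intro r hr
    rw [hv, Prod.norm_mk, norm_zero, max_eq_left (norm_nonneg _), norm_smul]
    have := (norm_fst_le _).trans (hR r hr)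
    norm_num
    exact this
  have hle : 𝓝[>] t ≤ 𝓝[Icc t s] t := nhdsWithin_le_of_mem
    (mem_of_superset (Ioc_mem_nhdsGT hts) Ioc_subset_Icc_self)
  have hmem : ∀ᶠ r in 𝓝[>] t, r ∈ Ioc t s := Ioc_mem_nhdsGT hts
  have hvt : Tendsto v (𝓝[>] t) (𝓝 (v t)) := by
    have h1 : Tendsto (fun r => ψ r s u) (𝓝[>] t) (𝓝 (ψ t s u)) := (hψc t htm).mono_left hle
    have h2 : Continuous fun w : V × V => (((2 : ℝ) • w.1, 0) : V × V) := by fun_prop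
    exact (h2.tendsto _).comp h1
  have hΦt : Tendsto (fun r => Φ r s u) (𝓝[>] t) (𝓝 (Φ t s u)) := by
    have h1 := h.continuousOn_left_phi hu (s := s) t hts.le
    exact h1.mono_left (hle.trans (nhdsWithin_mono _ fun r hr => hr.2))
  -- The arguments v(r) = 2 Re ψ_{r,s}(u) move with r but stay in one bounded part of 𝒰_{l²}, so the
  -- uniform small-time estimate makes P_{t,r} tend to the identity on them.
  have hsmall : ∀ ε : ℝ, 0 < ε → ∀ᶠ r in 𝓝[>] t,
      ‖Φ t r (v r) - 1‖ ≤ ε ∧ ‖ψ t r (v r) - v r‖ ≤ ε := by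
    intro ε hε
    obtain ⟨δ, hδ, hs⟩ := h.exists_small_time hE (l ^ 2) (2 * R) s hε
    filter_upwards [hmem, Ioc_mem_nhdsGT (lt_add_of_pos_right t hδ)] with r hr hr'
    exact hs t r (v r) hr.1.le hr.2 hr'.2 (hvmem r ⟨hr.1.le, hr.2⟩) (hvR r ⟨hr.1.le, hr.2⟩)
  have hΦv : Tendsto (fun r => Φ t r (v r)) (𝓝[>] t) (𝓝 1) := by
    rw [Metric.tendsto_nhds]
    intro ε hε
    filter_upwards [hsmall (ε / 2) (half_pos hε)] with r hr
    rw [dist_eq_norm]; linarith [hr.1]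
  have hψv : Tendsto (fun r => ψ t r (v r)) (𝓝[>] t) (𝓝 (v t)) := by
    have h1 : Tendsto (fun r => ψ t r (v r) - v r) (𝓝[>] t) (𝓝 0) := by
      rw [Metric.tendsto_nhds]
      intro ε hε
      filter_upwards [hsmall (ε / 2) (half_pos hε)] with r hr
      rw [dist_zero_right]; linarith [hr.2]
    simpa using h1.add hvt
  have hlim : Tendsto (fun r => ‖Φ r s u‖ ^ 2 * (Φ t r (v r) * expFun (ψ t r (v r)) x).re)
      (𝓝[>] t) (𝓝 (‖Φ t s u‖ ^ 2 * (1 * expFun (v t) x).re)) :=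
    (hΦt.norm.pow 2).mul ((Complex.continuous_re.tendsto _).comp
      (hΦv.mul (((continuous_expFun x).tendsto _).comp hψv)))
  have hval : ‖P.expTransform t s u x‖ ^ 2 = ‖Φ t s u‖ ^ 2 * (1 * expFun (v t) x).re := by
    rw [h.affine.expTransform_eq hts.le hu, norm_mul, mul_pow, norm_expFun_sq, one_mul]
  rw [hval]
  refine hlim.congr' ?_
  filter_upwards [hmem] with r hr
  have := P.isMarkovKernel t r hr.1.le
  have hvr := expBoundedBy_subset _ (hvmem r ⟨hr.1.le, hr.2⟩)
  have h1 : ∀ y, ‖P.expTransform r s u y‖ ^ 2 = ‖Φ r s u‖ ^ 2 * (expFun (v r) y).re := fun y => by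
    rw [h.affine.expTransform_eq hr.2 hu, norm_mul, mul_pow, norm_expFun_sq]
  simp only [h1]
  rw [integral_const_mul]
  have h2 := integral_re (integrable_expFun hvr (P.kernel t r x))
  simp only [RCLike.re_to_complex] at h2
  rw [h2, ← h.affine.expTransform_eq hr.1.le hvr]
  rfl

end Continuity

/-! ### The Markov property at germ events. -/

section Germ

variable {V : Type*} [NormedAddCommGroup V] [InnerProductSpace ℝ V] [FiniteDimensional ℝ V]
  [MeasurableSpace V] [BorelSpace V] {E : Set V} {P : TransitionFunction E}
  {Φ : ℝ≥0 → ℝ≥0 → V × V → ℂ} {ψ : ℝ≥0 → ℝ≥0 → V × V → V × V}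
  {Ω : Type*} {mΩ : MeasurableSpace Ω} {X : ℝ≥0 → Ω → OnePoint E} {ℱ : Filtration ℝ≥0 mΩ}
  {μ : Measure Ω}

/-- Conditionally on X_t, the mean of P_{r,s}f_u(X_r) is P_{t,s}f_u(X_t), so the mean squared
difference is a difference of second moments. -/
lemma IsAffineData.integral_norm_sub_sq_eq (h : IsAffineData P Φ ψ)
    (hM : IsMarkovProcess X ℱ μ P) {t r s : ℝ≥0} (htr : t ≤ r) (hrs : r ≤ s) {u : V × V} {k : ℕ}
    (hu : u ∈ expBoundedBy E k) :
    ∫ ω, ‖P.expTransform r s u (X r ω) - P.expTransform t s u (X t ω)‖ ^ 2 ∂μ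
      = ∫ x, (∫ y, ‖P.expTransform r s u y‖ ^ 2 ∂(P.kernel t r x) - ‖P.expTransform t s u x‖ ^ 2)
        ∂(μ.map (X t)) := by
  have := hM.isProbabilityMeasure
  have := P.isMarkovKernel t r htr
  have hu' := expBoundedBy_subset k hu
  have mr := h.measurable_expTransform hrs hu'
  have mt := h.measurable_expTransform (htr.trans hrs) hu'
  have hm : Measurable fun p : OnePoint E × OnePoint E =>
      ‖P.expTransform r s u p.2 - P.expTransform t s u p.1‖ ^ 2 :=
    ((mr.comp measurable_snd).sub (mt.comp measurable_fst)).norm.pow_const 2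
  have hpair : Measurable fun ω => (X t ω, X r ω) := (hM.measurable t).prodMk (hM.measurable r)
  have hprob : IsProbabilityMeasure (μ.map (X t)) :=
    Measure.isProbabilityMeasure_map (hM.measurable t).aemeasurable
  have h1 : ∫ ω, ‖P.expTransform r s u (X r ω) - P.expTransform t s u (X t ω)‖ ^ 2 ∂μ
      = ∫ p, ‖P.expTransform r s u p.2 - P.expTransform t s u p.1‖ ^ 2
        ∂((μ.map (X t)) ⊗ₘ (P.kernel t r)) := by
    rw [← hM.map_prod_eq htr, integral_map hpair.aemeasurable hm.aestronglyMeasurable]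
  rw [h1, Measure.integral_compProd]
  · refine integral_congr_ae (ae_of_all _ fun x => ?_)
    simp only
    rw [integral_norm_sub_sq mr (fun y => P.norm_expTransform_le hrs hu y),
      ← P.expTransform_comp htr hrs hu', Complex.star_def, Complex.mul_conj']
    norm_cast
    ring
  · refine Integrable.of_bound hm.aestronglyMeasurable ((k + k : ℝ) ^ 2) (ae_of_all _ fun p => ?_)
    rw [norm_pow, norm_norm]
    exact pow_le_pow_left₀ (norm_nonneg _) ((norm_sub_le _ _).trans
      (add_le_add (P.norm_expTransform_le hrs hu _)
        (P.norm_expTransform_le (htr.trans hrs) hu _))) 2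

lemma IsAffineData.tendsto_integral_norm_sub_sq (h : IsAffineData P Φ ψ) (hE : E.Nonempty)
    (hM : IsMarkovProcess X ℱ μ P) {t s : ℝ≥0} (hts : t < s) {u : V × V}
    (hu : u ∈ expBounded E) (hne : Φ t s u ≠ 0) :
    Tendsto (fun r => ∫ ω, ‖P.expTransform r s u (X r ω) - P.expTransform t s u (X t ω)‖ ^ 2 ∂μ)
      (𝓝[>] t) (𝓝 0) := by
  have := hM.isProbabilityMeasure
  have hprob : IsProbabilityMeasure (μ.map (X t)) :=
    Measure.isProbabilityMeasure_map (hM.measurable t).aemeasurable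
  obtain ⟨k, hk⟩ := exists_mem_expBoundedBy hu
  have hmem : ∀ᶠ r in 𝓝[>] t, r ∈ Ioc t s := Ioc_mem_nhdsGT hts
  have mt := h.measurable_expTransform hts.le hu
  have hb : ∀ r, r ≤ s → ∀ y, ‖‖P.expTransform r s u y‖ ^ 2‖ ≤ (k : ℝ) ^ 2 := fun r hr y => by
    rw [norm_pow, norm_norm]
    exact pow_le_pow_left₀ (norm_nonneg _) (P.norm_expTransform_le hr hk y) 2
  have key : Tendsto (fun r => ∫ x, (∫ y, ‖P.expTransform r s u y‖ ^ 2 ∂(P.kernel t r x)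
      - ‖P.expTransform t s u x‖ ^ 2) ∂(μ.map (X t))) (𝓝[>] t)
      (𝓝 (∫ _, (0 : ℝ) ∂(μ.map (X t)))) := by
    refine tendsto_integral_filter_of_dominated_convergence (fun _ => (k : ℝ) ^ 2 + (k : ℝ) ^ 2)
      ?_ ?_ (integrable_const _) (ae_of_all _ fun x => ?_)
    · filter_upwards [hmem] with r hr
      have := P.isMarkovKernel t r hr.1.le
      have m1 : StronglyMeasurable fun y => ‖P.expTransform r s u y‖ ^ 2 :=
        ((h.measurable_expTransform hr.2 hu).norm.pow_const 2).stronglyMeasurable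
      exact ((m1.integral_kernel (κ := P.kernel t r)).sub
        (mt.norm.pow_const 2).stronglyMeasurable).aestronglyMeasurable
    · filter_upwards [hmem] with r hr
      have := P.isMarkovKernel t r hr.1.le
      refine ae_of_all _ fun x => (norm_sub_le _ _).trans (add_le_add ?_ (hb t hts.le x))
      exact (norm_integral_le_of_norm_le_const (ae_of_all _ fun y => hb r hr.2 y)).trans (by simp)
    · have := (h.tendsto_integral_norm_expTransform_sq hE hts hu hne x).sub_const
        (‖P.expTransform t s u x‖ ^ 2)
      simpa using this
  rw [integral_zero] at key
  refine key.congr' ?_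
  filter_upwards [hmem] with r hr
  exact (h.integral_norm_sub_sq_eq hM hr.1.le hr.2 hk).symm

lemma integral_expFun_comp_kernel {t s : ℝ≥0} (hts : t ≤ s) {u : V × V} (hu : u ∈ expBounded E)
    (κ : Measure (OnePoint E)) [IsFiniteMeasure κ] :
    ∫ y, expFun u y ∂((P.kernel t s) ∘ₘ κ) = ∫ x, P.expTransform t s u x ∂κ := by
  have := P.isMarkovKernel t s hts
  exact integral_comp_measure (integrable_expFun hu _)

/-- The Markov property at germ events for the functions `f_u` with nonvanishing transform. -/
lemma IsAffineData.integral_expFun_germ_of_ne_zero (h : IsAffineData P Φ ψ) (hE : E.Nonempty)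
    (hM : IsMarkovProcess X ℱ μ P) {t s : ℝ≥0} (hts : t < s) {A : Set Ω}
    (hA : IsGermEvent ℱ μ t A) {u : V × V} (hu : u ∈ expBounded E) (hne : Φ t s u ≠ 0) :
    ∫ y, expFun u y ∂((μ.restrict A).map (X s))
      = ∫ x, P.expTransform t s u x ∂((μ.restrict A).map (X t)) := by
  have := hM.isProbabilityMeasure
  obtain ⟨k, hk⟩ := exists_mem_expBoundedBy hu
  have mt := h.measurable_expTransform hts.le hu
  set D := ∫ y, expFun u y ∂((μ.restrict A).map (X s))
    - ∫ x, P.expTransform t s u x ∂((μ.restrict A).map (X t)) with hD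
  -- D does not depend on r: the Markov property at r > t rewrites the law of X_s on A. The
  -- elementary bound a ≤ ε/2 + a²/(2ε) then turns L² convergence into smallness of D.
  have hbound : ∀ ε : ℝ, 0 < ε → ∀ r, t < r → r ≤ s → ‖D‖ ≤ ε / 2
      + (∫ ω, ‖P.expTransform r s u (X r ω) - P.expTransform t s u (X t ω)‖ ^ 2 ∂μ) / (2 * ε) := by
    intro ε hε r htr hrs
    obtain ⟨B, hB, hAB⟩ := hA r htr
    have mr := h.measurable_expTransform hrs hu
    have hdm : Measurable fun ω => P.expTransform r s u (X r ω) - P.expTransform t s u (X t ω) :=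
      (mr.comp (hM.measurable r)).sub (mt.comp (hM.measurable t))
    have ir : Integrable (fun ω => P.expTransform r s u (X r ω)) μ :=
      Integrable.of_bound (mr.comp (hM.measurable r)).aestronglyMeasurable k
        (ae_of_all _ fun ω => P.norm_expTransform_le hrs hk _)
    have it : Integrable (fun ω => P.expTransform t s u (X t ω)) μ :=
      Integrable.of_bound (mt.comp (hM.measurable t)).aestronglyMeasurable k
        (ae_of_all _ fun ω => P.norm_expTransform_le hts.le hk _)
    have hDr : D = ∫ ω in A, (P.expTransform r s u (X r ω) - P.expTransform t s u (X t ω)) ∂μ := by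
      rw [hD, hM.map_restrict_eq hrs hB hAB, integral_expFun_comp_kernel hrs hu,
        integral_map (hM.measurable r).aemeasurable mr.aestronglyMeasurable,
        integral_map (hM.measurable t).aemeasurable mt.aestronglyMeasurable,
        integral_sub ir.integrableOn it.integrableOn]
    have isq : Integrable (fun ω => ‖P.expTransform r s u (X r ω)
        - P.expTransform t s u (X t ω)‖ ^ 2) μ := by
      refine Integrable.of_bound (hdm.norm.pow_const 2).aestronglyMeasurable ((k + k : ℝ) ^ 2)
        (ae_of_all _ fun ω => ?_)
      rw [norm_pow, norm_norm]
      exact pow_le_pow_left₀ (norm_nonneg _) ((norm_sub_le _ _).trans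
        (add_le_add (P.norm_expTransform_le hrs hk _) (P.norm_expTransform_le hts.le hk _))) 2
    have irhs : Integrable (fun ω => ε / 2 + ‖P.expTransform r s u (X r ω)
        - P.expTransform t s u (X t ω)‖ ^ 2 / (2 * ε)) μ :=
      (integrable_const _).add (isq.div_const _)
    calc ‖D‖ ≤ ∫ ω in A, ‖P.expTransform r s u (X r ω) - P.expTransform t s u (X t ω)‖ ∂μ := by
          rw [hDr]; exact norm_integral_le_integral_norm _
      _ ≤ ∫ ω, ‖P.expTransform r s u (X r ω) - P.expTransform t s u (X t ω)‖ ∂μ :=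
          setIntegral_le_integral (ir.sub it).norm (ae_of_all _ fun ω => norm_nonneg _)
      _ ≤ ∫ ω, (ε / 2 + ‖P.expTransform r s u (X r ω)
            - P.expTransform t s u (X t ω)‖ ^ 2 / (2 * ε)) ∂μ := by
          refine integral_mono (ir.sub it).norm irhs fun ω => ?_
          simp only
          generalize ‖P.expTransform r s u (X r ω) - P.expTransform t s u (X t ω)‖ = a
          have : ε / 2 + a ^ 2 / (2 * ε) - a = (ε - a) ^ 2 / (2 * ε) := by field_simp; ring
          have h2 : 0 ≤ (ε - a) ^ 2 / (2 * ε) := by positivity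
          linarith
      _ = _ := by
          rw [integral_add (integrable_const _) (isq.div_const _), integral_const,
            probReal_univ, one_smul, integral_div]
  have hlim := h.tendsto_integral_norm_sub_sq hE hM hts hu hne
  have hfin : ∀ ε : ℝ, 0 < ε → ‖D‖ ≤ ε / 2 := by
    intro ε hε
    have h1 := (hlim.div_const (2 * ε)).const_add (ε / 2)
    rw [zero_div, add_zero] at h1
    refine ge_of_tendsto h1 ?_
    filter_upwards [Ioc_mem_nhdsGT hts] with r hr using hbound ε hε r hr.1 hr.2
  rw [← sub_eq_zero, ← hD, ← norm_le_zero_iff]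
  exact le_of_forall_pos_le_add fun ε hε => by
    have := hfin ε hε
    linarith

/-- The Markov property at germ events. -/
lemma IsAffineData.map_restrict_germ_eq (h : IsAffineData P Φ ψ) (hE : IsClosed E) {ι : Type*}
    [Fintype ι] [Nonempty ι] (b : AffineBasis ι ℝ V) (hb : range b ⊆ E)
    (hM : IsMarkovProcess X ℱ μ P) {t s : ℝ≥0} (hts : t ≤ s) {A : Set Ω}
    (hA : IsGermEvent ℱ μ t A) :
    (μ.restrict A).map (X s) = (P.kernel t s) ∘ₘ ((μ.restrict A).map (X t)) := by
  have := hM.isProbabilityMeasure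
  rcases hts.eq_or_lt with rfl | hlt
  · rw [P.refl, Measure.id_comp]
  have hEne : E.Nonempty := ⟨_, hb (mem_range_self (Classical.arbitrary ι))⟩
  have hker : ∀ w, IsMarkovKernel (P.kernel t (max t w)) := fun w =>
    P.isMarkovKernel t _ (le_max_left _ _)
  set κ₁ : ℝ≥0 → Measure (OnePoint E) := fun w => (μ.restrict A).map (X w) with hκ₁
  -- Only w ≥ t matters; the maximum makes the kernel Markov, hence the measure finite, for every w.
  set κ₂ : ℝ≥0 → Measure (OnePoint E) := fun w => (P.kernel t (max t w)) ∘ₘ (κ₁ t) with hκ₂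
  have hfin₁ : ∀ w, IsFiniteMeasure (κ₁ w) := fun w => by simp only [hκ₁]; infer_instance
  have hfin₂ : ∀ w, IsFiniteMeasure (κ₂ w) := fun w => by simp only [hκ₂]; infer_instance
  have hmax : ∀ w, t ≤ w → κ₂ w = (P.kernel t w) ∘ₘ (κ₁ t) := fun w hw => by
    simp only [hκ₂, max_eq_right hw]
  change κ₁ s = (P.kernel t s) ∘ₘ (κ₁ t)
  rw [← hmax s hts]
  refine ext_of_integral_expFun hE ?_ fun c => ?_
  · rw [hmax s hts, Measure.bind_apply MeasurableSet.univ (Kernel.aemeasurable _)]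
    have := P.isMarkovKernel t s hts
    simp only [hκ₁, measure_univ, lintegral_one]
    rw [Measure.map_apply (hM.measurable s) MeasurableSet.univ,
      Measure.map_apply (hM.measurable t) MeasurableSet.univ]
    rfl
  · refine h.integral_expFun_eq_of_nonvanishing b hb (t := t) (κ₁ := κ₁) (κ₂ := κ₂) ?_ ?_ ?_ hlt
      (imag_mem_expBounded c)
    · intro w s htw hws u hu
      obtain ⟨B, hB, hAB⟩ := hA w htw
      have h1 : κ₁ s = (P.kernel w s) ∘ₘ (κ₁ w) := hM.map_restrict_eq hws hB hAB
      rw [h1, integral_expFun_comp_kernel hws hu, ← integral_const_mul]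
      exact integral_congr_ae (ae_of_all _ fun y => h.affine.expTransform_eq hws hu y)
    · intro w s htw hws u hu
      have h1 : κ₂ s = (P.kernel w s) ∘ₘ (κ₂ w) := by
        rw [hmax s (htw.le.trans hws), hmax w htw.le, Measure.comp_assoc,
          P.comp_of_le htw.le hws]
      rw [h1, integral_expFun_comp_kernel hws hu, ← integral_const_mul]
      exact integral_congr_ae (ae_of_all _ fun y => h.affine.expTransform_eq hws hu y)
    · intro s hts u hu hne
      rw [hmax s hts.le, integral_expFun_comp_kernel hts.le hu]
      exact h.integral_expFun_germ_of_ne_zero hEne hM hts hA hu hne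

end Germ

end AffineProcess

/-! ### From the Markov property at germ events to right-continuity. -/

namespace AffineProcess

/-- The measures with densities f and g agree on m, hence they integrate m-measurable weights
equally. -/
lemma lintegral_mul_eq_of_setLIntegral_eq {Ω : Type*} {m mΩ : MeasurableSpace Ω} (hm : m ≤ mΩ)
    {μ : Measure Ω} {f g k : Ω → ENNReal} (hf : Measurable f) (hg : Measurable g)
    (hfg : ∀ B, MeasurableSet[m] B → ∫⁻ ω in B, f ω ∂μ = ∫⁻ ω in B, g ω ∂μ)
    (hk : Measurable[m] k) : ∫⁻ ω, k ω * f ω ∂μ = ∫⁻ ω, k ω * g ω ∂μ := by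
  have h1 : (μ.withDensity f).trim hm = (μ.withDensity g).trim hm := by
    refine @Measure.ext _ m _ _ fun B hB => ?_
    rw [trim_measurableSet_eq hm hB, trim_measurableSet_eq hm hB, withDensity_apply _ (hm _ hB),
      withDensity_apply _ (hm _ hB), hfg B hB]
  have h2 := lintegral_trim (μ := μ.withDensity f) hm hk
  rw [h1, lintegral_trim hm hk, lintegral_withDensity_eq_lintegral_mul _ hf (hk.mono hm le_rfl),
    lintegral_withDensity_eq_lintegral_mul _ hg (hk.mono hm le_rfl)] at h2
  simpa only [Pi.mul_apply, mul_comm] using h2.symm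

section Germ

variable {E : Type*} [MeasurableSpace E] {Ω : Type*} {mΩ : MeasurableSpace Ω}
  {X : ℝ≥0 → Ω → OnePoint E} {ℱ : Filtration ℝ≥0 mΩ} {μ : Measure Ω} {P : TransitionFunction E}

lemma IsGermEvent.mono {r t : ℝ≥0} (hrt : r ≤ t) {A : Set Ω} (hA : IsGermEvent ℱ μ r A) :
    IsGermEvent ℱ μ t A := fun s hs => hA s (hrt.trans_lt hs)

lemma isGermEvent_of_measurableSet {t : ℝ≥0} {A : Set Ω} (hA : MeasurableSet[ℱ t] A) :
    IsGermEvent ℱ μ t A := fun _ hs => ⟨A, ℱ.mono hs.le A hA, EventuallyEq.rfl⟩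

lemma IsGermEvent.inter {t : ℝ≥0} {A A' : Set Ω} (hA : IsGermEvent ℱ μ t A)
    (hA' : IsGermEvent ℱ μ t A') : IsGermEvent ℱ μ t (A ∩ A') := fun s hs => by
  obtain ⟨B, hB, hAB⟩ := hA s hs
  obtain ⟨B', hB', hAB'⟩ := hA' s hs
  exact ⟨B ∩ B', hB.inter hB', hAB.inter hAB'⟩

lemma IsGermEvent.congr {t : ℝ≥0} {A A' : Set Ω} (hA : IsGermEvent ℱ μ t A)
    (h : A' =ᵐ[μ] A) : IsGermEvent ℱ μ t A' := fun s hs => by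
  obtain ⟨B, hB, hAB⟩ := hA s hs
  exact ⟨B, hB, h.trans hAB⟩

/-- The Markov property at germ events. -/
def HasGermMarkovProperty (X : ℝ≥0 → Ω → OnePoint E) (ℱ : Filtration ℝ≥0 mΩ) (μ : Measure Ω)
    (P : TransitionFunction E) : Prop :=
  ∀ t s, t ≤ s → ∀ A, IsGermEvent ℱ μ t A →
    (μ.restrict A).map (X s) = (P.kernel t s) ∘ₘ ((μ.restrict A).map (X t))

/-- Given the state at time `r`, the probability of a future cylinder event is the same on all
germ events. -/
lemma HasGermMarkovProperty.exists_cylinder (hG : HasGermMarkovProperty X ℱ μ P)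
    (hX : ∀ t, Measurable[ℱ t] (X t)) (B : ℝ≥0 → Set (OnePoint E)) (S : Finset ℝ≥0) :
    ∀ r, (∀ a ∈ S, r ≤ a) → (∀ a ∈ S, MeasurableSet (B a)) →
      ∃ G : OnePoint E → ENNReal, Measurable G ∧ ∀ A, IsGermEvent ℱ μ r A →
        μ (A ∩ ⋂ a ∈ S, X a ⁻¹' B a) = ∫⁻ ω in A, G (X r ω) ∂μ := by
  have hXm : ∀ t, Measurable (X t) := fun t => (hX t).mono (ℱ.le t) le_rfl
  induction S using Finset.induction_on_min with
  | empty => exact fun r _ _ => ⟨fun _ => 1, measurable_const, fun A _ => by simp⟩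
  | insert a S hlt ih =>
    intro r hr hB
    have hra : r ≤ a := hr a (Finset.mem_insert_self a S)
    have hBa : MeasurableSet (B a) := hB a (Finset.mem_insert_self a S)
    -- The earliest time a is peeled off. The set A ∩ {X_a ∈ B_a} is a germ event at a, so the
    -- induction hypothesis applies to it.
    obtain ⟨G, hGm, hGe⟩ := ih a (fun x hx => (hlt x hx).le)
      (fun x hx => hB x (Finset.mem_insert_of_mem hx))
    refine ⟨fun x => ∫⁻ y, (B a).indicator G y ∂(P.kernel r a x),
      (hGm.indicator hBa).lintegral_kernel, fun A hA => ?_⟩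
    have hmeas : MeasurableSet[ℱ a] (X a ⁻¹' B a) := hX a hBa
    have h1 := hGe (A ∩ X a ⁻¹' B a) ((hA.mono hra).inter (isGermEvent_of_measurableSet hmeas))
    rw [Finset.set_biInter_insert, ← inter_assoc, h1]
    calc ∫⁻ ω in A ∩ X a ⁻¹' B a, G (X a ω) ∂μ
        = ∫⁻ ω in A, (X a ⁻¹' B a).indicator (fun ω => G (X a ω)) ω ∂μ := by
          rw [lintegral_indicator (hXm a hBa), Measure.restrict_restrict (hXm a hBa), inter_comm]
      _ = ∫⁻ y, (B a).indicator G y ∂((μ.restrict A).map (X a)) := by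
          rw [lintegral_map (hGm.indicator hBa) (hXm a)]
          rfl
      _ = _ := by
          rw [hG r a hra A hA, Measure.lintegral_bind (Kernel.aemeasurable _)
            (hGm.indicator hBa).aemeasurable,
            lintegral_map (hGm.indicator hBa).lintegral_kernel (hXm r)]

/-- The germ events at time `t` belong to the completion of `ℱ t`. -/
lemma HasGermMarkovProperty.exists_measurableSet_ae_eq {hX : ∀ t, Measurable (X t)}
    (hΩ : mΩ = processSigma X) [IsFiniteMeasure μ]
    (hG : HasGermMarkovProperty X (naturalFiltration X hX) μ P) {t : ℝ≥0} {A : Set Ω}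
    (hA : IsGermEvent (naturalFiltration X hX) μ t A) :
    ∃ B, MeasurableSet[naturalFiltration X hX t] B ∧ A =ᵐ[μ] B := by
  set ℱ := naturalFiltration X hX with hℱ
  have hXad : ∀ t, Measurable[ℱ t] (X t) := fun t =>
    Measurable.mono (comap_measurable (X t))
      (le_iSup₂_of_le (f := fun s (_ : s ≤ t) => MeasurableSpace.comap (X s) inferInstance)
        t le_rfl le_rfl) le_rfl
  obtain ⟨A₀, hA₀m, hA₀⟩ : ∃ A₀, MeasurableSet A₀ ∧ A =ᵐ[μ] A₀ := by
    obtain ⟨B, hB, hAB⟩ := hA (t + 1) (by simp)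
    exact ⟨B, ℱ.le _ _ hB, hAB⟩
  have hA₀g : IsGermEvent ℱ μ t A₀ := hA.congr hA₀.symm
  have hle : ℱ t ≤ mΩ := ℱ.le t
  obtain ⟨h, hhm, hh⟩ : ∃ h : Ω → ENNReal, Measurable[ℱ t] h ∧ ∀ B, MeasurableSet[ℱ t] B →
      ∫⁻ ω in B, A₀.indicator 1 ω ∂μ = ∫⁻ ω in B, h ω ∂μ :=
    ⟨condLExp (ℱ t) μ (A₀.indicator 1), measurable_condLExp _ _ _, fun B hB =>
      (setLIntegral_condLExp hle μ _ hB).symm⟩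
  have hhm' : Measurable h := hhm.mono hle le_rfl
  have hind : Measurable (A₀.indicator (1 : Ω → ENNReal)) := measurable_one.indicator hA₀m
  -- h is the conditional probability of A₀ given F_t. The identity says that it is also the
  -- conditional probability given the whole process, that is, the indicator of A₀; cylinder sets
  -- suffice because they generate the σ-algebra.
  have key : μ.restrict A₀ = μ.withDensity h := by
    refine ext_of_generate_finite (piiUnionInter (fun n : ℝ≥0 =>
      { s | MeasurableSet[MeasurableSpace.comap (X n) inferInstance] s }) univ) ?_ ?_ ?_ ?_
    · refine hΩ.trans (Eq.trans ?_ (generateFrom_piiUnionInter_measurableSet (fun n : ℝ≥0 =>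
        MeasurableSpace.comap (X n) inferInstance) univ).symm)
      simp [processSigma]
    · exact isPiSystem_piiUnionInter _ (fun n =>
        @MeasurableSpace.isPiSystem_measurableSet _ (MeasurableSpace.comap (X n) inferInstance)) _
    · rintro C ⟨S, -, f, hf, rfl⟩
      have hf' : ∀ a ∈ S, ∃ B, MeasurableSet B ∧ X a ⁻¹' B = f a := hf
      choose! B hBm hBf using hf'
      have hsplit : (⋂ a ∈ S, f a) = (⋂ a ∈ S.filter (· ≤ t), X a ⁻¹' B a)
          ∩ ⋂ a ∈ S.filter (t < ·), X a ⁻¹' B a := by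
        ext ω
        simp only [mem_inter_iff, mem_iInter, Finset.mem_filter]
        refine ⟨fun H => ⟨fun a ha => ?_, fun a ha => ?_⟩, fun H a ha => ?_⟩
        · exact (hBf a ha.1).symm ▸ H a ha.1
        · exact (hBf a ha.1).symm ▸ H a ha.1
        · rw [← hBf a ha]
          rcases le_or_gt a t with hat | hat
          · exact H.1 a ⟨ha, hat⟩
          · exact H.2 a ⟨ha, hat⟩
      set C₁ := ⋂ a ∈ S.filter (· ≤ t), X a ⁻¹' B a with hC₁
      set C₂ := ⋂ a ∈ S.filter (t < ·), X a ⁻¹' B a with hC₂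
      have hC₁m : MeasurableSet[ℱ t] C₁ := Finset.measurableSet_biInter _ fun a ha =>
        ℱ.mono (Finset.mem_filter.1 ha).2 _ (hXad a (hBm a (Finset.mem_filter.1 ha).1))
      have hC₁m' : MeasurableSet C₁ := hle _ hC₁m
      have hC₂m : MeasurableSet C₂ := Finset.measurableSet_biInter _ fun a ha =>
        hX a (hBm a (Finset.mem_filter.1 ha).1)
      obtain ⟨G, hGm, hGe⟩ := hG.exists_cylinder hXad B (S.filter (t < ·)) t
        (fun a ha => (Finset.mem_filter.1 ha).2.le) (fun a ha => hBm a (Finset.mem_filter.1 ha).1)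
      have hGX : Measurable[ℱ t] fun ω => G (X t ω) := hGm.comp (hXad t)
      have hGX' : Measurable fun ω => G (X t ω) := hGm.comp (hX t)
      have hind₂ : Measurable (C₂.indicator (1 : Ω → ENNReal)) := measurable_one.indicator hC₂m
      have hfut : ∀ D, MeasurableSet[ℱ t] D →
          ∫⁻ ω in D, C₂.indicator 1 ω ∂μ = ∫⁻ ω in D, G (X t ω) ∂μ := fun D hD => by
        rw [← hGe D (isGermEvent_of_measurableSet hD), lintegral_indicator_one hC₂m,
          Measure.restrict_apply hC₂m, inter_comm]
      rw [hsplit, Measure.restrict_apply (hC₁m'.inter hC₂m), withDensity_apply _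
        (hC₁m'.inter hC₂m)]
      -- The future part C₂ is replaced by G(X_t), using the germ Markov property on A₀ ∩ C₁; A₀ is
      -- then replaced by h; finally G(X_t) is turned back into C₂, all other factors being
      -- F_t-measurable.
      calc μ (C₁ ∩ C₂ ∩ A₀) = μ ((A₀ ∩ C₁) ∩ C₂) := by
            rw [inter_comm, inter_assoc]
        _ = ∫⁻ ω in A₀ ∩ C₁, G (X t ω) ∂μ :=
            hGe _ (hA₀g.inter (isGermEvent_of_measurableSet hC₁m))
        _ = ∫⁻ ω, C₁.indicator (fun ω => G (X t ω)) ω * A₀.indicator 1 ω ∂μ := by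
            rw [← lintegral_indicator (hA₀m.inter hC₁m')]
            refine lintegral_congr fun ω => ?_
            by_cases h1 : ω ∈ A₀ <;> by_cases h2 : ω ∈ C₁ <;> simp [h1, h2]
        _ = ∫⁻ ω, C₁.indicator (fun ω => G (X t ω)) ω * h ω ∂μ :=
            lintegral_mul_eq_of_setLIntegral_eq hle hind hhm' hh (hGX.indicator hC₁m)
        _ = ∫⁻ ω, C₁.indicator h ω * G (X t ω) ∂μ := by
            refine lintegral_congr fun ω => ?_
            by_cases h2 : ω ∈ C₁ <;> simp [h2, mul_comm]
        _ = ∫⁻ ω, C₁.indicator h ω * C₂.indicator 1 ω ∂μ :=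
            (lintegral_mul_eq_of_setLIntegral_eq hle hind₂ hGX' hfut (hhm.indicator hC₁m)).symm
        _ = ∫⁻ ω in C₁ ∩ C₂, h ω ∂μ := by
            rw [← lintegral_indicator (hC₁m'.inter hC₂m)]
            refine lintegral_congr fun ω => ?_
            by_cases h1 : ω ∈ C₁ <;> by_cases h2 : ω ∈ C₂ <;> simp [h1, h2]
    · have := hh univ MeasurableSet.univ
      rw [lintegral_indicator hA₀m] at this
      simpa using this
  have hae : A₀.indicator 1 =ᵐ[μ] h := by
    refine ae_eq_of_forall_setLIntegral_eq_of_sigmaFinite hind hhm' fun s hs _ => ?_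
    have := congrArg (fun ν => ν s) key
    simp only [withDensity_apply _ hs, Measure.restrict_apply hs] at this
    rw [← this, lintegral_indicator hA₀m, Measure.restrict_restrict hA₀m]
    simp [inter_comm]
  refine ⟨h ⁻¹' {1}, hhm (measurableSet_singleton 1), hA₀.trans ?_⟩
  filter_upwards [hae] with ω hω
  refine propext ?_
  change ω ∈ A₀ ↔ h ω = 1
  rw [← hω]
  by_cases hm : ω ∈ A₀ <;> simp [hm]

lemma HasGermMarkovProperty.isRightContinuous {hX : ∀ t, Measurable (X t)}
    (hΩ : mΩ = processSigma X) [IsFiniteMeasure μ]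
    (hG : HasGermMarkovProperty X (naturalFiltration X hX) μ P) :
    (completedFiltration (naturalFiltration X hX) μ).IsRightContinuous := by
  refine ⟨fun t A hA => ?_⟩
  rw [Filtration.rightCont_eq] at hA
  simp only [MeasurableSpace.measurableSet_iInf] at hA
  exact hG.exists_measurableSet_ae_eq hΩ fun s hs => hA s hs

end Germ

/-! ### Time shift and conclusion. -/

section Shift

variable {E : Type*} [MeasurableSpace E]

/-- The transition function with time shifted by `r`. -/
noncomputable def TransitionFunction.shift (P : TransitionFunction E) (r : ℝ≥0) :
    TransitionFunction E where
  kernel s t := P.kernel (r + s) (r + t)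
  isMarkovKernel s t hst := P.isMarkovKernel _ _ (by gcongr)
  absorbing s t hst := P.absorbing _ _ (by gcongr)
  refl s := P.refl _
  comp s u t hsu hut := P.comp _ _ _ (by gcongr) (by gcongr)

/-- Starting at absolute time r only shifts the kernels, so the statement about families reduces to
the one for a single measure. -/
lemma IsMarkovFamily.isMarkovProcess {Ω : Type*} {mΩ : MeasurableSpace Ω}
    {X : ℝ≥0 → Ω → OnePoint E} {ℱ : Filtration ℝ≥0 mΩ} {Pr : ℝ≥0 → OnePoint E → Measure Ω}
    {P : TransitionFunction E} (hM : IsMarkovFamily X ℱ Pr P) (r : ℝ≥0) (x : OnePoint E) :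
    IsMarkovProcess X ℱ (Pr r x) (P.shift r) where
  isProbabilityMeasure := hM.isProbabilityMeasure r x
  adapted := hM.adapted
  staysInCemetery := hM.staysInCemetery
  markov s t hst f hf hb := by
    have h := hM.markov r x s (t - s) f hf hb
    rwa [tsub_add_cancel_of_le hst.le, add_assoc, add_tsub_cancel_of_le hst.le] at h

end Shift

section Affine

variable {V : Type*} [NormedAddCommGroup V] [InnerProductSpace ℝ V] [FiniteDimensional ℝ V]
  [MeasurableSpace V] [BorelSpace V] {E : Set V} {P : TransitionFunction E}
  {Φ : ℝ≥0 → ℝ≥0 → V × V → ℂ} {ψ : ℝ≥0 → ℝ≥0 → V × V → V × V}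

/-- The normalization of ψ is recorded on the whole diagonal rather than at time 0, which makes the
data invariant under the shift. -/
lemma IsAffineData.shift (h : IsAffineData P Φ ψ) (r : ℝ≥0) :
    IsAffineData (P.shift r) (fun s t => Φ (r + s) (r + t)) (fun s t => ψ (r + s) (r + t)) := by
  have hc : Continuous fun p : ℝ≥0 × ℝ≥0 × (V × V) => (r + p.1, r + p.2.1, p.2.2) := by fun_prop
  refine ⟨fun s t hst u hu x => h.affine _ _ (by gcongr) u hu x, fun t u hu => h.diag _ u hu,
    fun k => (h.continuousOn_psi k).comp hc.continuousOn ?_,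
    fun k => (h.continuousOn_phi k).comp hc.continuousOn ?_⟩
  · rintro p ⟨⟨hp, hu⟩, hne⟩
    refine ⟨⟨add_le_add_right hp r, hu⟩, fun v hv hv' => ?_⟩
    have hrv : r ≤ v := le_self_add.trans hv
    have := hne (v - r) (le_tsub_of_add_le_left hv) (tsub_le_iff_left.2 hv')
    simpa only [add_tsub_cancel_of_le hrv] using this
  · rintro p ⟨hp, hu⟩
    exact ⟨add_le_add_right hp r, hu⟩

/-- The completed natural filtration of an affine process is right-continuous. -/
theorem IsAffineData.isRightContinuous (h : IsAffineData P Φ ψ) (hE : IsClosed E) {ι : Type*}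
    [Fintype ι] [Nonempty ι] (b : AffineBasis ι ℝ V) (hb : range b ⊆ E) {Ω : Type*}
    {mΩ : MeasurableSpace Ω} {X : ℝ≥0 → Ω → OnePoint E} {hX : ∀ t, Measurable (X t)}
    (hΩ : mΩ = processSigma X) {μ : Measure Ω}
    (hM : IsMarkovProcess X (naturalFiltration X hX) μ P) :
    (completedFiltration (naturalFiltration X hX) μ).IsRightContinuous := by
  have := hM.isProbabilityMeasure
  refine HasGermMarkovProperty.isRightContinuous (P := P) hΩ fun t s hts A hA => ?_
  exact h.map_restrict_germ_eq hE b hb hM hts hA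

end Affine

end AffineProcess

theorem mainTheorem4 {V : Type*} [NormedAddCommGroup V] [InnerProductSpace ℝ V]
    [FiniteDimensional ℝ V] [MeasurableSpace V] [BorelSpace V]
    (E : Set V) (hE : IsClosed E)
    (hspan : ∃ b : AffineBasis (Fin (Module.finrank ℝ V + 1)) ℝ V, Set.range b ⊆ E)
    (P : AffineProcess.TransitionFunction E) (hP : P.IsContinuouslyAffine)
    {Ω : Type*} [mΩ : MeasurableSpace Ω] (X : ℝ≥0 → Ω → OnePoint E)
    (hX : ∀ t, Measurable (X t)) (hΩ : mΩ = AffineProcess.processSigma X) :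
    (∀ μ : Measure Ω,
      AffineProcess.IsMarkovProcess X (AffineProcess.naturalFiltration X hX) μ P →
      (AffineProcess.completedFiltration
        (AffineProcess.naturalFiltration X hX) μ).IsRightContinuous) ∧
    (∀ Pr : ℝ≥0 → OnePoint E → Measure Ω,
      AffineProcess.IsMarkovFamily X (AffineProcess.naturalFiltration X hX) Pr P →
      ∀ r x, (AffineProcess.completedFiltration
        (AffineProcess.naturalFiltration X hX) (Pr r x)).IsRightContinuous) := by
  obtain ⟨Φ, ψ, φ, haff, -, hψ0, hψ, -, hΦ, -⟩ := hP
  obtain ⟨b, hb⟩ := hspan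
  have h : AffineProcess.IsAffineData P Φ ψ := ⟨haff, fun t u hu =>
    AffineProcess.psi_self haff b hb hψ0 hψ t hu, hψ, hΦ⟩
  exact ⟨fun μ hM => h.isRightContinuous hE b hb hΩ hM,
    fun Pr hM r x => (h.shift r).isRightContinuous hE b hb hΩ (hM.isMarkovProcess r x)⟩
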